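/- There is an absolute constant $C>0$ such that the following holds. Let $\Omega\subset\mathbb{R}^2$ be the interior of an arbitrary non-degenerate (acute, right or obtuse) triangle with sides $A,B,C$; let $L$ be the length of its longest side, and for each side $S\in\{A,B,C\}$ let $\ell_S$ be the corresponding altitude, i.e. the distance from the line containing $S$ to the opposite vertex. Let $u_0,u_1\in H^1_0(\Omega)\cap H^s(\Omega)$ for all $s\ge 0$ be complex valued, and let $u\in C^1([0,\infty);H^1_0(\Omega))\cap C^2([0,\infty);L^2(\Omega))$ solve $$(\partial_t^2-\Delta)u=0\ \text{ in }\Omega,\qquad u|_{\partial\Omega}=0,\qquad u(0,\cdot)=u_0,\quad \partial_tu(0,\cdot)=u_1 .$$ Then the energy $$E(t)=\int_\Omega |\partial_tu|^2+|\nabla u|^2\,dV$$ is conserved, $E(t)=E(0)$ for all $t\ge0$; for every $t\ge 0$ the normal derivative $\partial_\nu u(t)$ (defined by Green's formula $\int_{\partial\Omega}\partial_\nu u\,\varphi\,dS=\int_\Omega\nabla u\cdot\nabla\varphi+(\Delta u)\varphi\,dV$ for all smooth $\varphi$ on $\mathbb{R}^2$) exists in $L^2(\partial\Omega)$, $dS$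 being arclength; and for every $T>0$ and every side $S\in\{A,B,C\}$, $$\int_0^T\int_S|\partial_\nu u|^2\,dS\,dt=\frac{T}{\ell_S}\,E(0)\,(1+r)\quad\text{with}\quad |r|\le C\,\frac{L}{T}$$ (where $r$ may depend on $\Omega$, $u$, $S$ and $T$). -/

import Mathlib

open MeasureTheory Set
open scoped ContDiff ENNReal

noncomputable section

namespace TriangleWave

/-- The Euclidean plane. -/
abbrev Plane := EuclideanSpace ℝ (Fin 2)

/-- The complex Hilbert space `L²(Ω)`, with respect to Lebesgue measure on `Ω`. -/
abbrev L2 (Ω : Set Plane) := Lp ℂ 2 ((volume : Measure Plane).restrict Ω)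

/-- The classical partial derivative `∂ᵢ φ`. -/
def pderiv (i : Fin 2) (φ : Plane → ℂ) (x : Plane) : ℂ :=
  fderiv ℝ φ x (EuclideanSpace.single i 1)

/-- Test functions on `Ω`: smooth functions with compact support contained in `Ω`. -/
def IsTest (Ω : Set Plane) (φ : Plane → ℂ) : Prop :=
  ContDiff ℝ ∞ φ ∧ HasCompactSupport φ ∧ tsupport φ ⊆ Ω

/-- `g` is the weak (distributional) partial derivative `∂ᵢ f` on `Ω`. -/
def IsWeakPartial (Ω : Set Plane) (i : Fin 2) (f g : L2 Ω) : Prop :=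
  ∀ φ : Plane → ℂ, IsTest Ω φ →
    ∫ x in Ω, f x * pderiv i φ x = -∫ x in Ω, g x * φ x

/-- The Sobolev space `H^k(Ω)`, `k ∈ ℕ`: all weak derivatives of order at most `k` exist and are
in `L²(Ω)`. -/
def MemSobolev (Ω : Set Plane) : ℕ → L2 Ω → Prop
  | 0, _ => True
  | k + 1, f => ∀ i : Fin 2, ∃ g : L2 Ω, IsWeakPartial Ω i f g ∧ MemSobolev Ω k g

/-- `f` lies in `H^s(Ω)` for all `s ≥ 0`. -/
def MemSobolevAll (Ω : Set Plane) (f : L2 Ω) : Prop := ∀ k : ℕ, MemSobolev Ω k f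

/-- The set of pairs `(φ, ∇φ)`, `φ` a test function on `Ω`, in `L²(Ω) × L²(Ω)²`. -/
def testGraph (Ω : Set Plane) : Set (L2 Ω × (Fin 2 → L2 Ω)) :=
  {p | ∃ φ : Plane → ℂ, IsTest Ω φ ∧
    (p.1 : Plane → ℂ) =ᵐ[volume.restrict Ω] φ ∧
    ∀ i : Fin 2, (p.2 i : Plane → ℂ) =ᵐ[volume.restrict Ω] pderiv i φ}

/-- The space `H¹₀(Ω)`, the closure of the test functions in the `H¹` norm. Its elements are
written as pairs `(f, ∇f)`. -/
def H10 (Ω : Set Plane) : Set (L2 Ω × (Fin 2 → L2 Ω)) := closure (testGraph Ω)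

/-- `f ∈ H¹₀(Ω)`. -/
def MemH10 (Ω : Set Plane) (f : L2 Ω) : Prop := ∃ G : Fin 2 → L2 Ω, (f, G) ∈ H10 Ω

/-- `div G = f` weakly on `Ω`. For `G = ∇v` this says `Δ v = f`. -/
def IsWeakDiv (Ω : Set Plane) (G : Fin 2 → L2 Ω) (f : L2 Ω) : Prop :=
  ∀ φ : Plane → ℂ, IsTest Ω φ →
    ∑ i, ∫ x in Ω, G i x * pderiv i φ x = -∫ x in Ω, f x * φ x

/-- The time derivative on `[0, ∞)` of a curve in `L²(Ω)` (one-sided at `0`). -/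
def timeDeriv {Ω : Set Plane} (u : ℝ → L2 Ω) (t : ℝ) : L2 Ω := derivWithin u (Ici 0) t

/-- `u`, with spatial gradient `Du`, is the solution on `[0, ∞) × Ω` of
`(∂ₜ² - Δ) u = 0`, `u = 0` on `∂Ω`, `u(0) = u₀`, `∂ₜu(0) = u₁`, in the class
`C¹([0, ∞); H¹₀(Ω)) ∩ C²([0, ∞); L²(Ω))`. -/
structure IsWaveSolution (Ω : Set Plane) (u₀ u₁ : L2 Ω)
    (u : ℝ → L2 Ω) (Du : ℝ → Fin 2 → L2 Ω) : Prop where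
  contDiffOn_L2 : ContDiffOn ℝ 2 u (Ici 0)
  contDiffOn_grad : ContDiffOn ℝ 1 Du (Ici 0)
  dirichlet : ∀ t : ℝ, 0 ≤ t → (u t, Du t) ∈ H10 Ω
  wave : ∀ t : ℝ, 0 ≤ t → IsWeakDiv Ω (Du t) (timeDeriv (timeDeriv u) t)
  initial : u 0 = u₀
  initial_deriv : timeDeriv u 0 = u₁

/-- The energy `E(t) = ∫_Ω |∂ₜu|² + |∇u|² dV`. -/
def energy {Ω : Set Plane} (u : ℝ → L2 Ω) (Du : ℝ → Fin 2 → L2 Ω) (t : ℝ) : ℝ :=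
  ∫ x in Ω, (‖timeDeriv u t x‖ ^ 2 + ∑ i, ‖Du t i x‖ ^ 2)

/-- The (closed) side of the triangle `T` opposite to the vertex `i`. -/
def side (T : Affine.Triangle ℝ Plane) (i : Fin 3) : Set Plane :=
  segment ℝ (T.points (i + 1)) (T.points (i + 2))

/-- The length of the longest side of `T`. -/
def longestSide (T : Affine.Triangle ℝ Plane) : ℝ :=
  max (dist (T.points 0) (T.points 1))
    (max (dist (T.points 1) (T.points 2)) (dist (T.points 2) (T.points 0)))

/-- The arclength measure. -/
def arclength : Measure Plane := Measure.hausdorffMeasure 1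

/-- `g ∈ L²(∂Ω)` is the outward normal derivative `∂_ν v` on the boundary of the triangle `T`
(with `Ω` its interior) of a function `v` with gradient `G = ∇v` and `Δv` in `L²(Ω)`, in the sense
of Green's formula `∫_Ω ∇v · ∇φ + (Δv) φ dV = ∫_{∂Ω} (∂_ν v) φ dS` for all `φ ∈ C^∞`. -/
def IsNormalDeriv (T : Affine.Triangle ℝ Plane) (G : Fin 2 → L2 T.interior)
    (g : Plane → ℂ) : Prop :=
  MemLp g 2 (arclength.restrict (⋃ i, side T i)) ∧
  ∃ f : L2 T.interior, IsWeakDiv T.interior G f ∧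
    ∀ φ : Plane → ℂ, ContDiff ℝ ∞ φ →
      (∑ i, ∫ x in T.interior, G i x * pderiv i φ x) + ∫ x in T.interior, f x * φ x
        = ∫ x in ⋃ i, side T i, g x * φ x ∂arclength

end TriangleWave

end

open TriangleWave

noncomputable section

namespace TriangleWave

section

variable {Ω : Set Plane}

/-! ### Continuous functions as elements of `L²(Ω)` -/

/-! Fix a side `S`, its altitude `ℓ` and the opposite vertex `p`, and use the radial field `X = (x -
p)·∇`. On the two sides through `p` the vector `x - p` is tangential. On `S` its component along the
outward normal is the constant `ℓ`. In dimension two the Dirichlet integral is invariant under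
dilation, so the Rellich identity for `v = 0` on the boundary has no interior gradient term: `ℓ ∫_S
|∂_ν v|² = 2 Re ∫ Δv · X v̄`. The right side is `rellich`.

For a wave, let `M(t) = Re ∫ (2 Xu + u) ∂ₜū` (`momentum`). The virial identity `re_inner_radial` for
`∂ₜu` and Green's identity for `u` give `M' = rellich - E` (`hasDerivWithinAt_momentum`). Energy is
conserved, so integrating gives `ℓ ∫₀^τ ∫_S |∂_ν u|² = τ E + M(τ) - M(0)`. The Poincaré inequality
gives `|M| ≤ (3/2) L E`, whence the constant `3`.

The Rellich identity is proved for every `v ∈ H¹₀` with `Δv = f ∈ L²`, by comparing `v` with dilated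
test functions `φ(p + s(x - p))`. The expansion of `∫ f φ̄(p + s(x - p))` at `s = 1` is uniform in
`φ` relative to `‖∇φ‖` (`exists_norm_inner_dil_sub_le`), so `φ` may tend to `v` at fixed `s`
(`le_of_forall_isTest`).

For `s > 1` the dilated function vanishes in a strip along `S`, and expanding `‖∇v - ∇φ_s‖²` bounds
the integral of `|∇v|²` over that strip by `(s - 1)` times `rellich`, up to a small error
(`exists_setIntegral_strip_le`). A cutoff of almost minimal slope then bounds Green's functional by
the `L²` norms of the boundary values with sharp constants (`norm_greenFunctional_le`). By Riesz
this produces `∂_ν v` (`exists_greenFormula`), and by duality it gives one inequality in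
`height_mul_integral_eq`.

For `s < 1` the dilated function has a nonzero trace on `S` only. Its Dirichlet integral loses the
part of `φ` in a strip, and that same part controls the trace. The two contributions cancel, which
gives the reverse inequality (`rellich_le`). -/

lemma continuous_pderiv {φ : Plane → ℂ} (hφ : ContDiff ℝ ∞ φ) (i : Fin 2) :
    Continuous (pderiv i φ) :=
  (hφ.continuous_fderiv (by simp)).clm_apply continuous_const

lemma fderiv_apply_eq_sum_pderiv (φ : Plane → ℂ) (x z : Plane) :
    fderiv ℝ φ x z = ∑ i, (z i : ℂ) * pderiv i φ x := by
  have hz : z = ∑ i, z i • EuclideanSpace.single i (1 : ℝ) := by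
    ext j
    fin_cases j <;> simp [Fin.sum_univ_two]
  conv_lhs => rw [hz]
  simp [pderiv]

lemma memLp_restrict_of_continuous (hΩ : Bornology.IsBounded Ω) (p : ℝ≥0∞) {φ : Plane → ℂ}
    (hφ : Continuous φ) : MemLp φ p (volume.restrict Ω) := by
  have hK : IsCompact (closure Ω) := hΩ.isCompact_closure
  obtain ⟨C, hC⟩ := hK.exists_bound_of_continuousOn hφ.continuousOn
  have : IsFiniteMeasure ((volume : Measure Plane).restrict (closure Ω)) :=
    ⟨by simpa using hK.measure_lt_top⟩
  have h : MemLp φ p (volume.restrict (closure Ω)) := by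
    refine MemLp.of_bound hφ.aestronglyMeasurable C ?_
    filter_upwards [ae_restrict_mem isClosed_closure.measurableSet] with x hx using hC x hx
  exact h.mono_measure (Measure.restrict_mono subset_closure le_rfl)

/-- A continuous function, as an element of `L²(Ω)`. -/
def toL2 (hΩ : Bornology.IsBounded Ω) (φ : Plane → ℂ) (hφ : Continuous φ) : L2 Ω :=
  (memLp_restrict_of_continuous hΩ 2 hφ).toLp

lemma coeFn_toL2 (hΩ : Bornology.IsBounded Ω) {φ : Plane → ℂ} (hφ : Continuous φ) :
    (toL2 hΩ φ hφ : Plane → ℂ) =ᵐ[volume.restrict Ω] φ :=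
  MemLp.coeFn_toLp _

/-- The gradient of a smooth function, as an element of `L²(Ω)²`. -/
def gradL2 (hΩ : Bornology.IsBounded Ω) (φ : Plane → ℂ) (hφ : ContDiff ℝ ∞ φ) :
    Fin 2 → L2 Ω :=
  fun i => toL2 hΩ (pderiv i φ) (continuous_pderiv hφ i)

lemma mem_testGraph (hΩ : Bornology.IsBounded Ω) {φ : Plane → ℂ} (hφ : IsTest Ω φ) :
    (toL2 hΩ φ hφ.1.continuous, gradL2 hΩ φ hφ.1) ∈ testGraph Ω :=
  ⟨φ, hφ, coeFn_toL2 hΩ hφ.1.continuous, fun i => coeFn_toL2 hΩ (continuous_pderiv hφ.1 i)⟩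

lemma mem_testGraph_iff (hΩ : Bornology.IsBounded Ω) {p : L2 Ω × (Fin 2 → L2 Ω)} :
    p ∈ testGraph Ω ↔ ∃ (φ : Plane → ℂ) (hφ : IsTest Ω φ),
      p = (toL2 hΩ φ hφ.1.continuous, gradL2 hΩ φ hφ.1) := by
  constructor
  · rintro ⟨φ, hφ, h1, h2⟩
    refine ⟨φ, hφ, Prod.ext (Lp.ext (h1.trans (coeFn_toL2 hΩ hφ.1.continuous).symm)) ?_⟩
    exact funext fun i => Lp.ext ((h2 i).trans (coeFn_toL2 hΩ (continuous_pderiv hφ.1 i)).symm)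
  · rintro ⟨φ, hφ, rfl⟩
    exact mem_testGraph hΩ hφ

/-- A closed condition satisfied by all test functions is satisfied on `H¹₀(Ω)`. -/
lemma H10_induction (hΩ : Bornology.IsBounded Ω) {P : L2 Ω × (Fin 2 → L2 Ω) → Prop}
    (hP : IsClosed {p | P p})
    (h : ∀ (φ : Plane → ℂ) (hφ : IsTest Ω φ),
      P (toL2 hΩ φ hφ.1.continuous, gradL2 hΩ φ hφ.1))
    {p : L2 Ω × (Fin 2 → L2 Ω)} (hp : p ∈ H10 Ω) : P p := by
  refine closure_minimal (s := testGraph Ω) ?_ hP hp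
  intro q hq
  obtain ⟨φ, hφ, rfl⟩ := (mem_testGraph_iff hΩ).1 hq
  exact h φ hφ

lemma inner_L2_eq (a f : L2 Ω) :
    inner ℂ a f = ∫ x in Ω, f x * (starRingEnd ℂ) (a x) := by
  rw [L2.inner_def]
  rfl

lemma inner_toL2_eq (hΩ : Bornology.IsBounded Ω) {φ : Plane → ℂ} (hφ : Continuous φ)
    (f : L2 Ω) : inner ℂ (toL2 hΩ φ hφ) f = ∫ x in Ω, f x * (starRingEnd ℂ) (φ x) := by
  rw [inner_L2_eq]
  refine integral_congr_ae ?_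
  filter_upwards [coeFn_toL2 hΩ hφ] with x hx
  rw [hx]

lemma norm_sq_L2_eq (a : L2 Ω) : ‖a‖ ^ 2 = ∫ x in Ω, ‖a x‖ ^ 2 := by
  have h := inner_self_eq_norm_sq_to_K (𝕜 := ℂ) a
  rw [inner_L2_eq] at h
  have h2 : ∀ x, a x * (starRingEnd ℂ) (a x) = ((‖a x‖ ^ 2 : ℝ) : ℂ) := by
    intro x
    rw [Complex.mul_conj, Complex.normSq_eq_norm_sq]
  simp_rw [h2] at h
  rw [integral_complex_ofReal] at h
  exact Complex.ofReal_injective (by rw [h]; push_cast; rfl)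

lemma integrable_norm_sq_L2 (a : L2 Ω) :
    Integrable (fun x => ‖a x‖ ^ 2) (volume.restrict Ω) :=
  (memLp_two_iff_integrable_sq_norm (Lp.aestronglyMeasurable a)).1 (Lp.memLp a)

lemma norm_sq_toL2_eq (hΩ : Bornology.IsBounded Ω) {φ : Plane → ℂ} (hφ : Continuous φ) :
    ‖toL2 hΩ φ hφ‖ ^ 2 = ∫ x in Ω, ‖φ x‖ ^ 2 := by
  rw [norm_sq_L2_eq]
  refine integral_congr_ae ?_
  filter_upwards [coeFn_toL2 hΩ hφ] with x hx
  rw [hx]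

/-! ### Squared norms and inner products of gradients -/

/-- The squared norm of a vector field in `L²(Ω)²`. -/
def normSq (G : Fin 2 → L2 Ω) : ℝ := ∑ i, ‖G i‖ ^ 2

/-- The inner product of vector fields in `L²(Ω)²`. -/
def vinner (W G : Fin 2 → L2 Ω) : ℂ := ∑ i, inner ℂ (W i) (G i)

/-- `|∇φ|²`. -/
def gradSq (φ : Plane → ℂ) (x : Plane) : ℝ := ∑ i, ‖pderiv i φ x‖ ^ 2

lemma gradSq_nonneg (φ : Plane → ℂ) (x : Plane) : 0 ≤ gradSq φ x :=
  Finset.sum_nonneg fun _ _ => by positivity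

lemma continuous_gradSq {φ : Plane → ℂ} (hφ : ContDiff ℝ ∞ φ) : Continuous (gradSq φ) :=
  continuous_finsetSum _ fun i _ => (continuous_pderiv hφ i).norm.pow 2

lemma normSq_nonneg (G : Fin 2 → L2 Ω) : 0 ≤ normSq G :=
  Finset.sum_nonneg fun _ _ => by positivity

lemma continuous_normSq : Continuous (normSq (Ω := Ω)) := by
  unfold normSq; fun_prop

lemma continuous_vinner_left (G : Fin 2 → L2 Ω) : Continuous fun W => vinner W G := by
  unfold vinner; fun_prop

lemma normSq_sub (G W : Fin 2 → L2 Ω) :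
    normSq (fun i => G i - W i) = normSq G - 2 * (vinner W G).re + normSq W := by
  simp only [normSq, vinner, Fin.sum_univ_two, Complex.add_re]
  have h : ∀ i, ‖G i - W i‖ ^ 2 = ‖G i‖ ^ 2 - 2 * (inner ℂ (W i) (G i)).re + ‖W i‖ ^ 2 := by
    intro i
    have := norm_sub_sq (𝕜 := ℂ) (G i) (W i)
    rw [this, ← inner_conj_symm (G i) (W i), RCLike.conj_re]
    rfl
  rw [h, h]; ring

lemma vinner_self (G : Fin 2 → L2 Ω) : vinner G G = (normSq G : ℂ) := by
  simp only [vinner, normSq, Complex.ofReal_sum]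
  refine Finset.sum_congr rfl fun i _ => ?_
  rw [inner_self_eq_norm_sq_to_K]
  norm_cast

lemma integrable_of_continuous (hΩ : Bornology.IsBounded Ω) {φ : Plane → ℝ}
    (hφ : Continuous φ) : Integrable φ (volume.restrict Ω) :=
  ((hφ.continuousOn (s := closure Ω)).integrableOn_compact hΩ.isCompact_closure).mono_set
    subset_closure

lemma normSq_gradL2 (hΩ : Bornology.IsBounded Ω) {φ : Plane → ℂ} (hφ : ContDiff ℝ ∞ φ) :
    normSq (gradL2 hΩ φ hφ) = ∫ x in Ω, gradSq φ x := by
  unfold normSq gradSq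
  rw [integral_finsetSum]
  · refine Finset.sum_congr rfl fun i _ => ?_
    rw [gradL2, norm_sq_toL2_eq]
  · intro i _
    exact integrable_of_continuous hΩ ((continuous_pderiv hφ i).norm.pow 2)

lemma isTest_conj {φ : Plane → ℂ} (hφ : IsTest Ω φ) :
    IsTest Ω fun x => (starRingEnd ℂ) (φ x) := by
  refine ⟨Complex.conjCLE.contDiff.comp hφ.1, hφ.2.1.comp_left (g := starRingEnd ℂ) (by simp),
    ?_⟩
  refine (closure_mono ?_).trans hφ.2.2
  intro x hx
  simpa using hx

lemma pderiv_conj {φ : Plane → ℂ} (hφ : ContDiff ℝ ∞ φ) (i : Fin 2) (x : Plane) :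
    pderiv i (fun x => (starRingEnd ℂ) (φ x)) x = (starRingEnd ℂ) (pderiv i φ x) := by
  have h := (hφ.differentiable (by simp) x).hasFDerivAt
  have h2 := (Complex.conjCLE.toContinuousLinearMap.hasFDerivAt (x := φ x)).comp x h
  unfold pderiv
  have h3 : fderiv ℝ (fun x => (starRingEnd ℂ) (φ x)) x = _ := h2.fderiv
  rw [h3]
  simp

/-- The weak divergence may be tested with all of `H¹₀(Ω)`. -/
lemma vinner_eq_of_isWeakDiv (hΩ : Bornology.IsBounded Ω) {G : Fin 2 → L2 Ω} {f : L2 Ω}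
    (h : IsWeakDiv Ω G f) {p : L2 Ω × (Fin 2 → L2 Ω)} (hp : p ∈ H10 Ω) :
    vinner p.2 G = -inner ℂ p.1 f := by
  refine H10_induction hΩ (P := fun p => vinner p.2 G = -inner ℂ p.1 f) ?_ ?_ hp
  · refine isClosed_eq ((continuous_vinner_left G).comp continuous_snd) ?_
    fun_prop
  · intro φ hφ
    have := h _ (isTest_conj hφ)
    simp only [vinner, gradL2, inner_toL2_eq]
    rw [← this]
    refine Finset.sum_congr rfl fun i _ => ?_
    refine integral_congr_ae (ae_of_all _ fun x => ?_)
    simp only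
    rw [pderiv_conj hφ.1]

/-! ### `H¹₀(Ω)` is a closed subspace -/

lemma isTest_add {φ ψ : Plane → ℂ} (hφ : IsTest Ω φ) (hψ : IsTest Ω ψ) :
    IsTest Ω fun x => φ x + ψ x :=
  ⟨hφ.1.add hψ.1, hφ.2.1.add hψ.2.1,
    (tsupport_add φ ψ).trans (union_subset hφ.2.2 hψ.2.2)⟩

lemma isTest_smul (c : ℝ) {φ : Plane → ℂ} (hφ : IsTest Ω φ) :
    IsTest Ω fun x => c • φ x :=
  ⟨hφ.1.const_smul c, hφ.2.1.smul_left (f := fun _ => c),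
    (closure_mono (fun x hx => by
      simp only [Function.mem_support] at hx ⊢
      exact fun h => hx (by simp [h]))).trans hφ.2.2⟩

lemma pderiv_add {φ ψ : Plane → ℂ} (hφ : ContDiff ℝ ∞ φ) (hψ : ContDiff ℝ ∞ ψ) (i : Fin 2)
    (x : Plane) : pderiv i (fun x => φ x + ψ x) x = pderiv i φ x + pderiv i ψ x := by
  unfold pderiv
  rw [fderiv_fun_add (hφ.differentiable (by simp) x) (hψ.differentiable (by simp) x)]
  rfl

lemma pderiv_smul (c : ℝ) {φ : Plane → ℂ} (hφ : ContDiff ℝ ∞ φ) (i : Fin 2) (x : Plane) :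
    pderiv i (fun x => c • φ x) x = c • pderiv i φ x := by
  unfold pderiv
  rw [fderiv_fun_const_smul (hφ.differentiable (by simp) x)]
  rfl

/-- The graphs of test functions form a real subspace. -/
def testGraphSubmodule (Ω : Set Plane) : Submodule ℝ (L2 Ω × (Fin 2 → L2 Ω)) where
  carrier := testGraph Ω
  zero_mem' := by
    refine ⟨0, ⟨contDiff_const, HasCompactSupport.zero, by simp [tsupport]⟩, ?_, fun i => ?_⟩
    · exact Lp.coeFn_zero _ _ _
    · refine (Lp.coeFn_zero _ _ _).trans (ae_of_all _ fun x => ?_)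
      simp [pderiv]
  add_mem' := by
    rintro a b ⟨φ, hφ, h1, h2⟩ ⟨ψ, hψ, h3, h4⟩
    refine ⟨_, isTest_add hφ hψ, ?_, fun i => ?_⟩
    · filter_upwards [Lp.coeFn_add a.1 b.1, h1, h3] with x hx hx1 hx3
      exact hx.trans (by rw [Pi.add_apply, hx1, hx3])
    · filter_upwards [Lp.coeFn_add (a.2 i) (b.2 i), h2 i, h4 i] with x hx hx1 hx3
      exact hx.trans (by rw [Pi.add_apply, hx1, hx3, pderiv_add hφ.1 hψ.1])
  smul_mem' := by
    rintro c a ⟨φ, hφ, h1, h2⟩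
    refine ⟨_, isTest_smul c hφ, ?_, fun i => ?_⟩
    · filter_upwards [Lp.coeFn_smul c a.1, h1] with x hx hx1
      exact hx.trans (by rw [Pi.smul_apply, hx1])
    · filter_upwards [Lp.coeFn_smul c (a.2 i), h2 i] with x hx hx1
      exact hx.trans (by rw [Pi.smul_apply, hx1, pderiv_smul c hφ.1])

/-- `H¹₀(Ω)` as a real subspace. -/
def H10Submodule (Ω : Set Plane) : Submodule ℝ (L2 Ω × (Fin 2 → L2 Ω)) :=
  (testGraphSubmodule Ω).topologicalClosure

/-! ### Multiplication by the position vector -/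

/-- Multiplication by the coordinate function `x ↦ xᵢ - pᵢ`. -/
def posMul (hΩ : Bornology.IsBounded Ω) (p : Plane) (i : Fin 2) : L2 Ω →L[ℂ] L2 Ω :=
  (ContinuousLinearMap.mul ℂ ℂ).holderL (volume.restrict Ω) ∞ 2 2
    ((memLp_restrict_of_continuous hΩ ∞ (φ := fun x => ((x i - p i : ℝ) : ℂ))
      (by fun_prop)).toLp)

lemma coeFn_posMul (hΩ : Bornology.IsBounded Ω) (p : Plane) (i : Fin 2) (f : L2 Ω) :
    (posMul hΩ p i f : Plane → ℂ) =ᵐ[volume.restrict Ω]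
      fun x => ((x i - p i : ℝ) : ℂ) * f x := by
  unfold posMul
  rw [ContinuousLinearMap.holderL_apply_apply]
  filter_upwards [ContinuousLinearMap.coeFn_holder (ContinuousLinearMap.mul ℂ ℂ) (r := 2)
    ((memLp_restrict_of_continuous hΩ ∞ (φ := fun x => ((x i - p i : ℝ) : ℂ))
      (by fun_prop)).toLp) f, (memLp_restrict_of_continuous hΩ ∞
      (φ := fun x => ((x i - p i : ℝ) : ℂ)) (by fun_prop)).coeFn_toLp] with x hx hx2
  rw [hx, hx2]
  rfl

/-- The radial part `(x - p) · G` of a vector field. -/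
def radial (hΩ : Bornology.IsBounded Ω) (p : Plane) : (Fin 2 → L2 Ω) →L[ℂ] L2 Ω :=
  ∑ i, (posMul hΩ p i).comp (ContinuousLinearMap.proj i)

lemma coeFn_radial (hΩ : Bornology.IsBounded Ω) (p : Plane) (G : Fin 2 → L2 Ω) :
    (radial hΩ p G : Plane → ℂ) =ᵐ[volume.restrict Ω]
      fun x => ∑ i, ((x i - p i : ℝ) : ℂ) * G i x := by
  have h : radial hΩ p G = posMul hΩ p 0 (G 0) + posMul hΩ p 1 (G 1) := by
    simp [radial, Fin.sum_univ_two]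
  rw [h]
  filter_upwards [Lp.coeFn_add (posMul hΩ p 0 (G 0)) (posMul hΩ p 1 (G 1)),
    coeFn_posMul hΩ p 0 (G 0), coeFn_posMul hΩ p 1 (G 1)] with x h1 h2 h3
  rw [h1, Pi.add_apply, h2, h3, Fin.sum_univ_two]

lemma norm_sq_sum_mul_le (a : Plane) (b : Fin 2 → ℂ) :
    ‖∑ i, (a i : ℂ) * b i‖ ^ 2 ≤ ‖a‖ ^ 2 * ∑ i, ‖b i‖ ^ 2 := by
  have h1 : ‖∑ i, (a i : ℂ) * b i‖ ≤ ∑ i, |a i| * ‖b i‖ := by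
    refine (norm_sum_le _ _).trans (le_of_eq ?_)
    simp
  have h2 := Finset.sum_mul_sq_le_sq_mul_sq Finset.univ (fun i => |a i|) (fun i => ‖b i‖)
  rw [EuclideanSpace.real_norm_sq_eq]
  simp only [sq_abs] at h2
  exact (pow_le_pow_left₀ (norm_nonneg _) h1 2).trans h2

/-- Pointwise Cauchy–Schwarz with `|x - p| ≤ M`. For a triangle and one of its vertices `M` is the
longest side, which is how that length enters the error term. -/
lemma norm_sq_radial_le (hΩ : Bornology.IsBounded Ω) (hm : MeasurableSet Ω) {p : Plane} {M : ℝ}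
    (hM : ∀ x ∈ Ω, dist x p ≤ M) (G : Fin 2 → L2 Ω) :
    ‖radial hΩ p G‖ ^ 2 ≤ M ^ 2 * normSq G := by
  have h1 : normSq G = ∫ x in Ω, ∑ i, ‖G i x‖ ^ 2 := by
    rw [integral_finsetSum _ fun i _ => integrable_norm_sq_L2 (G i)]
    exact Finset.sum_congr rfl fun i _ => norm_sq_L2_eq _
  rw [h1, norm_sq_L2_eq, ← integral_const_mul]
  refine integral_mono_ae (integrable_norm_sq_L2 _)
    ((integrable_finsetSum _ fun i _ => integrable_norm_sq_L2 (G i)).const_mul _) ?_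
  filter_upwards [coeFn_radial hΩ p G, ae_restrict_mem hm] with x hx hxΩ
  rw [hx]
  have h2 := norm_sq_sum_mul_le (x - p) (fun i => G i x)
  have h3 : ‖x - p‖ ≤ M := by simpa [dist_eq_norm] using hM x hxΩ
  refine h2.trans ?_
  gcongr

lemma norm_radial_le (hΩ : Bornology.IsBounded Ω) (hm : MeasurableSet Ω) {p : Plane} {M : ℝ}
    (hM0 : 0 ≤ M) (hM : ∀ x ∈ Ω, dist x p ≤ M) (G : Fin 2 → L2 Ω) :
    ‖radial hΩ p G‖ ≤ M * √(normSq G) := by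
  refine (pow_le_pow_iff_left₀ (norm_nonneg _) (by positivity) two_ne_zero).1 ?_
  rw [mul_pow, Real.sq_sqrt (normSq_nonneg G)]
  exact norm_sq_radial_le hΩ hm hM G

/-! ### The virial identity and the Poincaré inequality -/

lemma setIntegral_eq_integral_of_isTest {E : Type*} [NormedAddCommGroup E] [NormedSpace ℝ E]
    {φ : Plane → ℂ} (hφ : IsTest Ω φ) {F : Plane → E} (hF : ∀ x, x ∉ tsupport φ → F x = 0) :
    ∫ x in Ω, F x = ∫ x, F x :=
  setIntegral_eq_integral_of_forall_compl_eq_zero fun x hx =>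
    hF x fun h => hx (hφ.2.2 h)

lemma pderiv_eq_zero_of_notMem {φ : Plane → ℂ} {x : Plane} (hx : x ∉ tsupport φ) (i : Fin 2) :
    pderiv i φ x = 0 := by
  unfold pderiv
  rw [fderiv_of_notMem_tsupport ℝ hx]
  rfl

lemma radial_gradL2_coeFn (hΩ : Bornology.IsBounded Ω) (p : Plane) {φ : Plane → ℂ}
    (hφ : ContDiff ℝ ∞ φ) :
    (radial hΩ p (gradL2 hΩ φ hφ) : Plane → ℂ) =ᵐ[volume.restrict Ω]
      fun x => fderiv ℝ φ x (x - p) := by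
  filter_upwards [coeFn_radial hΩ p (gradL2 hΩ φ hφ),
    coeFn_toL2 hΩ (continuous_pderiv hφ 0), coeFn_toL2 hΩ (continuous_pderiv hφ 1)]
    with x h1 h2 h3
  rw [h1, fderiv_apply_eq_sum_pderiv, Fin.sum_univ_two, Fin.sum_univ_two]
  simp only [gradL2]
  rw [h2, h3]
  rfl

/-- Integration by parts: `∫ (x - p) · ∇k = -2 ∫ k`. -/
lemma integral_fderiv_position {k : Plane → ℝ} (hk : ContDiff ℝ ∞ k) (hc : HasCompactSupport k)
    (p : Plane) : ∫ x, fderiv ℝ k x (x - p) = -2 * ∫ x, k x := by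
  have hd : ∀ i : Fin 2, Continuous fun x => fderiv ℝ k x (EuclideanSpace.single i 1) := fun i =>
    (hk.continuous_fderiv (by simp)).clm_apply continuous_const
  have hcd : ∀ i : Fin 2, HasCompactSupport fun x => fderiv ℝ k x (EuclideanSpace.single i 1) :=
    fun i => hc.fderiv_apply ℝ _
  have hco' : ∀ (i : Fin 2) (x : Plane), HasFDerivAt (fun x : Plane => x i - p i)
      (EuclideanSpace.proj i : Plane →L[ℝ] ℝ) x := fun i x =>
    ((EuclideanSpace.proj i : Plane →L[ℝ] ℝ).hasFDerivAt (x := x)).sub_const _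
  have hi : ∀ i : Fin 2, Integrable (fun x : Plane =>
      (x i - p i) * fderiv ℝ k x (EuclideanSpace.single i 1)) := fun i =>
    Continuous.integrable_of_hasCompactSupport (by have := hd i; fun_prop) (hcd i).mul_left
  have key : ∀ i : Fin 2, ∫ x : Plane, (x i - p i) * fderiv ℝ k x (EuclideanSpace.single i 1)
      = - ∫ x, k x := by
    intro i
    have hf : ∀ x : Plane, fderiv ℝ (fun x : Plane => x i - p i) x (EuclideanSpace.single i 1)
        = 1 := by
      intro x
      rw [(hco' i x).fderiv]
      simp
    rw [integral_mul_fderiv_eq_neg_fderiv_mul_of_integrable]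
    · simp [hf]
    · simp only [hf, one_mul]
      exact hk.continuous.integrable_of_hasCompactSupport hc
    · exact hi i
    · exact Continuous.integrable_of_hasCompactSupport (by have := hk.continuous; fun_prop)
        hc.mul_left
    · exact fun x _ => (hco' i x).differentiableAt
    · exact fun x _ => hk.differentiable (by simp) x
  have hz : ∀ x : Plane, fderiv ℝ k x (x - p)
      = ∑ i, (x i - p i) * fderiv ℝ k x (EuclideanSpace.single i 1) := by
    intro x
    have hz : x - p = ∑ i, (x i - p i) • EuclideanSpace.single i (1 : ℝ) := by
      ext j
      fin_cases j <;> simp [Fin.sum_univ_two]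
    conv_lhs => rw [hz]
    simp
  simp_rw [hz]
  rw [integral_finsetSum _ fun i _ => hi i]
  simp only [key, Fin.sum_univ_two]
  ring

/-- The virial identity `Re ∫ ((x - p) · ∇w) w̄ = -∫ |w|²` on `H¹₀(Ω)`. -/
lemma re_inner_radial (hΩ : Bornology.IsBounded Ω) (p : Plane) {q : L2 Ω × (Fin 2 → L2 Ω)}
    (hq : q ∈ H10 Ω) : (inner ℂ q.1 (radial hΩ p q.2)).re = -‖q.1‖ ^ 2 := by
  refine H10_induction hΩ (P := fun q => (inner ℂ q.1 (radial hΩ p q.2)).re = -‖q.1‖ ^ 2)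
    ?_ ?_ hq
  · refine isClosed_eq (Complex.continuous_re.comp ?_) (by fun_prop)
    fun_prop
  · intro φ hφ
    have hsm : ContDiff ℝ ∞ fun x => ‖φ x‖ ^ 2 := hφ.1.norm_sq ℝ
    have hfd : ∀ x, fderiv ℝ (fun x => ‖φ x‖ ^ 2) x (x - p)
        = 2 * (fderiv ℝ φ x (x - p) * (starRingEnd ℂ) (φ x)).re := by
      intro x
      have := ((hφ.1.differentiable (by simp) x).hasFDerivAt).norm_sq
      rw [this.fderiv]
      simp [real_inner_eq_re_inner ℂ, mul_comm]
      ring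
    have hc : HasCompactSupport fun x => ‖φ x‖ ^ 2 :=
      hφ.2.1.comp_left (g := fun z : ℂ => ‖z‖ ^ 2) (by simp)
    -- The radial integration by parts is applied to `k = |φ|²`, whose radial derivative is `2 Re
    -- (Xφ · φ̄)`. The factor `2` cancels the dimension `2`.
    have h := integral_fderiv_position hsm hc p
    simp_rw [hfd] at h
    rw [integral_const_mul] at h
    have e1 : (inner ℂ (toL2 hΩ φ hφ.1.continuous) (radial hΩ p (gradL2 hΩ φ hφ.1))).re
        = ∫ x, (fderiv ℝ φ x (x - p) * (starRingEnd ℂ) (φ x)).re := by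
      have hint : Integrable (fun x => fderiv ℝ φ x (x - p) * (starRingEnd ℂ) (φ x)) := by
        have h1 := hφ.1.continuous_fderiv (by simp)
        have h2 := hφ.1.continuous
        refine Continuous.integrable_of_hasCompactSupport ?_ ?_
        · exact (h1.clm_apply (by fun_prop)).mul (Complex.continuous_conj.comp h2)
        · exact (hφ.2.1.comp_left (g := starRingEnd ℂ) (by simp)).mul_left
      have e2 : ∫ x, (fderiv ℝ φ x (x - p) * (starRingEnd ℂ) (φ x)).re
          = (∫ x, fderiv ℝ φ x (x - p) * (starRingEnd ℂ) (φ x)).re :=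
        integral_re hint
      rw [inner_toL2_eq, e2, ← setIntegral_eq_integral_of_isTest hφ]
      · congr 1
        refine integral_congr_ae ?_
        filter_upwards [radial_gradL2_coeFn hΩ p hφ.1] with x hx
        rw [hx]
      · intro x hx
        simp [image_eq_zero_of_notMem_tsupport hx]
    have e3 : ‖toL2 hΩ φ hφ.1.continuous‖ ^ 2 = ∫ x, ‖φ x‖ ^ 2 := by
      rw [norm_sq_toL2_eq, setIntegral_eq_integral_of_isTest hφ]
      intro x hx
      simp [image_eq_zero_of_notMem_tsupport hx]
    simp only [e1, e3]
    linarith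

/-- The Poincaré inequality. -/
lemma norm_le_of_mem_H10 (hΩ : Bornology.IsBounded Ω) (hm : MeasurableSet Ω) {p : Plane} {M : ℝ}
    (hM0 : 0 ≤ M) (hM : ∀ x ∈ Ω, dist x p ≤ M) {q : L2 Ω × (Fin 2 → L2 Ω)} (hq : q ∈ H10 Ω) :
    ‖q.1‖ ≤ M * √(normSq q.2) := by
  have h1 := re_inner_radial hΩ p hq
  -- The virial identity together with Cauchy–Schwarz gives `‖w‖² ≤ ‖w‖ ‖Xw‖`. Dividing by `‖w‖`
  -- yields the Poincaré constant `M`.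
  have h2 : ‖q.1‖ ^ 2 ≤ ‖q.1‖ * ‖radial hΩ p q.2‖ := by
    have := (Complex.abs_re_le_norm _).trans (norm_inner_le_norm (𝕜 := ℂ) q.1 (radial hΩ p q.2))
    rw [h1, abs_neg, abs_of_nonneg (by positivity)] at this
    exact this
  have h3 := norm_radial_le hΩ hm hM0 hM q.2
  rcases (norm_nonneg q.1).eq_or_lt with h0 | h0
  · rw [← h0]; positivity
  · nlinarith

end

section

open scoped RealInnerProductSpace

/-! ### Orthonormal charts of the plane -/

/-- The affine chart of the plane with origin `q` and axes `e`, `n`. -/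
def chart (q e n : Plane) (z : ℝ × ℝ) : Plane := q + (z.1 • e + z.2 • n)

lemma continuous_chart (q e n : Plane) : Continuous (chart q e n) := by
  unfold chart; fun_prop

lemma inner_chart_left {q e n : Plane} (he : ‖e‖ = 1) (hen : ⟪e, n⟫ = 0) (z : ℝ × ℝ) :
    ⟪e, chart q e n z - q⟫ = z.1 := by
  simp [chart, inner_add_right, inner_smul_right, hen, he]

lemma inner_chart_right {q e n : Plane} (hn : ‖n‖ = 1) (hen : ⟪e, n⟫ = 0) (z : ℝ × ℝ) :
    ⟪n, chart q e n z - q⟫ = z.2 := by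
  simp [chart, inner_add_right, inner_smul_right, hn, real_inner_comm, hen]

lemma measurableEmbedding_chart {q e n : Plane} (he : ‖e‖ = 1) (hn : ‖n‖ = 1) (hen : ⟪e, n⟫ = 0) :
    MeasurableEmbedding (chart q e n) := by
  refine (continuous_chart q e n).measurableEmbedding fun z w h => Prod.ext ?_ ?_
  · rw [← inner_chart_left he hen (q := q) z, h, inner_chart_left he hen]
  · rw [← inner_chart_right hn hen (q := q) z, h, inner_chart_right hn hen]

/-- The orthonormal basis formed by two orthogonal unit vectors of the plane. -/
def axisBasis {e n : Plane} (he : ‖e‖ = 1) (hn : ‖n‖ = 1) (hen : ⟪e, n⟫ = 0) :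
    OrthonormalBasis (Fin 2) ℝ Plane :=
  have hon : Orthonormal ℝ ![e, n] := by
    rw [orthonormal_iff_ite]
    intro i j
    fin_cases i <;> fin_cases j <;> simp [he, hn, hen, real_inner_comm]
  OrthonormalBasis.mk hon
    (by rw [hon.linearIndependent.span_eq_top_of_card_eq_finrank (by simp)])

lemma measurePreserving_chart {q e n : Plane} (he : ‖e‖ = 1) (hn : ‖n‖ = 1) (hen : ⟪e, n⟫ = 0) :
    MeasurePreserving (chart q e n) := by
  let b := axisBasis he hn hen
  have h1 := (volume_preserving_finTwoArrow ℝ).symm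
  have h2 := (PiLp.volume_preserving_toLp (Fin 2)).comp h1
  have h3 := b.measurePreserving_repr_symm.comp h2
  have h4 := (measurePreserving_add_left (volume : Measure Plane) q).comp h3
  refine (congrArg (fun f => MeasurePreserving f volume volume) (funext fun z => ?_)).mp h4
  have hb : ∀ v : EuclideanSpace ℝ (Fin 2), b.repr.symm v = v 0 • e + v 1 • n := by
    intro v
    rw [b.sum_repr_symm v |>.symm, Fin.sum_univ_two]
    simp [b, axisBasis]
  simp only [Function.comp_apply, hb, chart]
  rfl

lemma chart_inner {q e n : Plane} (he : ‖e‖ = 1) (hn : ‖n‖ = 1) (hen : ⟪e, n⟫ = 0)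
    (x : Plane) : chart q e n (⟪e, x - q⟫, ⟪n, x - q⟫) = x := by
  have h := (axisBasis he hn hen).sum_repr' (x - q)
  simp only [Fin.sum_univ_two, axisBasis, OrthonormalBasis.coe_mk] at h
  simp only [Matrix.cons_val_zero, Matrix.cons_val_one] at h
  rw [chart, h, add_sub_cancel]

lemma isometry_axis {q e : Plane} (he : ‖e‖ = 1) : Isometry fun σ : ℝ => q + σ • e := by
  refine Isometry.of_dist_eq fun a b => ?_
  rw [dist_add_left, dist_eq_norm, ← sub_smul, norm_smul, he, mul_one, Real.dist_eq,
    Real.norm_eq_abs]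

/-! ### Barycentric coordinates of a triangle -/

namespace Tri

variable (T : Affine.Triangle ℝ Plane) (i : Fin 3)

/-- The inward unit normal vector of a side. -/
def normal : Plane := (T.height i)⁻¹ • (T.points i - T.altitudeFoot i)

/-- The length of a side. -/
def len : ℝ := dist (T.points (i + 1)) (T.points (i + 2))

/-- The unit vector along a side. -/
def tangent : Plane := (len T i)⁻¹ • (T.points (i + 2) - T.points (i + 1))

/-- The barycentric coordinate with respect to the vertex `i`. -/
def bary (x : Plane) : ℝ := (T.height i)⁻¹ * ⟪normal T i, x - T.points (i + 1)⟫

/-- The chart adapted to a side. -/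
def sideChart : ℝ × ℝ → Plane := chart (T.points (i + 1)) (tangent T i) (normal T i)

lemma ne_add_one : i ≠ i + 1 := by fin_cases i <;> decide

lemma ne_add_two : i ≠ i + 2 := by fin_cases i <;> decide

lemma add_one_ne_add_two : i + 1 ≠ i + 2 := by fin_cases i <;> decide

lemma sum_eq_cyclic {M : Type*} [AddCommMonoid M] (a : Fin 3 → M) :
    ∑ j, a j = a i + a (i + 1) + a (i + 2) := by
  fin_cases i
  · exact Fin.sum_univ_three a
  · rw [Fin.sum_univ_three]
    change _ = a 1 + a 2 + a 0
    rw [add_assoc, add_comm]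
  · rw [Fin.sum_univ_three]
    change _ = a 2 + a 0 + a 1
    rw [add_comm, add_assoc]

lemma eq_or_eq_or_eq (j : Fin 3) : j = i ∨ j = i + 1 ∨ j = i + 2 := by
  fin_cases i <;> fin_cases j <;> decide

lemma height_eq_norm : T.height i = ‖T.points i - T.altitudeFoot i‖ := by
  rw [Affine.Simplex.height, dist_eq_norm]

lemma norm_normal : ‖normal T i‖ = 1 := by
  rw [normal, norm_smul, ← height_eq_norm, norm_inv, Real.norm_of_nonneg (T.height_pos i).le]
  exact inv_mul_cancel₀ (T.height_pos i).ne'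

lemma inner_normal_foot {j : Fin 3} (h : i ≠ j) :
    ⟪normal T i, T.points j - T.altitudeFoot i⟫ = 0 := by
  have := T.inner_vsub_altitudeFoot_vsub_altitudeFoot_eq_zero h
  rw [normal, real_inner_smul_left, real_inner_comm]
  simp only [vsub_eq_sub] at this
  rw [this, mul_zero]

lemma bary_eq (x : Plane) :
    bary T i x = (T.height i)⁻¹ * ⟪normal T i, x - T.altitudeFoot i⟫ := by
  have h := inner_normal_foot T i (ne_add_one i)
  have : x - T.points (i + 1)
      = (x - T.altitudeFoot i) - (T.points (i + 1) - T.altitudeFoot i) := by abel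
  rw [bary, this, inner_sub_right, h, sub_zero]

lemma bary_points_of_ne {j : Fin 3} (h : i ≠ j) : bary T i (T.points j) = 0 := by
  rw [bary_eq, inner_normal_foot T i h, mul_zero]

lemma bary_points_self : bary T i (T.points i) = 1 := by
  have h := T.height_pos i
  rw [bary_eq, normal, real_inner_smul_left, real_inner_self_eq_norm_sq, ← height_eq_norm]
  field_simp

lemma bary_points (j : Fin 3) : bary T i (T.points j) = if j = i then 1 else 0 := by
  split_ifs with h
  · rw [h, bary_points_self]
  · exact bary_points_of_ne T i (Ne.symm h)

lemma bary_sub (x y : Plane) :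
    bary T i x - bary T i y = (T.height i)⁻¹ * ⟪normal T i, x - y⟫ := by
  rw [bary, bary, ← mul_sub, ← inner_sub_right]
  congr 2; abel

lemma continuous_bary : Continuous (bary T i) := by
  unfold bary; fun_prop

/-- The function is affine and takes the values `0` and `1` at the vertices, so it reads off the
weights of any affine combination. -/
lemma bary_sum_smul {w : Fin 3 → ℝ} (hw : ∑ j, w j = 1) :
    bary T i (∑ j, w j • T.points j) = w i := by
  have h1 : (∑ j, w j • T.points j) - T.points (i + 1)
      = ∑ j, w j • (T.points j - T.points (i + 1)) := by
    simp only [smul_sub, Finset.sum_sub_distrib, ← Finset.sum_smul, hw, one_smul]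
  have h2 : ∀ j, (T.height i)⁻¹ * ⟪normal T i, T.points j - T.points (i + 1)⟫
      = if j = i then 1 else 0 := fun j => bary_points T i j
  rw [bary, h1, inner_sum, Finset.mul_sum]
  simp only [real_inner_smul_right]
  rw [Finset.sum_eq_single i]
  · rw [mul_left_comm, h2, if_pos rfl, mul_one]
  · intro j _ hj
    rw [mul_left_comm, h2, if_neg hj, mul_zero]
  · simp

lemma exists_weights (x : Plane) :
    ∃ w : Fin 3 → ℝ, ∑ j, w j = 1 ∧ ∑ j, w j • T.points j = x := by
  have htop : affineSpan ℝ (range T.points) = ⊤ := by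
    rw [T.independent.affineSpan_eq_top_iff_card_eq_finrank_add_one]
    simp
  have hx : x ∈ affineSpan ℝ (range T.points) := by rw [htop]; trivial
  obtain ⟨w, hw, rfl⟩ := eq_affineCombination_of_mem_affineSpan_of_fintype hx
  exact ⟨w, hw, (Finset.affineCombination_eq_linear_combination _ _ _ hw).symm⟩

lemma sum_bary (x : Plane) : ∑ j, bary T j x = 1 := by
  obtain ⟨w, hw, rfl⟩ := exists_weights T x
  simp only [bary_sum_smul T _ hw, hw]

lemma sum_bary_smul (x : Plane) : ∑ j, bary T j x • T.points j = x := by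
  obtain ⟨w, hw, rfl⟩ := exists_weights T x
  simp only [bary_sum_smul T _ hw]

lemma mem_interior_iff {x : Plane} : x ∈ T.interior ↔ ∀ j, 0 < bary T j x := by
  constructor
  · rintro ⟨w, hw, hw2, rfl⟩ j
    rw [Finset.affineCombination_eq_linear_combination _ _ _ hw, bary_sum_smul T j hw]
    exact (hw2 j).1
  · intro h
    refine ⟨fun j => bary T j x, sum_bary T x, fun j => ⟨h j, ?_⟩, ?_⟩
    -- Membership in the interior also asks for weights below `1`. This follows since the three
    -- weights add up to `1` and the other two are positive.
    · have h1 := sum_bary T x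
      rw [sum_eq_cyclic j] at h1
      linarith [h (j + 1), h (j + 2)]
    · rw [Finset.affineCombination_eq_linear_combination _ _ _ (sum_bary T x), sum_bary_smul]

lemma isOpen_interior : IsOpen T.interior := by
  have : T.interior = ⋂ j, {x | 0 < bary T j x} := by
    ext x; simp [mem_interior_iff]
  rw [this]
  exact isOpen_iInter_of_finite fun j => isOpen_lt continuous_const (continuous_bary T j)

lemma measurableSet_interior : MeasurableSet T.interior := (isOpen_interior T).measurableSet

lemma dist_points_le (j k : Fin 3) : dist (T.points j) (T.points k) ≤ longestSide T := by
  have h0 : 0 ≤ longestSide T := le_max_of_le_left dist_nonneg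
  have h1 : dist (T.points 0) (T.points 1) ≤ longestSide T := le_max_left _ _
  have h2 : dist (T.points 1) (T.points 2) ≤ longestSide T :=
    le_max_of_le_right (le_max_left _ _)
  have h3 : dist (T.points 2) (T.points 0) ≤ longestSide T :=
    le_max_of_le_right (le_max_right _ _)
  fin_cases j <;> fin_cases k <;> simp only [dist_self] <;>
    first
      | exact h0 | exact h1 | exact h2 | exact h3
      | (rw [dist_comm]; exact h1) | (rw [dist_comm]; exact h2) | (rw [dist_comm]; exact h3)

lemma longestSide_nonneg : 0 ≤ longestSide T := le_max_of_le_left dist_nonneg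

/-- A point of the triangle is a convex combination of the vertices, so its distance to a vertex is
at most the largest distance between vertices. -/
lemma dist_le_of_mem_interior {x : Plane} (hx : x ∈ T.interior) :
    dist x (T.points i) ≤ longestSide T := by
  rw [mem_interior_iff] at hx
  have h1 : x - T.points i = ∑ j, bary T j x • (T.points j - T.points i) := by
    simp only [smul_sub, Finset.sum_sub_distrib, ← Finset.sum_smul, sum_bary, sum_bary_smul,
      one_smul]
  rw [dist_eq_norm, h1]
  calc ‖∑ j, bary T j x • (T.points j - T.points i)‖
      ≤ ∑ j, bary T j x * longestSide T := by
        refine norm_sum_le_of_le _ fun j _ => ?_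
        rw [norm_smul, Real.norm_of_nonneg (hx j).le, ← dist_eq_norm]
        exact mul_le_mul_of_nonneg_left (dist_points_le T j i) (hx j).le
    _ = longestSide T := by rw [← Finset.sum_mul, sum_bary, one_mul]

lemma isBounded_interior : Bornology.IsBounded T.interior :=
  (Metric.isBounded_iff_subset_closedBall (T.points 0)).2
    ⟨longestSide T, fun _ hx => dist_le_of_mem_interior T 0 hx⟩

/-! ### The chart adapted to a side -/

lemma len_pos : 0 < len T i :=
  dist_pos.2 fun h => add_one_ne_add_two i (T.independent.injective h)

lemma norm_tangent : ‖tangent T i‖ = 1 := by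
  rw [tangent, norm_smul, ← dist_eq_norm, dist_comm, ← len, norm_inv,
    Real.norm_of_nonneg (len_pos T i).le]
  exact inv_mul_cancel₀ (len_pos T i).ne'

lemma inner_tangent_normal : ⟪tangent T i, normal T i⟫ = 0 := by
  have h : bary T i (T.points (i + 2)) = 0 := bary_points_of_ne T i (ne_add_two i)
  have h2 : ⟪normal T i, T.points (i + 2) - T.points (i + 1)⟫ = 0 :=
    (mul_eq_zero.1 h).resolve_left (inv_ne_zero (T.height_pos i).ne')
  rw [tangent, real_inner_smul_left, real_inner_comm, h2, mul_zero]

lemma continuous_sideChart : Continuous (sideChart T i) := continuous_chart _ _ _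

lemma measurableEmbedding_sideChart : MeasurableEmbedding (sideChart T i) :=
  measurableEmbedding_chart (norm_tangent T i) (norm_normal T i) (inner_tangent_normal T i)

lemma measurePreserving_sideChart : MeasurePreserving (sideChart T i) :=
  measurePreserving_chart (norm_tangent T i) (norm_normal T i) (inner_tangent_normal T i)

lemma bary_sideChart (z : ℝ × ℝ) : bary T i (sideChart T i z) = z.2 / T.height i := by
  rw [bary, sideChart, inner_chart_right (norm_normal T i) (inner_tangent_normal T i),
    div_eq_inv_mul]

lemma exists_points_eq_sideChart : ∃ c, T.points i = sideChart T i (c, T.height i) := by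
  refine ⟨⟪tangent T i, T.points i - T.points (i + 1)⟫, ?_⟩
  have h := bary_points_self T i
  rw [bary, inv_mul_eq_one₀ (T.height_pos i).ne'] at h
  rw [sideChart]
  conv_rhs => rw [h]
  rw [chart_inner (norm_tangent T i) (norm_normal T i) (inner_tangent_normal T i)]

/-- In the coordinates along and across the side the dilation acts on each coordinate separately. In
particular it carries the side to a slice parallel to it. -/
lemma dil_sideChart {c : ℝ} (hc : T.points i = sideChart T i (c, T.height i)) (s σ k : ℝ) :
    T.points i + s • (sideChart T i (σ, k) - T.points i)
      = sideChart T i (c + s * (σ - c), T.height i + s * (k - T.height i)) := by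
  rw [hc]
  simp only [sideChart, chart]
  module

lemma abs_le_of_sideChart_mem {z : ℝ × ℝ} (h : sideChart T i z ∈ T.interior) :
    |z.1| ≤ longestSide T := by
  rw [← inner_chart_left (q := T.points (i + 1)) (norm_tangent T i)
    (inner_tangent_normal T i) z]
  refine (abs_real_inner_le_norm _ _).trans ?_
  rw [norm_tangent, one_mul, ← dist_eq_norm]
  exact dist_le_of_mem_interior T (i + 1) h

lemma sideChart_zero (σ : ℝ) : sideChart T i (σ, 0)
    = (1 - σ / len T i) • T.points (i + 1) + (σ / len T i) • T.points (i + 2) := by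
  simp only [sideChart, chart, tangent, zero_smul, add_zero, smul_smul, ← div_eq_mul_inv,
    smul_sub, sub_smul, one_smul]
  abel

lemma sideChart_zero_eq_sum (σ : ℝ) : ∃ w : Fin 3 → ℝ, ∑ j, w j = 1 ∧ w i = 0 ∧
    w (i + 1) = 1 - σ / len T i ∧ w (i + 2) = σ / len T i ∧
    sideChart T i (σ, 0) = ∑ j, w j • T.points j := by
  refine ⟨fun j => if j = i then 0 else if j = i + 1 then 1 - σ / len T i else σ / len T i,
    ?_, ?_, ?_, ?_, ?_⟩
  · rw [sum_eq_cyclic i]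
    simp [(ne_add_one i).symm, (ne_add_two i).symm, (add_one_ne_add_two i).symm]
  · simp
  · simp [(ne_add_one i).symm]
  · simp [(ne_add_two i).symm, (add_one_ne_add_two i).symm]
  · rw [sum_eq_cyclic i, sideChart_zero]
    simp [(ne_add_one i).symm, (ne_add_two i).symm, (add_one_ne_add_two i).symm]

lemma bary_add_one_sideChart_zero (σ : ℝ) :
    bary T (i + 1) (sideChart T i (σ, 0)) = 1 - σ / len T i := by
  obtain ⟨w, h1, -, h3, -, h5⟩ := sideChart_zero_eq_sum T i σ
  rw [h5, bary_sum_smul T _ h1, h3]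

lemma bary_add_two_sideChart_zero (σ : ℝ) :
    bary T (i + 2) (sideChart T i (σ, 0)) = σ / len T i := by
  obtain ⟨w, h1, -, -, h4, h5⟩ := sideChart_zero_eq_sum T i σ
  rw [h5, bary_sum_smul T _ h1, h4]

/-! ### Sides and their arclength -/

lemma side_eq_image : side T i = (fun σ => sideChart T i (σ, 0)) '' Icc 0 (len T i) := by
  have hl := len_pos T i
  rw [side, segment_eq_image]
  ext x
  simp only [mem_image]
  constructor
  · rintro ⟨θ, hθ, rfl⟩
    refine ⟨θ * len T i, ⟨by have := hθ.1; positivity, ?_⟩, ?_⟩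
    · nlinarith [hθ.2]
    · rw [sideChart_zero, mul_div_cancel_right₀ _ hl.ne']
  · rintro ⟨σ, hσ, rfl⟩
    refine ⟨σ / len T i, ⟨div_nonneg hσ.1 hl.le, (div_le_one hl).2 hσ.2⟩, ?_⟩
    rw [sideChart_zero]

lemma isometry_sideChart_zero : Isometry fun σ : ℝ => sideChart T i (σ, 0) := by
  have h := isometry_axis (q := T.points (i + 1)) (norm_tangent T i)
  refine (congrArg Isometry (funext fun σ => ?_)).mp h
  simp [sideChart, chart]

/-- The chart restricted to height `0` is an isometry of the line, so it carries one-dimensional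
Hausdorff measure, which on the line is Lebesgue measure, to arclength. -/
lemma arclength_restrict_side : arclength.restrict (side T i)
    = (volume.restrict (Icc 0 (len T i))).map fun σ => sideChart T i (σ, 0) := by
  have hi := isometry_sideChart_zero T i
  have he := hi.isClosedEmbedding.measurableEmbedding
  have h1 := hi.map_hausdorffMeasure (d := 1) (Or.inl zero_le_one)
  rw [hausdorffMeasure_real] at h1
  have hs : MeasurableSet (side T i) := by
    rw [side_eq_image]
    exact he.measurableSet_image' measurableSet_Icc
  have h2 : side T i ⊆ range fun σ => sideChart T i (σ, 0) := by
    rw [side_eq_image]; exact image_subset_range _ _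
  have h3 : (fun σ => sideChart T i (σ, 0)) ⁻¹' side T i = Icc 0 (len T i) := by
    rw [side_eq_image, preimage_image_eq _ hi.injective]
  rw [arclength, ← Measure.restrict_restrict_of_subset h2, ← h1, he.restrict_map, h3]

lemma measurableSet_side : MeasurableSet (side T i) := by
  rw [side_eq_image]
  exact (isometry_sideChart_zero T i).isClosedEmbedding.measurableEmbedding.measurableSet_image'
    measurableSet_Icc

lemma setIntegral_side {E : Type*} [NormedAddCommGroup E] [NormedSpace ℝ E] (F : Plane → E) :
    ∫ x in side T i, F x ∂arclength = ∫ σ in Icc 0 (len T i), F (sideChart T i (σ, 0)) := by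
  rw [arclength_restrict_side,
    (isometry_sideChart_zero T i).isClosedEmbedding.measurableEmbedding.integral_map]

lemma arclength_side_lt_top : arclength (side T i) < ⊤ := by
  have h : (arclength.restrict (side T i)) univ < ⊤ := by
    rw [arclength_restrict_side, Measure.map_apply
      (isometry_sideChart_zero T i).continuous.measurable MeasurableSet.univ]
    simp
  simpa using h

lemma bary_eq_zero_of_mem_side {x : Plane} (hx : x ∈ side T i) : bary T i x = 0 := by
  rw [side_eq_image] at hx
  obtain ⟨σ, -, rfl⟩ := hx
  rw [bary_sideChart, zero_div]

/-- On the intersection two barycentric coordinates vanish, hence the third equals `1`. The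
intersection has at most one point, and points are null. -/
lemma arclength_side_inter_side {j : Fin 3} (h : i ≠ j) :
    arclength (side T i ∩ side T j) = 0 := by
  have : NullSingletonClass arclength := Measure.nullSingletonClass_hausdorff Plane one_pos
  refine Set.Subsingleton.measure_zero (fun x hx y hy => ?_) arclength
  have hx1 := bary_eq_zero_of_mem_side T i hx.1
  have hx2 := bary_eq_zero_of_mem_side T j hx.2
  have hy1 := bary_eq_zero_of_mem_side T i hy.1
  have hy2 := bary_eq_zero_of_mem_side T j hy.2
  have hxs := sum_bary T x
  have hys := sum_bary T y
  rw [sum_eq_cyclic i] at hxs hys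
  have key : ∀ l, bary T l x = bary T l y := by
    intro l
    rcases eq_or_eq_or_eq i j with rfl | rfl | rfl
    · exact absurd rfl h
    · rcases eq_or_eq_or_eq i l with rfl | rfl | rfl <;> linarith
    · rcases eq_or_eq_or_eq i l with rfl | rfl | rfl <;> linarith
  rw [← sum_bary_smul T x, ← sum_bary_smul T y]
  simp only [key]

/-- The boundary of the triangle. -/
def bdry : Set Plane := ⋃ j, side T j

lemma measurableSet_bdry : MeasurableSet (bdry T) :=
  MeasurableSet.iUnion fun j => measurableSet_side T j

instance isFiniteMeasure_bdry : IsFiniteMeasure (arclength.restrict (bdry T)) := by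
  refine ⟨?_⟩
  rw [Measure.restrict_apply_univ]
  exact (measure_iUnion_le _).trans_lt
    (by rw [tsum_fintype]; exact ENNReal.sum_lt_top.2 fun j _ => arclength_side_lt_top T j)

/-! ### Dilations about a vertex -/

/-- The dilation with centre `p` and factor `s`. -/
def _root_.TriangleWave.dil (p : Plane) (s : ℝ) (x : Plane) : Plane := p + s • (x - p)

/-- Relative to the centre an affine function scales by `s`. The own coordinate of the vertex equals
`1` there, so `1 - bᵢ` scales; the other two vanish there, so they scale themselves. -/
lemma bary_dil_self (s : ℝ) (x : Plane) :
    bary T i (dil (T.points i) s x) = 1 - s * (1 - bary T i x) := by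
  have h1 := bary_sub T i (dil (T.points i) s x) (T.points i)
  have h2 := bary_sub T i x (T.points i)
  rw [bary_points_self] at h1 h2
  have h3 : dil (T.points i) s x - T.points i = s • (x - T.points i) := by simp [dil]
  rw [h3, real_inner_smul_right] at h1
  linear_combination h1 - s * h2

lemma bary_dil_of_ne {j : Fin 3} (h : j ≠ i) (s : ℝ) (x : Plane) :
    bary T j (dil (T.points i) s x) = s * bary T j x := by
  have h1 := bary_sub T j (dil (T.points i) s x) (T.points i)
  have h2 := bary_sub T j x (T.points i)
  rw [bary_points_of_ne T j h] at h1 h2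
  have h3 : dil (T.points i) s x - T.points i = s • (x - T.points i) := by simp [dil]
  rw [h3, real_inner_smul_right] at h1
  linear_combination h1 - s * h2

end Tri

end

section

open scoped Topology

/-! ### Cauchy–Schwarz for `L²` functions -/

section CauchySchwarz

variable {α : Type*} [MeasurableSpace α] {μ : Measure α}

lemma norm_integral_mul_le_eLpNorm {a b : α → ℂ} (ha : MemLp a 2 μ) (hb : MemLp b 2 μ) :
    ‖∫ x, a x * b x ∂μ‖ ≤ (eLpNorm a 2 μ).toReal * (eLpNorm b 2 μ).toReal := by
  have hb' : MemLp (fun x => (starRingEnd ℂ) (b x)) 2 μ := hb.star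
  have h1 : ∫ x, a x * b x ∂μ = inner ℂ hb'.toLp ha.toLp := by
    rw [L2.inner_def]
    refine integral_congr_ae ?_
    filter_upwards [ha.coeFn_toLp, hb'.coeFn_toLp] with x hx hx'
    rw [hx, hx']
    simp [RCLike.inner_apply]
  have h2 : eLpNorm (fun x => (starRingEnd ℂ) (b x)) 2 μ = eLpNorm b 2 μ :=
    eLpNorm_congr_norm_ae (ae_of_all _ fun x => by simp)
  rw [h1]
  refine (norm_inner_le_norm _ _).trans ?_
  rw [Lp.norm_toLp, Lp.norm_toLp, h2, mul_comm]

lemma toReal_eLpNorm_two_eq_sqrt {E : Type*} [NormedAddCommGroup E] {a : α → E}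
    (ha : MemLp a 2 μ) : (eLpNorm a 2 μ).toReal = √(∫ x, ‖a x‖ ^ 2 ∂μ) := by
  rw [ha.eLpNorm_eq_integral_rpow_norm (by simp) (by simp),
    ENNReal.toReal_ofReal (by positivity), Real.sqrt_eq_rpow]
  simp

lemma norm_integral_mul_le_sqrt {a b : α → ℂ} (ha : MemLp a 2 μ) (hb : MemLp b 2 μ) :
    ‖∫ x, a x * b x ∂μ‖ ≤ √(∫ x, ‖a x‖ ^ 2 ∂μ) * √(∫ x, ‖b x‖ ^ 2 ∂μ) := by
  rw [← toReal_eLpNorm_two_eq_sqrt ha, ← toReal_eLpNorm_two_eq_sqrt hb]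
  exact norm_integral_mul_le_eLpNorm ha hb

lemma integral_mul_norm_le_sqrt {E F : Type*} [NormedAddCommGroup E] [NormedAddCommGroup F]
    {a : α → E} {b : α → F} (ha : MemLp a 2 μ) (hb : MemLp b 2 μ) :
    ∫ x, ‖a x‖ * ‖b x‖ ∂μ ≤ √(∫ x, ‖a x‖ ^ 2 ∂μ) * √(∫ x, ‖b x‖ ^ 2 ∂μ) := by
  have h := norm_integral_mul_le_sqrt (a := fun x => ((‖a x‖ : ℝ) : ℂ))
    (b := fun x => ((‖b x‖ : ℝ) : ℂ)) ha.norm.ofReal hb.norm.ofReal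
  have h2 : ∫ x, ((‖a x‖ : ℝ) : ℂ) * ((‖b x‖ : ℝ) : ℂ) ∂μ
      = ((∫ x, ‖a x‖ * ‖b x‖ ∂μ : ℝ) : ℂ) := by
    rw [← integral_complex_ofReal]
    simp
  rw [h2] at h
  simp only [Complex.norm_real, norm_norm] at h
  exact (le_abs_self _).trans h

end CauchySchwarz

/-! ### Change of variables for dilations -/

lemma dil_one (p x : Plane) : dil p 1 x = x := by simp [dil]

lemma dil_dil (p : Plane) (s t : ℝ) (x : Plane) : dil p s (dil p t x) = dil p (s * t) x := by
  simp [dil, smul_smul]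

lemma dil_sub (p : Plane) (s : ℝ) (x : Plane) : dil p s x - p = s • (x - p) := by simp [dil]

lemma dil_eq (p : Plane) (s : ℝ) (x : Plane) : dil p s x = s • x + (p - s • p) := by
  simp only [dil, smul_sub]; abel

lemma continuous_dil (p : Plane) (s : ℝ) : Continuous (dil p s) := by unfold dil; fun_prop

lemma contDiff_dil (p : Plane) (s : ℝ) : ContDiff ℝ ∞ (dil p s) := by
  unfold dil; fun_prop

/-- A dilation with non-zero factor, as a homeomorphism. -/
def dilHomeomorph (p : Plane) {s : ℝ} (hs : s ≠ 0) : Plane ≃ₜ Plane where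
  toFun := dil p s
  invFun := dil p s⁻¹
  left_inv x := by rw [dil_dil, inv_mul_cancel₀ hs, dil_one]
  right_inv x := by rw [dil_dil, mul_inv_cancel₀ hs, dil_one]
  continuous_toFun := continuous_dil p s
  continuous_invFun := continuous_dil p s⁻¹

lemma measurableEmbedding_dil (p : Plane) {s : ℝ} (hs : s ≠ 0) : MeasurableEmbedding (dil p s) :=
  (dilHomeomorph p hs).measurableEmbedding

lemma map_dil (p : Plane) {s : ℝ} (hs : 0 < s) :
    Measure.map (dil p s) volume = ENNReal.ofReal (s ^ 2)⁻¹ • (volume : Measure Plane) := by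
  have h1 : dil p s = (fun x => x + (p - s • p)) ∘ fun x => s • x := funext (dil_eq p s)
  rw [h1, ← Measure.map_map (by fun_prop) (by fun_prop), Measure.map_addHaar_smul _ hs.ne']
  simp only [finrank_euclideanSpace, Fintype.card_fin]
  rw [Measure.map_smul, map_add_right_eq_self, abs_of_nonneg (by positivity)]

lemma integral_comp_dil {E : Type*} [NormedAddCommGroup E] [NormedSpace ℝ E] (p : Plane) {s : ℝ}
    (hs : 0 < s) (F : Plane → E) : ∫ x, F (dil p s x) = (s ^ 2)⁻¹ • ∫ x, F x := by
  rw [← (measurableEmbedding_dil p hs.ne').integral_map, map_dil p hs, integral_smul_measure,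
    ENNReal.toReal_ofReal (by positivity)]

lemma eLpNorm_comp_dil (p : Plane) {s : ℝ} (hs : 0 < s) {F : Plane → ℂ} :
    eLpNorm (fun x => F (dil p s x)) 2 volume = ENNReal.ofReal s⁻¹ * eLpNorm F 2 volume := by
  have h := (measurableEmbedding_dil p hs.ne').eLpNorm_map_measure (p := 2) (g := F)
    (μ := (volume : Measure Plane))
  rw [map_dil p hs, eLpNorm_smul_measure_of_ne_top (by simp)] at h
  rw [show (fun x => F (dil p s x)) = F ∘ dil p s from rfl, ← h, smul_eq_mul]
  congr 1
  rw [ENNReal.ofReal_rpow_of_pos (by positivity), ← inv_pow, ← Real.rpow_natCast,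
    ← Real.rpow_mul (by positivity)]
  simp

lemma memLp_comp_dil (p : Plane) {s : ℝ} (hs : 0 < s) {F : Plane → ℂ} (hF : MemLp F 2 volume) :
    MemLp (fun x => F (dil p s x)) 2 volume := by
  refine ⟨?_, ?_⟩
  · have h : Measure.QuasiMeasurePreserving (dil p s) volume volume :=
      ⟨(continuous_dil p s).measurable, by
        rw [map_dil p hs]; exact Measure.smul_absolutelyContinuous⟩
    exact hF.1.comp_quasiMeasurePreserving h
  · rw [eLpNorm_comp_dil p hs]
    exact ENNReal.mul_lt_top ENNReal.ofReal_lt_top hF.2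

/-- Continuity in `L²` of rescaled dilations, for continuous functions of compact support. -/
lemma eventually_eLpNorm_dil_sub_le_of_continuous (p : Plane) {g : Plane → ℂ}
    (hg : Continuous g) (hc : HasCompactSupport g) {δ : ℝ} (hδ : 0 < δ) :
    ∀ᶠ c : ℝ in 𝓝 1, eLpNorm ((fun x => (c : ℂ) ^ 3 * g (dil p c x)) - g) 2 volume
      ≤ ENNReal.ofReal δ := by
  obtain ⟨R, hR0, hR⟩ := hc.isCompact.isBounded.subset_closedBall_lt 0 p
  -- For factors above `1/2` the dilated function is still supported in the ball of twice the
  -- radius, so one compact set serves all factors considered.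
  set K := Metric.closedBall p (2 * R) with hK
  have hKc : IsCompact K := isCompact_closedBall _ _
  set V : ℝ := (volume K).toReal ^ (1 / (2 : ℝ)) with hV
  have hV0 : 0 ≤ V := by positivity
  set η : ℝ := δ / (V + 1) with hη
  have hη0 : 0 < η := by positivity
  have hcont : Continuous fun z : ℝ × Plane =>
      dist ((z.1 : ℂ) ^ 3 * g (dil p z.1 z.2)) (g z.2) := by
    unfold dil; fun_prop
  have h1 : ∀ᶠ c : ℝ in 𝓝 1, ∀ y ∈ K, dist ((c : ℂ) ^ 3 * g (dil p c y)) (g y) < η := by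
    refine hKc.eventually_forall_of_forall_eventually fun y _ => ?_
    refine (hcont.tendsto (1, y)).eventually (gt_mem_nhds ?_)
    simpa [dil_one] using hη0
  have h2 : ∀ᶠ c in 𝓝 (1 : ℝ), 1 / 2 < c := lt_mem_nhds (by norm_num)
  filter_upwards [h1, h2] with c hc1 hc2
  have hgz : ∀ y, y ∉ Metric.closedBall p R → g y = 0 := fun y hy =>
    image_eq_zero_of_notMem_tsupport fun h => hy (hR h)
  have hs1 : Function.support (fun x => (c : ℂ) ^ 3 * g (dil p c x)) ⊆ K := by
    intro x hx
    by_contra hxK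
    refine hx ?_
    rw [hK, Metric.mem_closedBall, not_le, dist_eq_norm] at hxK
    simp only
    rw [hgz, mul_zero]
    rw [Metric.mem_closedBall, not_le, dist_eq_norm, dil_sub, norm_smul,
      Real.norm_of_nonneg (by linarith)]
    nlinarith
  have hs2 : Function.support g ⊆ K := by
    intro x hx
    by_contra hxK
    refine hx (hgz x fun h => hxK ?_)
    exact Metric.closedBall_subset_closedBall (by linarith) h
  refine (eLpNorm_sub_le_of_dist_bdd (c := η) volume (by simp) hKc.measurableSet hη0.le ?_ hs1
    hs2).trans ?_
  · intro x
    by_cases hx : x ∈ K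
    · exact (hc1 x hx).le
    · rw [Function.notMem_support.1 fun h => hx (hs1 h),
        Function.notMem_support.1 fun h => hx (hs2 h), dist_self]
      exact hη0.le
  · have hfin : volume K ≠ ⊤ := hKc.measure_lt_top.ne
    have : volume K ^ (1 / (2 : ℝ≥0∞).toReal) = ENNReal.ofReal V := by
      rw [hV, ← ENNReal.ofReal_rpow_of_nonneg ENNReal.toReal_nonneg (by norm_num),
        ENNReal.ofReal_toReal hfin]
      simp
    rw [this, ← ENNReal.ofReal_mul hη0.le]
    refine ENNReal.ofReal_le_ofReal ?_
    rw [hη, div_mul_eq_mul_div, div_le_iff₀ (by positivity)]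
    nlinarith

/-- Continuity in `L²` of rescaled dilations. -/
lemma eventually_eLpNorm_dil_sub_le (p : Plane) {f : Plane → ℂ} (hf : MemLp f 2 volume) {δ : ℝ}
    (hδ : 0 < δ) :
    ∀ᶠ c : ℝ in 𝓝 1, eLpNorm ((fun x => (c : ℂ) ^ 3 * f (dil p c x)) - f) 2 volume
      ≤ ENNReal.ofReal δ := by
  -- For `c < 2` the rescaled dilation multiplies norms by `c³ · c⁻¹ = c² ≤ 4`, so an approximation
  -- error of `δ/16` becomes at most `δ/4`. The total `δ/4 + δ/2 + δ/16` stays below `δ`.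
  obtain ⟨g, hgc, hfg, hg, hgm⟩ := hf.exists_hasCompactSupport_eLpNorm_sub_le (by simp)
    (ε := ENNReal.ofReal (δ / 16)) (by simpa using hδ)
  have h2 : ∀ᶠ c in 𝓝 (1 : ℝ), c ∈ Ioo (1 / 2 : ℝ) 2 :=
    Ioo_mem_nhds (by norm_num) (by norm_num)
  filter_upwards [eventually_eLpNorm_dil_sub_le_of_continuous p hg hgc (half_pos hδ), h2]
    with c hc hc2
  have hc0 : 0 < c := by linarith [hc2.1]
  have hd : MemLp (f - g) 2 volume := hf.sub hgm
  set A : Plane → ℂ := fun x => (c : ℂ) ^ 3 * (f - g) (dil p c x) with hA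
  have hAm : MemLp A 2 volume := (memLp_comp_dil p hc0 hd).const_mul _
  have hgm2 : MemLp (fun x => (c : ℂ) ^ 3 * g (dil p c x)) 2 volume :=
    (memLp_comp_dil p hc0 hgm).const_mul _
  have hsplit : (fun x => (c : ℂ) ^ 3 * f (dil p c x)) - f
      = A + (((fun x => (c : ℂ) ^ 3 * g (dil p c x)) - g) - (f - g)) := by
    funext x
    simp only [hA, Pi.sub_apply, Pi.add_apply]
    ring
  have hAn : eLpNorm A 2 volume ≤ ENNReal.ofReal (δ / 4) := by
    have h1 : A = (c : ℂ) ^ 3 • fun x => (f - g) (dil p c x) := rfl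
    have hn : ‖(c : ℂ) ^ 3‖ₑ = ENNReal.ofReal (c ^ 3) := by
      rw [← ofReal_norm]
      simp [abs_of_pos hc0]
    rw [h1, eLpNorm_const_smul, eLpNorm_comp_dil p hc0, hn]
    refine (mul_le_mul_right (mul_le_mul_right hfg _) _).trans ?_
    rw [← ENNReal.ofReal_mul (by positivity), ← ENNReal.ofReal_mul (by positivity)]
    refine ENNReal.ofReal_le_ofReal ?_
    have : c ^ 3 * (c⁻¹ * (δ / 16)) = c ^ 2 * (δ / 16) := by field_simp
    have hc4 : c ^ 2 ≤ 4 := by nlinarith [hc2.2]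
    rw [this]
    nlinarith
  rw [hsplit]
  refine (eLpNorm_add_le hAm.1 ((hgm2.sub hgm).sub hd).1 (by simp)).trans ?_
  refine (add_le_add hAn ((eLpNorm_sub_le (hgm2.sub hgm).1 hd.1 (by simp)).trans
    (add_le_add hc hfg))).trans ?_
  rw [← ENNReal.ofReal_add (by positivity) (by positivity),
    ← ENNReal.ofReal_add (by positivity) (by positivity)]
  exact ENNReal.ofReal_le_ofReal (by linarith)

/-! ### The derivative of `s ↦ ∫ f w̄(p + s(x - p))` -/

variable {Ω : Set Plane}

/-- The derivative of `s ↦ ∫ f w̄(p + s(x - p))`. -/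
def dilDeriv (p : Plane) (f : L2 Ω) (φ : Plane → ℂ) (s : ℝ) : ℂ :=
  ∫ x in Ω, f x * (starRingEnd ℂ) (fderiv ℝ φ (dil p s x) (x - p))

lemma isFiniteMeasure_restrict (hΩ : Bornology.IsBounded Ω) :
    IsFiniteMeasure ((volume : Measure Plane).restrict Ω) :=
  ⟨by simpa using hΩ.measure_lt_top⟩

lemma integrable_L2 (hΩ : Bornology.IsBounded Ω) (f : L2 Ω) :
    Integrable f (volume.restrict Ω) :=
  have := isFiniteMeasure_restrict hΩ
  (Lp.memLp f).integrable (by simp)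

/-- Differentiation under the integral: the gradient of `φ` is bounded and `|x - p| ≤ M` on the
domain, so a multiple of `|f|` dominates for all `s` at once. -/
lemma hasDerivAt_integral_dil (hΩ : Bornology.IsBounded Ω) (hm : MeasurableSet Ω) {p : Plane}
    {M : ℝ} (hM : ∀ x ∈ Ω, dist x p ≤ M) (f : L2 Ω) {φ : Plane → ℂ} (hφ : IsTest Ω φ) (s₀ : ℝ) :
    HasDerivAt (fun s => ∫ x in Ω, f x * (starRingEnd ℂ) (φ (dil p s x)))
      (dilDeriv p f φ s₀) s₀ := by
  have hfd := hφ.1.continuous_fderiv (by simp)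
  obtain ⟨C, hC⟩ := hfd.bounded_above_of_compact_support (hφ.2.1.fderiv (𝕜 := ℝ))
  have hC0 : 0 ≤ C := (norm_nonneg _).trans (hC p)
  have hmeas : ∀ s, AEStronglyMeasurable (fun x => f x * (starRingEnd ℂ) (φ (dil p s x)))
      (volume.restrict Ω) := fun s =>
    (Lp.aestronglyMeasurable f).mul (Complex.continuous_conj.comp
      (hφ.1.continuous.comp (continuous_dil p s))).aestronglyMeasurable
  obtain ⟨B, hB⟩ := hφ.1.continuous.bounded_above_of_compact_support hφ.2.1
  refine (hasDerivAt_integral_of_dominated_loc_of_deriv_le (s := univ)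
    (F := fun s x => f x * (starRingEnd ℂ) (φ (dil p s x)))
    (F' := fun s x => f x * (starRingEnd ℂ) (fderiv ℝ φ (dil p s x) (x - p)))
    (bound := fun x => ‖f x‖ * (C * M)) Filter.univ_mem
    (Filter.Eventually.of_forall hmeas) ?_ ?_ ?_ ?_ ?_).2
  · refine ((integrable_L2 hΩ f).norm.mul_const B).mono' (hmeas s₀) (ae_of_all _ fun x => ?_)
    rw [norm_mul, RCLike.norm_conj]
    exact mul_le_mul_of_nonneg_left (hB _) (norm_nonneg _)
  · refine (Lp.aestronglyMeasurable f).mul (Complex.continuous_conj.comp ?_).aestronglyMeasurable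
    exact (hfd.comp (continuous_dil p s₀)).clm_apply (by fun_prop)
  · filter_upwards [ae_restrict_mem hm] with x hx s _
    rw [norm_mul, RCLike.norm_conj]
    refine mul_le_mul_of_nonneg_left ?_ (norm_nonneg _)
    refine (ContinuousLinearMap.le_opNorm _ _).trans ?_
    have := hM x hx
    rw [dist_eq_norm] at this
    exact mul_le_mul (hC _) this (norm_nonneg _) hC0
  · exact (integrable_L2 hΩ f).norm.mul_const _
  · refine ae_of_all _ fun x s _ => ?_
    have h1 : HasDerivAt (fun s : ℝ => dil p s x) (x - p) s := by
      have := ((hasDerivAt_id s).smul_const (x - p)).const_add p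
      simpa [dil] using this
    have h2 := ((hφ.1.differentiable (by simp) (dil p s x)).hasFDerivAt).comp_hasDerivAt s h1
    have h3 := (Complex.conjCLE.toContinuousLinearMap.hasFDerivAt
      (x := φ (dil p s x))).comp_hasDerivAt s h2
    exact h3.const_mul (f x)

/-- The substitution `y = p + s(x - p)` moves the dependence on `s` from `φ` to `f`. The Jacobian
contributes `s⁻²` and `x - p = s⁻¹ (y - p)` contributes one more factor, whence the cube. -/
lemma dilDeriv_eq (hm : MeasurableSet Ω) (p : Plane) (f : L2 Ω) (φ : Plane → ℂ) {s : ℝ}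
    (hs : 0 < s) :
    dilDeriv p f φ s = ∫ y, ((s⁻¹ : ℝ) : ℂ) ^ 3 * (Ω.indicator f (dil p s⁻¹ y))
      * (starRingEnd ℂ) (fderiv ℝ φ y (y - p)) := by
  have h1 := integral_comp_dil p hs (fun y => ((s⁻¹ : ℝ) : ℂ) * (Ω.indicator f (dil p s⁻¹ y))
      * (starRingEnd ℂ) (fderiv ℝ φ y (y - p)))
  rw [dilDeriv, ← integral_indicator hm]
  have h2 : ∀ x, Ω.indicator (fun x => f x * (starRingEnd ℂ) (fderiv ℝ φ (dil p s x) (x - p))) x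
      = ((s⁻¹ : ℝ) : ℂ) * (Ω.indicator f (dil p s⁻¹ (dil p s x)))
      * (starRingEnd ℂ) (fderiv ℝ φ (dil p s x) (dil p s x - p)) := by
    intro x
    rw [dil_dil, inv_mul_cancel₀ hs.ne', dil_one, dil_sub, map_smul]
    by_cases hx : x ∈ Ω
    · rw [indicator_of_mem hx, indicator_of_mem hx]
      have : (s : ℂ) ≠ 0 := by exact_mod_cast hs.ne'
      simp only [Complex.real_smul, map_mul, Complex.conj_ofReal, Complex.ofReal_inv]
      field_simp
    · rw [indicator_of_notMem hx, indicator_of_notMem hx]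
      ring
  simp_rw [h2]
  rw [h1, ← integral_smul]
  refine integral_congr_ae (ae_of_all _ fun y => ?_)
  simp only [Complex.real_smul]
  push_cast
  ring

lemma memLp_radialDeriv {φ : Plane → ℂ} (hφ : IsTest Ω φ) (p : Plane) :
    MemLp (fun y => (starRingEnd ℂ) (fderiv ℝ φ y (y - p))) 2 volume := by
  refine Continuous.memLp_of_hasCompactSupport ?_ ?_
  · exact Complex.continuous_conj.comp
      ((hφ.1.continuous_fderiv (by simp)).clm_apply (by fun_prop))
  · refine (hφ.2.1.fderiv (𝕜 := ℝ)).mono ?_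
    intro x hx
    simp only [Function.mem_support, ne_eq] at hx ⊢
    exact fun h => hx (by simp [h])

lemma integral_radialDeriv_le (hΩ : Bornology.IsBounded Ω) (hm : MeasurableSet Ω) {p : Plane}
    {M : ℝ} (hM : ∀ x ∈ Ω, dist x p ≤ M) {φ : Plane → ℂ}
    (hφ : IsTest Ω φ) :
    ∫ y, ‖(starRingEnd ℂ) (fderiv ℝ φ y (y - p))‖ ^ 2
      ≤ M ^ 2 * normSq (gradL2 hΩ φ hφ.1) := by
  refine le_trans (le_of_eq ?_) (norm_sq_radial_le hΩ hm hM _)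
  rw [norm_sq_L2_eq, ← setIntegral_eq_integral_of_isTest hφ]
  · refine integral_congr_ae ?_
    filter_upwards [radial_gradL2_coeFn hΩ p hφ.1] with x hx
    rw [hx, RCLike.norm_conj]
  · intro x hx
    rw [fderiv_of_notMem_tsupport ℝ hx]
    simp

lemma memLp_indicator (hm : MeasurableSet Ω) (f : L2 Ω) :
    MemLp (Ω.indicator f) 2 volume :=
  (memLp_indicator_iff_restrict hm).2 (Lp.memLp f)

/-- After the substitution the difference is the pairing of a function depending on `f` and `s` only
with the radial derivative of `φ`. Cauchy–Schwarz separates the two, which is the source of the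
uniformity in `φ`. -/
lemma norm_dilDeriv_sub_le (hΩ : Bornology.IsBounded Ω) (hm : MeasurableSet Ω) {p : Plane}
    {M : ℝ} (hM0 : 0 ≤ M) (hM : ∀ x ∈ Ω, dist x p ≤ M) (f : L2 Ω) {φ : Plane → ℂ}
    (hφ : IsTest Ω φ) {s : ℝ} (hs : 0 < s) :
    ‖dilDeriv p f φ s - dilDeriv p f φ 1‖ ≤
      (eLpNorm ((fun x => ((s⁻¹ : ℝ) : ℂ) ^ 3 * Ω.indicator f (dil p s⁻¹ x))
        - Ω.indicator f) 2 volume).toReal * (M * √(normSq (gradL2 hΩ φ hφ.1))) := by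
  have hF := memLp_radialDeriv hφ p
  have hi := memLp_indicator hm f
  have hk : MemLp (fun x => ((s⁻¹ : ℝ) : ℂ) ^ 3 * Ω.indicator f (dil p s⁻¹ x)) 2 volume :=
    (memLp_comp_dil p (inv_pos.2 hs) hi).const_mul _
  have h1 : dilDeriv p f φ s - dilDeriv p f φ 1
      = ∫ y, ((fun x => ((s⁻¹ : ℝ) : ℂ) ^ 3 * Ω.indicator f (dil p s⁻¹ x))
        - Ω.indicator f) y * (starRingEnd ℂ) (fderiv ℝ φ y (y - p)) := by
    rw [dilDeriv_eq hm p f φ hs, dilDeriv_eq hm p f φ one_pos, ← integral_sub]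
    · refine integral_congr_ae (ae_of_all _ fun y => ?_)
      simp only [Pi.sub_apply, inv_one, dil_one]
      push_cast
      ring
    · exact hk.integrable_mul hF
    · simp only [inv_one, dil_one, Complex.ofReal_one, one_pow, one_mul]
      exact hi.integrable_mul hF
  rw [h1]
  refine (norm_integral_mul_le_eLpNorm (hk.sub hi) hF).trans ?_
  refine mul_le_mul_of_nonneg_left ?_ ENNReal.toReal_nonneg
  rw [toReal_eLpNorm_two_eq_sqrt hF]
  refine (Real.sqrt_le_sqrt (integral_radialDeriv_le hΩ hm hM hφ)).trans (le_of_eq ?_)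
  rw [Real.sqrt_mul (by positivity), Real.sqrt_sq hM0]

/-- First order expansion of `s ↦ ∫ f w̄(p + s(x - p))`, uniformly in the test function `w`. -/
lemma exists_norm_inner_dil_sub_le (hΩ : Bornology.IsBounded Ω) (hm : MeasurableSet Ω)
    {p : Plane} {M : ℝ} (hM0 : 0 ≤ M) (hM : ∀ x ∈ Ω, dist x p ≤ M) (f : L2 Ω) {δ : ℝ}
    (hδ : 0 < δ) :
    ∃ ε₀ > 0, ∀ (φ : Plane → ℂ) (hφ : IsTest Ω φ) (s : ℝ), |s - 1| ≤ ε₀ →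
      ‖inner ℂ (toL2 hΩ (fun x => φ (dil p s x)) (hφ.1.continuous.comp (continuous_dil p s))) f
        - inner ℂ (toL2 hΩ φ hφ.1.continuous) f
        - ((s - 1 : ℝ) : ℂ) * inner ℂ (radial hΩ p (gradL2 hΩ φ hφ.1)) f‖
      ≤ δ * |s - 1| * √(normSq (gradL2 hΩ φ hφ.1)) := by
  have hδ' : 0 < δ / (M + 1) := by positivity
  have hinv : Filter.Tendsto (fun s : ℝ => s⁻¹) (𝓝 1) (𝓝 1) := by
    simpa using (continuousAt_inv₀ (one_ne_zero (α := ℝ))).tendsto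
  have hev := hinv.eventually (eventually_eLpNorm_dil_sub_le p (memLp_indicator hm f) hδ')
  have hpos : ∀ᶠ s : ℝ in 𝓝 1, 0 < s := lt_mem_nhds one_pos
  obtain ⟨ε, hε, hball⟩ := Metric.eventually_nhds_iff.1 (hev.and hpos)
  refine ⟨ε / 2, by positivity, fun φ hφ s hs => ?_⟩
  set N := √(normSq (gradL2 hΩ φ hφ.1)) with hN
  have hN0 : 0 ≤ N := Real.sqrt_nonneg _
  have hbound : ∀ t ∈ Metric.closedBall (1 : ℝ) (ε / 2),
      ‖dilDeriv p f φ t - dilDeriv p f φ 1‖ ≤ δ * N := by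
    intro t ht
    obtain ⟨h1, h2⟩ := hball (y := t) (lt_of_le_of_lt (Metric.mem_closedBall.1 ht) (by linarith))
    refine (norm_dilDeriv_sub_le hΩ hm hM0 hM f hφ h2).trans ?_
    have h3 := ENNReal.toReal_mono ENNReal.ofReal_ne_top h1
    rw [ENNReal.toReal_ofReal hδ'.le] at h3
    refine (mul_le_mul_of_nonneg_right h3 (by positivity)).trans ?_
    rw [← mul_assoc]
    refine mul_le_mul_of_nonneg_right ?_ hN0
    rw [div_mul_eq_mul_div, div_le_iff₀ (by positivity)]
    nlinarith
  -- The mean value inequality is applied to `F(s) - s F'(1)`, whose derivative `F'(s) - F'(1)` is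
  -- small uniformly in `φ` relative to its gradient norm.
  have hd : ∀ t ∈ Metric.closedBall (1 : ℝ) (ε / 2), HasDerivWithinAt
      (fun s : ℝ => (∫ x in Ω, f x * (starRingEnd ℂ) (φ (dil p s x)))
        - (s : ℂ) * dilDeriv p f φ 1)
      (dilDeriv p f φ t - dilDeriv p f φ 1) (Metric.closedBall (1 : ℝ) (ε / 2)) t := by
    intro t _
    have h1 := hasDerivAt_integral_dil hΩ hm hM f hφ t
    have h2 := (Complex.ofRealCLM.hasDerivAt (x := t)).mul_const (dilDeriv p f φ 1)
    simp only [Complex.ofRealCLM_apply, Complex.ofReal_one, one_mul] at h2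
    exact (h1.sub h2).hasDerivWithinAt
  have h := (convex_closedBall (1 : ℝ) (ε / 2)).norm_image_sub_le_of_norm_hasDerivWithin_le hd
    hbound (Metric.mem_closedBall_self (by positivity)) (y := s)
    (by rwa [Metric.mem_closedBall, Real.dist_eq])
  have e1 : inner ℂ (radial hΩ p (gradL2 hΩ φ hφ.1)) f = dilDeriv p f φ 1 := by
    rw [inner_L2_eq, dilDeriv]
    refine integral_congr_ae ?_
    filter_upwards [radial_gradL2_coeFn hΩ p hφ.1] with x hx
    rw [hx, dil_one]
  rw [inner_toL2_eq, inner_toL2_eq, e1]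
  simp only [dil_one, Real.norm_eq_abs] at h
  calc _ = _ := by
        congr 1
        push_cast
        ring
    _ ≤ _ := h
    _ = _ := by ring

end

section

open scoped Topology RealInnerProductSpace

/-! ### Dilations of test functions -/

lemma pderiv_comp_dil {φ : Plane → ℂ} (hφ : ContDiff ℝ ∞ φ) (p : Plane) (s : ℝ) (j : Fin 2)
    (x : Plane) : pderiv j (fun x => φ (dil p s x)) x = s • pderiv j φ (dil p s x) := by
  have h1 : HasFDerivAt (dil p s) (s • ContinuousLinearMap.id ℝ Plane) x := by
    unfold dil
    exact (((hasFDerivAt_id x).sub_const p).const_smul s).const_add p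
  have h2 := ((hφ.differentiable (by simp) (dil p s x)).hasFDerivAt).comp x h1
  unfold pderiv
  rw [show (fun x => φ (dil p s x)) = φ ∘ dil p s from rfl, h2.fderiv]
  simp

lemma gradSq_comp_dil {φ : Plane → ℂ} (hφ : ContDiff ℝ ∞ φ) (p : Plane) (s : ℝ) (x : Plane) :
    gradSq (fun x => φ (dil p s x)) x = s ^ 2 * gradSq φ (dil p s x) := by
  simp only [gradSq, pderiv_comp_dil hφ, norm_smul, mul_pow, Real.norm_eq_abs, sq_abs,
    Finset.mul_sum]

lemma contDiff_comp_dil {φ : Plane → ℂ} (hφ : ContDiff ℝ ∞ φ) (p : Plane) (s : ℝ) :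
    ContDiff ℝ ∞ fun x => φ (dil p s x) :=
  hφ.comp (contDiff_dil p s)

lemma gradSq_eq_zero_of_notMem {φ : Plane → ℂ} {x : Plane} (hx : x ∉ tsupport φ) :
    gradSq φ x = 0 := by
  simp [gradSq, pderiv_eq_zero_of_notMem hx]

lemma le_of_mem_H10 {Ω : Set Plane} (hΩ : Bornology.IsBounded Ω)
    {F : L2 Ω × (Fin 2 → L2 Ω) → ℝ} (hF : Continuous F) {A : ℝ}
    (h : ∀ (φ : Plane → ℂ) (hφ : IsTest Ω φ),
      A ≤ F (toL2 hΩ φ hφ.1.continuous, gradL2 hΩ φ hφ.1))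
    {q : L2 Ω × (Fin 2 → L2 Ω)} (hq : q ∈ H10 Ω) : A ≤ F q :=
  H10_induction hΩ (P := fun q => A ≤ F q) (isClosed_le continuous_const hF) h hq

namespace Tri

variable (T : Affine.Triangle ℝ Plane) (i : Fin 3)

/-- `2 Re ∫ f (x - pᵢ) · ∇v̄`, where `G = ∇v`. -/
def rellich (G : Fin 2 → L2 T.interior) (f : L2 T.interior) : ℝ :=
  2 * (inner ℂ (radial (isBounded_interior T) (T.points i) G) f).re

/-- Expanding about a vertex enlarges the triangle, so preimages of interior points are interior.
Composing with such a dilation therefore preserves test functions. -/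
lemma mem_interior_of_dil_mem {s : ℝ} (hs : 1 ≤ s) {x : Plane}
    (hx : dil (T.points i) s x ∈ T.interior) : x ∈ T.interior := by
  rw [mem_interior_iff] at hx ⊢
  have hs0 : 0 < s := by linarith
  intro j
  rcases eq_or_ne j i with rfl | hj
  · have h1 := hx j
    rw [bary_dil_self] at h1
    by_contra h
    nlinarith
  · have h1 := hx j
    rw [bary_dil_of_ne T i hj] at h1
    exact pos_of_mul_pos_right h1 hs0.le

lemma isTest_comp_dil {s : ℝ} (hs : 1 ≤ s) {φ : Plane → ℂ} (hφ : IsTest T.interior φ) :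
    IsTest T.interior fun x => φ (dil (T.points i) s x) := by
  have hs0 : s ≠ 0 := by linarith
  refine ⟨contDiff_comp_dil hφ.1 _ _, hφ.2.1.comp_homeomorph (dilHomeomorph _ hs0), ?_⟩
  have h := tsupport_comp_eq_preimage φ (dilHomeomorph (T.points i) hs0)
  have h2 : tsupport (fun x => φ (dil (T.points i) s x))
      = dil (T.points i) s ⁻¹' tsupport φ := h
  rw [h2]
  exact fun x hx => mem_interior_of_dil_mem T i hs (hφ.2.2 hx)

/-- Contraction about a vertex maps the triangle onto the similar triangle cut off by the line `bᵢ =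
1 - s` parallel to the opposite side. -/
lemma dil_mem_interior_iff {s : ℝ} (hs : 0 < s) (hs1 : s ≤ 1) {x : Plane} :
    x ∈ T.interior ↔ dil (T.points i) s x ∈ T.interior ∩ {y | 1 - s < bary T i y} := by
  rw [mem_inter_iff, mem_interior_iff, mem_interior_iff, mem_ofPred_eq, bary_dil_self]
  constructor
  · intro h
    refine ⟨fun j => ?_, by nlinarith [h i]⟩
    rcases eq_or_ne j i with rfl | hj
    · rw [bary_dil_self]; nlinarith [h j]
    · rw [bary_dil_of_ne T i hj]; exact mul_pos hs (h j)
  · rintro ⟨h1, h2⟩ j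
    rcases eq_or_ne j i with rfl | hj
    · by_contra h; nlinarith
    · have := h1 j
      rw [bary_dil_of_ne T i hj] at this
      exact pos_of_mul_pos_right this hs.le

lemma measurableSet_bary_lt (c : ℝ) : MeasurableSet {x | bary T i x < c} :=
  (isOpen_lt (continuous_bary T i) continuous_const).measurableSet

lemma measurableSet_bary_le (c : ℝ) : MeasurableSet {x | bary T i x ≤ c} :=
  (isClosed_le (continuous_bary T i) continuous_const).measurableSet

lemma measurableSet_lt_bary (c : ℝ) : MeasurableSet {x | c < bary T i x} :=
  (isOpen_lt continuous_const (continuous_bary T i)).measurableSet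

/-- Conformal invariance in the plane: the factor `s²` from the gradient cancels the Jacobian `s⁻²`,
and no part of the support is lost. -/
lemma normSq_gradL2_comp_dil_of_one_le {s : ℝ} (hs : 1 ≤ s) {φ : Plane → ℂ}
    (hφ : IsTest T.interior φ) :
    normSq (gradL2 (isBounded_interior T) _ (contDiff_comp_dil hφ.1 (T.points i) s))
      = normSq (gradL2 (isBounded_interior T) φ hφ.1) := by
  have hs0 : 0 < s := by linarith
  rw [normSq_gradL2, normSq_gradL2, setIntegral_eq_integral_of_isTest hφ fun x hx =>
    gradSq_eq_zero_of_notMem hx, setIntegral_eq_integral_of_isTest (isTest_comp_dil T i hs hφ)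
    fun x hx => gradSq_eq_zero_of_notMem hx]
  simp_rw [gradSq_comp_dil hφ.1]
  rw [integral_const_mul, integral_comp_dil _ hs0, smul_eq_mul, ← mul_assoc,
    mul_inv_cancel₀ (by positivity), one_mul]

/-- The same invariance, except that the image of the triangle now misses a strip along the side.
The energy of `φ` in this strip is exactly what is lost, and `rellich_le` needs this gain. -/
lemma normSq_gradL2_comp_dil_of_le_one {s : ℝ} (hs : 0 < s) (hs1 : s ≤ 1) {φ : Plane → ℂ}
    (hφ : IsTest T.interior φ) :
    normSq (gradL2 (isBounded_interior T) _ (contDiff_comp_dil hφ.1 (T.points i) s))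
      = normSq (gradL2 (isBounded_interior T) φ hφ.1)
        - ∫ x in T.interior ∩ {x | bary T i x ≤ 1 - s}, gradSq φ x := by
  have hm := measurableSet_interior T
  have hm2 : MeasurableSet (T.interior ∩ {y | 1 - s < bary T i y}) :=
    hm.inter (measurableSet_lt_bary T i _)
  rw [normSq_gradL2, normSq_gradL2]
  have h1 : ∫ x in T.interior, gradSq (fun x => φ (dil (T.points i) s x)) x
      = ∫ x in T.interior ∩ {y | 1 - s < bary T i y}, gradSq φ x := by
    rw [← integral_indicator hm, ← integral_indicator hm2]
    have h2 : ∀ x, T.interior.indicator (gradSq (fun x => φ (dil (T.points i) s x))) x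
        = s ^ 2 * (T.interior ∩ {y | 1 - s < bary T i y}).indicator (gradSq φ)
          (dil (T.points i) s x) := by
      intro x
      by_cases hx : x ∈ T.interior
      · rw [indicator_of_mem hx, indicator_of_mem ((dil_mem_interior_iff T i hs hs1).1 hx),
          gradSq_comp_dil hφ.1]
      · rw [indicator_of_notMem hx, indicator_of_notMem fun h =>
          hx ((dil_mem_interior_iff T i hs hs1).2 h), mul_zero]
    simp_rw [h2]
    rw [integral_const_mul, integral_comp_dil _ hs, smul_eq_mul, ← mul_assoc,
      mul_inv_cancel₀ (by positivity), one_mul]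
  have h3 : IntegrableOn (gradSq φ) T.interior :=
    integrable_of_continuous (isBounded_interior T) (continuous_gradSq hφ.1)
  have h4 := integral_inter_add_sdiff (s := T.interior) (measurableSet_bary_le T i (1 - s)) h3
  have h5 : T.interior \ {x | bary T i x ≤ 1 - s}
      = T.interior ∩ {y | 1 - s < bary T i y} := by
    ext x; simp
  rw [h1, ← h4, h5]
  ring

variable {T}

lemma continuous_rellich (f : L2 T.interior) : Continuous fun G => rellich T i G f := by
  have h : Continuous fun G => inner ℂ (radial (isBounded_interior T) (T.points i) G) f :=
    (radial (isBounded_interior T) (T.points i)).continuous.inner continuous_const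
  exact continuous_const.mul (Complex.continuous_re.comp h)

/-- Passage from test functions to a function of `H¹₀` in the dilation inequalities. -/
lemma le_of_forall_isTest {v : L2 T.interior} {G : Fin 2 → L2 T.interior} {f : L2 T.interior}
    (hv : (v, G) ∈ H10 T.interior) (hG : IsWeakDiv T.interior G f) {A δ s : ℝ}
    (hdil : ∀ (φ : Plane → ℂ) (hφ : IsTest T.interior φ),
      ‖inner ℂ (toL2 (isBounded_interior T) (fun x => φ (dil (T.points i) s x))
          (hφ.1.continuous.comp (continuous_dil _ s))) f
        - inner ℂ (toL2 (isBounded_interior T) φ hφ.1.continuous) f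
        - ((s - 1 : ℝ) : ℂ) * inner ℂ (radial (isBounded_interior T) (T.points i)
            (gradL2 (isBounded_interior T) φ hφ.1)) f‖
      ≤ δ * |s - 1| * √(normSq (gradL2 (isBounded_interior T) φ hφ.1)))
    (hA : ∀ (φ : Plane → ℂ) (hφ : IsTest T.interior φ),
      A ≤ normSq G + normSq (gradL2 (isBounded_interior T) φ hφ.1)
        + 2 * (inner ℂ (toL2 (isBounded_interior T) (fun x => φ (dil (T.points i) s x))
          (hφ.1.continuous.comp (continuous_dil _ s))) f).re) :
    A ≤ (s - 1) * rellich T i G f + 2 * (δ * |s - 1| * √(normSq G)) := by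
  have h4 : Continuous fun q : L2 T.interior × (Fin 2 → L2 T.interior) => normSq q.2 :=
    continuous_normSq.comp continuous_snd
  have h2 : Continuous fun q : L2 T.interior × (Fin 2 → L2 T.interior) =>
      (inner ℂ q.1 f).re := Complex.continuous_re.comp (continuous_fst.inner continuous_const)
  have h3 : Continuous fun q : L2 T.interior × (Fin 2 → L2 T.interior) =>
      rellich T i q.2 f := (continuous_rellich i f).comp continuous_snd
  have h5 : Continuous fun q : L2 T.interior × (Fin 2 → L2 T.interior) =>
      normSq G + normSq q.2 + 2 * (inner ℂ q.1 f).re + (s - 1) * rellich T i q.2 f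
      + 2 * (δ * |s - 1| * √(normSq q.2)) :=
    (((continuous_const.add h4).add (continuous_const.mul h2)).add
        (continuous_const.mul h3)).add (continuous_const.mul (continuous_const.mul h4.sqrt))
  have key := le_of_mem_H10 (isBounded_interior T) h5 (A := A) (fun φ hφ => by
      have h1 := (Complex.re_le_norm _).trans (hdil φ hφ)
      have h2 := hA φ hφ
      simp only [Complex.sub_re, Complex.re_ofReal_mul] at h1
      simp only [rellich]
      linarith) hv
  simp only at key
  -- In the limit `φ → v` the terms of order zero cancel, because `Re ∫ f v̄ = -‖∇v‖²`. Only the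
  -- first order term in `s - 1` and the error survive.
  have h1 := vinner_eq_of_isWeakDiv (isBounded_interior T) hG hv
  rw [vinner_self] at h1
  have h2 : normSq G = -(inner ℂ v f).re := by
    have := congrArg Complex.re h1
    simpa using this
  linarith

variable (T)

lemma exists_dil_bound (f : L2 T.interior) {δ : ℝ} (hδ : 0 < δ) :
    ∃ ε₀ > 0, ∀ s : ℝ, |s - 1| ≤ ε₀ → ∀ (φ : Plane → ℂ) (hφ : IsTest T.interior φ),
      ‖inner ℂ (toL2 (isBounded_interior T) (fun x => φ (dil (T.points i) s x))
          (hφ.1.continuous.comp (continuous_dil _ s))) f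
        - inner ℂ (toL2 (isBounded_interior T) φ hφ.1.continuous) f
        - ((s - 1 : ℝ) : ℂ) * inner ℂ (radial (isBounded_interior T) (T.points i)
            (gradL2 (isBounded_interior T) φ hφ.1)) f‖
      ≤ δ * |s - 1| * √(normSq (gradL2 (isBounded_interior T) φ hφ.1)) := by
  obtain ⟨ε₀, h0, h⟩ := exists_norm_inner_dil_sub_le (isBounded_interior T)
    (measurableSet_interior T) (longestSide_nonneg T)
    (fun x hx => dist_le_of_mem_interior T i hx) f hδ
  exact ⟨ε₀, h0, fun s hs φ hφ => h φ hφ s hs⟩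

variable {T}

/-! ### The gradient near a side -/

lemma integrableOn_sum_norm_sq (G : Fin 2 → L2 T.interior) :
    IntegrableOn (fun x => ∑ j, ‖G j x‖ ^ 2) T.interior :=
  integrable_finsetSum _ fun j _ => integrable_norm_sq_L2 (G j)

lemma normSq_eq_integral (G : Fin 2 → L2 T.interior) :
    normSq G = ∫ x in T.interior, ∑ j, ‖G j x‖ ^ 2 := by
  rw [integral_finsetSum _ fun j _ => integrable_norm_sq_L2 (G j)]
  exact Finset.sum_congr rfl fun j _ => norm_sq_L2_eq _

/-- Points of the strip are sent by the dilation across the line of the side, out of the support of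
`φ`. The dilated gradient vanishes there and the difference is `G` itself. -/
lemma setIntegral_strip_le_normSq_sub (G : Fin 2 → L2 T.interior) {s : ℝ} (hs : 1 < s)
    {φ : Plane → ℂ} (hφ : IsTest T.interior φ) :
    ∫ x in T.interior ∩ {x | bary T i x < 1 - s⁻¹}, ∑ j, ‖G j x‖ ^ 2
      ≤ normSq fun j => G j - gradL2 (isBounded_interior T) _
          (contDiff_comp_dil hφ.1 (T.points i) s) j := by
  set W := gradL2 (isBounded_interior T) _ (contDiff_comp_dil hφ.1 (T.points i) s) with hW
  have hm := measurableSet_interior T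
  have hms : MeasurableSet (T.interior ∩ {x | bary T i x < 1 - s⁻¹}) :=
    hm.inter (measurableSet_bary_lt T i _)
  have hs0 : 0 < s := by linarith
  have hz : ∀ x, bary T i x < 1 - s⁻¹ → dil (T.points i) s x ∉ tsupport φ := by
    intro x hx h
    have h1 := (mem_interior_iff T).1 (hφ.2.2 h) i
    rw [bary_dil_self] at h1
    have h2 : s * s⁻¹ = 1 := mul_inv_cancel₀ hs0.ne'
    nlinarith
  have hWc : ∀ j, (W j : Plane → ℂ) =ᵐ[volume.restrict T.interior]
      pderiv j (fun x => φ (dil (T.points i) s x)) := fun j =>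
    coeFn_toL2 (isBounded_interior T) (continuous_pderiv (contDiff_comp_dil hφ.1 _ s) j)
  rw [normSq_eq_integral]
  refine le_trans (le_of_eq ?_) (setIntegral_mono_set
    (integrableOn_sum_norm_sq (fun j => G j - W j)) (ae_of_all _ fun x =>
      Finset.sum_nonneg fun _ _ => by positivity)
    (LE.le.eventuallyLE (inter_subset_left (t := {x | bary T i x < 1 - s⁻¹}))))
  refine integral_congr_ae ?_
  have hle : volume.restrict (T.interior ∩ {x | bary T i x < 1 - s⁻¹})
      ≤ (volume : Measure Plane).restrict T.interior :=
    Measure.restrict_mono inter_subset_left le_rfl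
  have e0 := hle.absolutelyContinuous.ae_le (hWc 0)
  have e1 := hle.absolutelyContinuous.ae_le (hWc 1)
  have d0 := hle.absolutelyContinuous.ae_le (Lp.coeFn_sub (G 0) (W 0))
  have d1 := hle.absolutelyContinuous.ae_le (Lp.coeFn_sub (G 1) (W 1))
  filter_upwards [e0, e1, d0, d1, ae_restrict_mem hms] with x hx0 hx1 hy0 hy1 hxs
  have hx := hz x hxs.2
  have hp : ∀ j, pderiv j (fun x => φ (dil (T.points i) s x)) x = 0 := fun j => by
    rw [pderiv_comp_dil hφ.1, pderiv_eq_zero_of_notMem hx, smul_zero]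
  simp only [Fin.sum_univ_two, hy0, hy1, Pi.sub_apply, hx0, hx1, hp, sub_zero]

/-- Upper bound for the Dirichlet integral over a thin strip along a side. -/
lemma exists_setIntegral_strip_le {v : L2 T.interior} {G : Fin 2 → L2 T.interior}
    {f : L2 T.interior} (hv : (v, G) ∈ H10 T.interior) (hG : IsWeakDiv T.interior G f) {δ : ℝ}
    (hδ : 0 < δ) :
    ∃ ε₀ > 0, ∀ s : ℝ, 1 < s → s - 1 ≤ ε₀ →
      ∫ x in T.interior ∩ {x | bary T i x < 1 - s⁻¹}, ∑ j, ‖G j x‖ ^ 2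
        ≤ (s - 1) * (rellich T i G f + 2 * δ * √(normSq G)) := by
  obtain ⟨ε₀, h0, h⟩ := exists_dil_bound T i f hδ
  refine ⟨ε₀, h0, fun s hs1 hs => ?_⟩
  have habs : |s - 1| = s - 1 := abs_of_pos (by linarith)
  refine (le_of_forall_isTest i hv hG (h s (by rwa [habs])) fun φ hφ => ?_).trans
    (le_of_eq ?_)
  · refine (setIntegral_strip_le_normSq_sub i G hs1 hφ).trans ?_
    -- Since `φ_s` is again a test function, the cross term in `‖G - ∇φ_s‖²` equals a pairing with
    -- `f`, and `‖∇φ_s‖ = ‖∇φ‖`.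
    have h1 := vinner_eq_of_isWeakDiv (isBounded_interior T) hG
      (subset_closure (mem_testGraph (isBounded_interior T) (isTest_comp_dil T i hs1.le hφ)))
    simp only at h1
    rw [normSq_sub, h1, normSq_gradL2_comp_dil_of_one_le T i hs1.le hφ, Complex.neg_re]
    linarith
  · rw [habs]; ring

/-! ### The trace of a dilated test function on a side -/

lemma norm_fderiv_apply_sq_le_gradSq (φ : Plane → ℂ) (x : Plane) {n : Plane} (hn : ‖n‖ = 1) :
    ‖fderiv ℝ φ x n‖ ^ 2 ≤ gradSq φ x := by
  rw [fderiv_apply_eq_sum_pderiv]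
  refine (norm_sq_sum_mul_le n fun j => pderiv j φ x).trans ?_
  rw [hn, one_pow, one_mul, gradSq]

/-- On the line of the side `φ` vanishes, so its value at height `h` is the integral of the normal
derivative over a segment of length `h`. Cauchy–Schwarz produces the factor `h`. -/
lemma norm_sq_sideChart_le {φ : Plane → ℂ} (hφ : IsTest T.interior φ) {h : ℝ} (hh : 0 ≤ h)
    (τ : ℝ) : ‖φ (sideChart T i (τ, h))‖ ^ 2
      ≤ h * ∫ k in Ioc 0 h, gradSq φ (sideChart T i (τ, k)) := by
  have hcont : Continuous fun k : ℝ => sideChart T i (τ, k) :=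
    (continuous_sideChart T i).comp (by fun_prop)
  have hd : ∀ k, HasDerivAt (fun k => φ (sideChart T i (τ, k)))
      (fderiv ℝ φ (sideChart T i (τ, k)) (normal T i)) k := by
    intro k
    have h1 : HasDerivAt (fun k : ℝ => sideChart T i (τ, k)) (normal T i) k := by
      have := (((hasDerivAt_id k).smul_const (normal T i)).const_add
        (τ • tangent T i)).const_add (T.points (i + 1))
      simpa [sideChart, chart] using this
    exact ((hφ.1.differentiable (by simp) _).hasFDerivAt).comp_hasDerivAt k h1
  have hdc : Continuous fun k => fderiv ℝ φ (sideChart T i (τ, k)) (normal T i) :=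
    ((hφ.1.continuous_fderiv (by simp)).comp hcont).clm_apply continuous_const
  have h0 : φ (sideChart T i (τ, 0)) = 0 := by
    refine image_eq_zero_of_notMem_tsupport fun hx => ?_
    have := (mem_interior_iff T).1 (hφ.2.2 hx) i
    rw [bary_sideChart] at this
    simp at this
  have hftc := intervalIntegral.integral_eq_sub_of_hasDerivAt (a := 0) (b := h)
    (fun k _ => hd k) (hdc.intervalIntegrable _ _)
  rw [h0, sub_zero, intervalIntegral.integral_of_le hh] at hftc
  have hfin : IsFiniteMeasure ((volume : Measure ℝ).restrict (Ioc 0 h)) := ⟨by simp⟩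
  have hmem : MemLp (fun k => fderiv ℝ φ (sideChart T i (τ, k)) (normal T i)) 2
      (volume.restrict (Ioc 0 h)) :=
    (memLp_two_iff_integrable_sq_norm hdc.aestronglyMeasurable).2
      ((hdc.norm.pow 2).integrableOn_Ioc)
  have hcs := norm_integral_mul_le_sqrt hmem (memLp_const (1 : ℂ))
  simp only [mul_one, norm_one, one_pow] at hcs
  rw [hftc] at hcs
  have hI : 0 ≤ ∫ k in Ioc 0 h, ‖fderiv ℝ φ (sideChart T i (τ, k)) (normal T i)‖ ^ 2 :=
    integral_nonneg fun _ => by positivity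
  have h1 : ∫ _ in Ioc (0 : ℝ) h, (1 : ℝ) = h := by simp [hh]
  rw [h1] at hcs
  have h2 := pow_le_pow_left₀ (norm_nonneg _) hcs 2
  rw [mul_pow, Real.sq_sqrt hI, Real.sq_sqrt hh, mul_comm] at h2
  refine h2.trans (mul_le_mul_of_nonneg_left ?_ hh)
  refine integral_mono ((hdc.norm.pow 2).integrableOn_Ioc)
    (((continuous_gradSq hφ.1).comp hcont).integrableOn_Ioc) fun k => ?_
  exact norm_fderiv_apply_sq_le_gradSq φ _ (norm_normal T i)

lemma integrable_gradSq {φ : Plane → ℂ} (hφ : IsTest T.interior φ) : Integrable (gradSq φ) := by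
  refine (continuous_gradSq hφ.1).integrable_of_hasCompactSupport ?_
  refine HasCompactSupport.intro hφ.2.1 fun x hx => gradSq_eq_zero_of_notMem hx

/-- Fubini in the chart. Since `φ` is supported in the triangle, the integrals may run over whole
lines and the shape of the slices plays no role. -/
lemma integral_integral_sideChart {φ : Plane → ℂ} (hφ : IsTest T.interior φ) (c : ℝ) :
    Integrable (fun τ => ∫ k in Ioc 0 (c * T.height i), gradSq φ (sideChart T i (τ, k))) ∧
    ∫ τ, ∫ k in Ioc 0 (c * T.height i), gradSq φ (sideChart T i (τ, k))
      = ∫ x in T.interior ∩ {x | bary T i x ≤ c}, gradSq φ x := by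
  have hl := T.height_pos i
  have hmp := measurePreserving_sideChart T i
  have hme := measurableEmbedding_sideChart T i
  have hint : Integrable fun z => gradSq φ (sideChart T i z) :=
    (hmp.integrable_comp_emb hme).2 (integrable_gradSq hφ)
  have hprod : ((volume : Measure (ℝ × ℝ)).restrict (univ ×ˢ Ioc 0 (c * T.height i)))
      = (volume : Measure ℝ).prod (volume.restrict (Ioc 0 (c * T.height i))) := by
    rw [Measure.volume_eq_prod, ← Measure.prod_restrict, Measure.restrict_univ]
  have hint2 : Integrable (fun z => gradSq φ (sideChart T i z))
      ((volume : Measure ℝ).prod (volume.restrict (Ioc 0 (c * T.height i)))) := by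
    rw [← hprod]; exact hint.integrableOn
  refine ⟨hint2.integral_prod_left, ?_⟩
  rw [← integral_prod _ hint2, ← hprod]
  have hpre : (univ : Set ℝ) ×ˢ Ioc 0 (c * T.height i)
      = sideChart T i ⁻¹' {x | 0 < bary T i x ∧ bary T i x ≤ c} := by
    ext z
    simp only [mem_prod, mem_univ, true_and, mem_Ioc, mem_preimage, mem_ofPred_eq,
      bary_sideChart, div_pos_iff_of_pos_right hl, div_le_iff₀ hl]
  rw [hpre, hmp.setIntegral_preimage_emb hme]
  have hms : MeasurableSet {x | 0 < bary T i x ∧ bary T i x ≤ c} :=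
    (measurableSet_lt_bary T i 0).inter (measurableSet_bary_le T i c)
  refine setIntegral_eq_of_subset_of_forall_sdiff_eq_zero hms ?_ ?_
  · exact fun x hx => ⟨(mem_interior_iff T).1 hx.1 i, hx.2⟩
  · intro x hx
    refine gradSq_eq_zero_of_notMem fun h => hx.2 ⟨hφ.2.2 h, hx.1.2⟩

/-- The dilation carries the side to the slice at height `(1 - s)ℓ` and shrinks lengths along it,
which gives `s⁻¹`. The slice is then controlled by the energy of `φ` below it. -/
lemma integral_side_dil_le {φ : Plane → ℂ} (hφ : IsTest T.interior φ) {s : ℝ} (hs : 0 < s)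
    (hs1 : s ≤ 1) :
    ∫ x in side T i, ‖φ (dil (T.points i) s x)‖ ^ 2 ∂arclength
      ≤ ((1 - s) * T.height i / s)
        * ∫ x in T.interior ∩ {x | bary T i x ≤ 1 - s}, gradSq φ x := by
  have hl := T.height_pos i
  obtain ⟨c, hc⟩ := exists_points_eq_sideChart T i
  set h := (1 - s) * T.height i with hh
  have hh0 : 0 ≤ h := mul_nonneg (by linarith) hl.le
  have hdil : ∀ σ, dil (T.points i) s (sideChart T i (σ, 0))
      = sideChart T i (c + s * (σ - c), h) := by
    intro σ
    rw [dil, dil_sideChart T i hc]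
    congr 2
    rw [hh]; ring
  rw [setIntegral_side]
  simp_rw [hdil]
  have hiso : Isometry fun τ : ℝ => sideChart T i (τ, h) := by
    have := isometry_axis (q := T.points (i + 1) + h • normal T i) (norm_tangent T i)
    refine (congrArg Isometry (funext fun τ => ?_)).mp this
    simp only [sideChart, chart]
    abel
  have hcF : Continuous fun τ => ‖φ (sideChart T i (τ, h))‖ ^ 2 :=
    ((hφ.1.continuous.comp hiso.continuous).norm).pow 2
  have hiF : Integrable fun τ => ‖φ (sideChart T i (τ, h))‖ ^ 2 := by
    refine hcF.integrable_of_hasCompactSupport ?_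
    exact (hφ.2.1.comp_isClosedEmbedding hiso.isClosedEmbedding).comp_left
      (g := fun z : ℂ => ‖z‖ ^ 2) (by simp)
  have hiF2 : Integrable fun σ => ‖φ (sideChart T i (c + s * (σ - c), h))‖ ^ 2 := by
    have h1 := (hiF.comp_add_right (c - s * c)).comp_mul_left' hs.ne'
    refine h1.congr (ae_of_all _ fun σ => ?_)
    simp only
    congr 5; ring
  have hsub : ∫ σ, ‖φ (sideChart T i (c + s * (σ - c), h))‖ ^ 2
      = s⁻¹ * ∫ τ, ‖φ (sideChart T i (τ, h))‖ ^ 2 := by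
    have h1 := Measure.integral_comp_mul_left
      (fun τ => ‖φ (sideChart T i (τ + (c - s * c), h))‖ ^ 2) s
    have h2 := integral_add_right_eq_self (μ := (volume : Measure ℝ))
      (fun τ => ‖φ (sideChart T i (τ, h))‖ ^ 2) (c - s * c)
    rw [h2, abs_of_pos (inv_pos.2 hs), smul_eq_mul] at h1
    rw [← h1]
    refine integral_congr_ae (ae_of_all _ fun σ => ?_)
    simp only
    congr 5; ring
  obtain ⟨hiI, heI⟩ := integral_integral_sideChart i hφ (1 - s)
  calc ∫ σ in Icc 0 (len T i), ‖φ (sideChart T i (c + s * (σ - c), h))‖ ^ 2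
      ≤ ∫ σ, ‖φ (sideChart T i (c + s * (σ - c), h))‖ ^ 2 :=
        setIntegral_le_integral hiF2 (ae_of_all _ fun _ => by positivity)
    _ = s⁻¹ * ∫ τ, ‖φ (sideChart T i (τ, h))‖ ^ 2 := hsub
    _ ≤ s⁻¹ * ∫ τ, h * ∫ k in Ioc 0 h, gradSq φ (sideChart T i (τ, k)) := by
        refine mul_le_mul_of_nonneg_left ?_ (by positivity)
        exact integral_mono hiF (hiI.const_mul h) fun τ => norm_sq_sideChart_le i hφ hh0 τ
    _ = _ := by
        rw [integral_const_mul, heI]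
        ring

/-! ### Lower bound for the normal derivative -/

/-- A dilation about `pᵢ` preserves the lines of the two sides through `pᵢ`, where `φ` vanishes.
Only the opposite side contributes, and Cauchy–Schwarz applies there. -/
lemma norm_integral_bdry_dil_le {g : Plane → ℂ}
    (hg : MemLp g 2 (arclength.restrict (bdry T))) {φ : Plane → ℂ} (hφ : IsTest T.interior φ)
    {s : ℝ} (hs : 0 < s) (hs1 : s ≤ 1) :
    ‖∫ x in bdry T, g x * (starRingEnd ℂ) (φ (dil (T.points i) s x)) ∂arclength‖
      ≤ √(∫ x in side T i, ‖g x‖ ^ 2 ∂arclength)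
        * √(((1 - s) * T.height i / s)
        * ∫ x in T.interior ∩ {x | bary T i x ≤ 1 - s}, gradSq φ x) := by
  have hsub : side T i ⊆ bdry T := subset_iUnion (side T) i
  have hle : arclength.restrict (side T i) ≤ arclength.restrict (bdry T) :=
    Measure.restrict_mono hsub le_rfl
  have h1 : ∫ x in bdry T, g x * (starRingEnd ℂ) (φ (dil (T.points i) s x)) ∂arclength
      = ∫ x in side T i, g x * (starRingEnd ℂ) (φ (dil (T.points i) s x)) ∂arclength := by
    refine setIntegral_eq_of_subset_of_forall_sdiff_eq_zero (measurableSet_bdry T) hsub ?_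
    intro x hx
    obtain ⟨j, hj⟩ := mem_iUnion.1 hx.1
    have hji : j ≠ i := fun h => hx.2 (h ▸ hj)
    have h2 : dil (T.points i) s x ∉ tsupport φ := by
      intro h
      have := (mem_interior_iff T).1 (hφ.2.2 h) j
      rw [bary_dil_of_ne T i hji, bary_eq_zero_of_mem_side T j hj, mul_zero] at this
      exact lt_irrefl _ this
    rw [image_eq_zero_of_notMem_tsupport h2, map_zero, mul_zero]
  have hfin : IsFiniteMeasure (arclength.restrict (side T i)) :=
    isFiniteMeasure_of_le _ hle
  have hφs : Continuous fun x => φ (dil (T.points i) s x) :=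
    hφ.1.continuous.comp (continuous_dil _ _)
  have hmem : MemLp (fun x => (starRingEnd ℂ) (φ (dil (T.points i) s x))) 2
      (arclength.restrict (side T i)) := by
    obtain ⟨B, hB⟩ := hφ.1.continuous.bounded_above_of_compact_support hφ.2.1
    refine MemLp.of_bound (Complex.continuous_conj.comp hφs).aestronglyMeasurable B
      (ae_of_all _ fun x => ?_)
    rw [RCLike.norm_conj]
    exact hB _
  rw [h1]
  refine (norm_integral_mul_le_sqrt (hg.mono_measure hle) hmem).trans ?_
  refine mul_le_mul_of_nonneg_left (Real.sqrt_le_sqrt ?_) (Real.sqrt_nonneg _)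
  simp only [RCLike.norm_conj]
  exact integral_side_dil_le i hφ hs hs1

/-- `g` represents the normal derivative in Green's formula for the field `G` with weak
divergence `f`. -/
def _root_.TriangleWave.GreenFormula (T : Affine.Triangle ℝ Plane) (G : Fin 2 → L2 T.interior)
    (f : L2 T.interior) (g : Plane → ℂ) : Prop :=
  ∀ φ : Plane → ℂ, ContDiff ℝ ∞ φ →
    (∑ j, ∫ x in T.interior, G j x * pderiv j φ x) + ∫ x in T.interior, f x * φ x
      = ∫ x in bdry T, g x * φ x ∂arclength

lemma vinner_add_inner_eq_integral {G : Fin 2 → L2 T.interior} {f : L2 T.interior}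
    {g : Plane → ℂ} (hgreen : GreenFormula T G f g) {φ : Plane → ℂ} (hφ : ContDiff ℝ ∞ φ) :
    vinner (gradL2 (isBounded_interior T) φ hφ) G
      + inner ℂ (toL2 (isBounded_interior T) φ hφ.continuous) f
      = ∫ x in bdry T, g x * (starRingEnd ℂ) (φ x) ∂arclength := by
  have hc : ContDiff ℝ ∞ fun x => (starRingEnd ℂ) (φ x) := Complex.conjCLE.contDiff.comp hφ
  rw [← hgreen _ hc]
  congr 1
  · refine Finset.sum_congr rfl fun j _ => ?_
    rw [gradL2, inner_toL2_eq]
    refine integral_congr_ae (ae_of_all _ fun x => ?_)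
    simp only
    rw [← pderiv_conj hφ]
  · rw [inner_toL2_eq]

/-- Expand `0 ≤ ‖G - ∇φ_s‖²` for `s = 1 - ε`. Green's formula turns the cross term into a pairing
with `f` and a boundary term; the energy lost by `φ_s` absorbs the part of the boundary term that
depends on `φ`. Dividing by `ε` and letting first `ε` and then the error tend to zero gives the
claim. -/
lemma rellich_le {v : L2 T.interior} {G : Fin 2 → L2 T.interior} {f : L2 T.interior}
    (hv : (v, G) ∈ H10 T.interior) (hG : IsWeakDiv T.interior G f) {g : Plane → ℂ}
    (hg : MemLp g 2 (arclength.restrict (bdry T))) (hgreen : GreenFormula T G f g) :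
    rellich T i G f ≤ T.height i * ∫ x in side T i, ‖g x‖ ^ 2 ∂arclength := by
  set a := ∫ x in side T i, ‖g x‖ ^ 2 ∂arclength with ha
  have ha0 : 0 ≤ a := integral_nonneg fun _ => by positivity
  have hl := T.height_pos i
  have main : ∀ δ > 0, ∃ ε₀ > 0, ∀ ε, 0 < ε → ε < 1 → ε ≤ ε₀ →
      rellich T i G f ≤ (T.height i / (1 - ε)) * a + 2 * (δ * √(normSq G)) := by
    intro δ hδ
    obtain ⟨ε₀, h0, h⟩ := exists_dil_bound T i f hδ
    refine ⟨ε₀, h0, fun ε hε hε1 hεε => ?_⟩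
    set s := 1 - ε with hs
    have hs0 : 0 < s := by linarith
    have hs1 : s ≤ 1 := by linarith
    have habs : |s - 1| = ε := by rw [hs, abs_sub_comm]; simp [abs_of_pos hε]
    have key := le_of_forall_isTest i hv hG (A := -((1 - s) * T.height i / s * a))
      (h s (by rwa [habs])) fun φ hφ => ?_
    · rw [habs] at key
      have e1 : s - 1 = -ε := by rw [hs]; ring
      have e2 : 1 - s = ε := by rw [hs]; ring
      rw [e1, e2] at key
      have e3 : ε * T.height i / s * a = ε * (T.height i / s * a) := by ring
      rw [e3] at key
      have : ε * rellich T i G f ≤ ε * (T.height i / s * a + 2 * (δ * √(normSq G))) := by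
        linarith
      exact le_of_mul_le_mul_left this hε
    · set D := ∫ x in T.interior ∩ {x | bary T i x ≤ 1 - s}, gradSq φ x with hD
      have hD0 : 0 ≤ D := integral_nonneg fun x => gradSq_nonneg φ x
      have hsm := contDiff_comp_dil hφ.1 (T.points i) s
      have h1 := normSq_nonneg fun j => G j - gradL2 (isBounded_interior T) _ hsm j
      rw [normSq_sub, normSq_gradL2_comp_dil_of_le_one T i hs0 hs1 hφ, ← hD] at h1
      have h2 := vinner_add_inner_eq_integral hgreen hsm
      have h3 := norm_integral_bdry_dil_le i hg hφ hs0 hs1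
      rw [← h2, ← ha, ← hD] at h3
      have h4 := (abs_le.1 ((Complex.abs_re_le_norm _).trans h3)).1
      rw [Complex.add_re] at h4
      set c := (1 - s) * T.height i / s with hc
      have hc0 : 0 ≤ c := div_nonneg (mul_nonneg (by linarith) hl.le) hs0.le
      -- This weighted arithmetic–geometric mean is balanced so that the coefficient of `D` is
      -- exactly `1`. It cancels the energy lost in the strip and leaves a bound free of `φ`.
      have h5 : 2 * (√a * √(c * D)) ≤ c * a + D := by
        rw [Real.sqrt_mul hc0, ← mul_assoc]
        have := two_mul_le_add_sq (√a * √c) (√D)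
        rw [mul_pow, Real.sq_sqrt ha0, Real.sq_sqrt hc0, Real.sq_sqrt hD0] at this
        linarith
      linarith
  refine le_of_forall_pos_le_add fun η hη => ?_
  have hδ : 0 < η / (4 * (√(normSq G) + 1)) := by positivity
  obtain ⟨ε₀, h0, h⟩ := main _ hδ
  have hcont : Filter.Tendsto (fun ε : ℝ => (T.height i / (1 - ε)) * a) (𝓝[>] 0)
      (𝓝 (T.height i / (1 - 0) * a)) := by
    refine tendsto_nhdsWithin_of_tendsto_nhds (ContinuousAt.tendsto ?_)
    have : (1 : ℝ) - 0 ≠ 0 := by norm_num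
    fun_prop (disch := exact this)
  have hev : ∀ᶠ ε in 𝓝[>] (0 : ℝ), ε < min 1 ε₀ :=
    mem_nhdsWithin_of_mem_nhds (Iio_mem_nhds (lt_min one_pos h0))
  have hlim := ge_of_tendsto (hcont.add_const (2 * (η / (4 * (√(normSq G) + 1))
    * √(normSq G)))) (b := rellich T i G f) (by
      filter_upwards [hev, self_mem_nhdsWithin] with ε h1 h2
      exact h ε h2 (h1.trans_le (min_le_left _ _)) (h1.le.trans (min_le_right _ _)))
  rw [sub_zero, div_one] at hlim
  refine hlim.trans (add_le_add_right ?_ _)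
  have hN := Real.sqrt_nonneg (normSq G)
  rw [div_mul_eq_mul_div, mul_div_assoc', div_le_iff₀ (by positivity)]
  nlinarith

end Tri

end

section

open scoped Topology RealInnerProductSpace

/-! ### Averages over thin strips -/

namespace Tri

variable (T : Affine.Triangle ℝ Plane) (i : Fin 3)

/-- The integral of `|φ|²` over the slice of the triangle at height `k` above a side. -/
def sliceIntegral (φ : Plane → ℂ) (k : ℝ) : ℝ :=
  ∫ σ, T.interior.indicator (fun x => ‖φ x‖ ^ 2) (sideChart T i (σ, k))

lemma continuous_sideChart_snd (σ : ℝ) : Continuous fun k : ℝ => sideChart T i (σ, k) :=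
  (continuous_sideChart T i).comp (by fun_prop)

lemma eventually_sideChart_mem {σ : ℝ} (hσ : σ ∈ Ioo 0 (len T i)) :
    ∀ᶠ k in 𝓝[>] (0 : ℝ), sideChart T i (σ, k) ∈ T.interior := by
  have hl := len_pos T i
  have hev : ∀ j, 0 < bary T j (sideChart T i (σ, 0)) →
      ∀ᶠ k in 𝓝[>] (0 : ℝ), 0 < bary T j (sideChart T i (σ, k)) := by
    intro j hj
    have hc : Continuous fun k => bary T j (sideChart T i (σ, k)) :=
      (continuous_bary T j).comp (continuous_sideChart_snd T i σ)
    exact mem_nhdsWithin_of_mem_nhds (hc.continuousAt.eventually (lt_mem_nhds hj))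
  have h1 := hev (i + 1) (by
    rw [bary_add_one_sideChart_zero, sub_pos, div_lt_one hl]; exact hσ.2)
  have h2 := hev (i + 2) (by
    rw [bary_add_two_sideChart_zero]; exact div_pos hσ.1 hl)
  filter_upwards [h1, h2, self_mem_nhdsWithin] with k hk1 hk2 hk
  rw [mem_interior_iff]
  intro j
  rcases eq_or_eq_or_eq i j with rfl | rfl | rfl
  · rw [bary_sideChart]; exact div_pos hk (T.height_pos _)
  · exact hk1
  · exact hk2

lemma eventually_sideChart_notMem {σ : ℝ} (hσ : σ ∉ Icc 0 (len T i)) :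
    ∀ᶠ k in 𝓝[>] (0 : ℝ), sideChart T i (σ, k) ∉ T.interior := by
  have hl := len_pos T i
  have hev : ∀ j, bary T j (sideChart T i (σ, 0)) < 0 →
      ∀ᶠ k in 𝓝[>] (0 : ℝ), sideChart T i (σ, k) ∉ T.interior := by
    intro j hj
    have hc : Continuous fun k => bary T j (sideChart T i (σ, k)) :=
      (continuous_bary T j).comp (continuous_sideChart_snd T i σ)
    filter_upwards [mem_nhdsWithin_of_mem_nhds (hc.continuousAt.eventually (gt_mem_nhds hj))]
      with k hk h
    exact absurd ((mem_interior_iff T).1 h j) (not_lt.2 (le_of_lt hk))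
  rcases lt_or_ge σ 0 with h | h
  · exact hev (i + 2) (by rw [bary_add_two_sideChart_zero]; exact div_neg_of_neg_of_pos h hl)
  · refine hev (i + 1) ?_
    rw [bary_add_one_sideChart_zero, sub_neg, one_lt_div hl]
    by_contra h2
    exact hσ ⟨h, not_lt.1 h2⟩

lemma measurable_slice (φ : Plane → ℂ) (hφ : Continuous φ) :
    Measurable (T.interior.indicator fun x => ‖φ x‖ ^ 2) :=
  (hφ.norm.pow 2).measurable.indicator (measurableSet_interior T)

lemma tendsto_sliceIntegral {φ : Plane → ℂ} (hφ : Continuous φ) :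
    Filter.Tendsto (sliceIntegral T i φ) (𝓝[>] 0)
      (𝓝 (∫ x in side T i, ‖φ x‖ ^ 2 ∂arclength)) := by
  have hl := len_pos T i
  obtain ⟨C, hC⟩ := (isBounded_interior T).isCompact_closure.exists_bound_of_continuousOn
    (hφ.norm.pow 2).continuousOn
  rw [setIntegral_side, ← integral_indicator measurableSet_Icc]
  refine tendsto_integral_filter_of_dominated_convergence
    ((Icc (-longestSide T) (longestSide T)).indicator fun _ => max C 0) ?_ ?_ ?_ ?_
  · refine Filter.Eventually.of_forall fun k => ?_
    exact ((measurable_slice T φ hφ).comp ((continuous_sideChart T i).comp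
      (by fun_prop : Continuous fun σ : ℝ => (σ, k))).measurable).aestronglyMeasurable
  · refine Filter.Eventually.of_forall fun k => ae_of_all _ fun σ => ?_
    by_cases h : sideChart T i (σ, k) ∈ T.interior
    · have h2 := abs_le_of_sideChart_mem T i h
      rw [indicator_of_mem h, indicator_of_mem (mem_Icc.2 (abs_le.1 h2))]
      exact (hC _ (subset_closure h)).trans (le_max_left _ _)
    · rw [indicator_of_notMem h, norm_zero]
      exact indicator_nonneg (fun _ _ => le_max_right _ _) _
  · exact (integrable_indicator_iff measurableSet_Icc).2
      (integrableOn_const (by simp))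
  -- Pointwise convergence may fail only above the two endpoints of the side: over the open segment
  -- low points lie inside the triangle, and away from the closed segment they lie outside.
  · have hne : ∀ᵐ σ : ℝ, σ ≠ 0 ∧ σ ≠ len T i := by
      have h1 : ∀ a : ℝ, ∀ᵐ σ : ℝ, σ ≠ a := fun a => by
        simp [ae_iff]
      filter_upwards [h1 0, h1 (len T i)] with σ h2 h3 using ⟨h2, h3⟩
    filter_upwards [hne] with σ hσ
    by_cases h : σ ∈ Icc 0 (len T i)
    · have hio : σ ∈ Ioo 0 (len T i) :=
        ⟨lt_of_le_of_ne h.1 (Ne.symm hσ.1), lt_of_le_of_ne h.2 hσ.2⟩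
      rw [indicator_of_mem h]
      have hc : Continuous fun k => ‖φ (sideChart T i (σ, k))‖ ^ 2 :=
        (hφ.comp (continuous_sideChart_snd T i σ)).norm.pow 2
      refine Filter.Tendsto.congr' ?_ (tendsto_nhdsWithin_of_tendsto_nhds (hc.tendsto 0))
      filter_upwards [eventually_sideChart_mem T i hio] with k hk
      rw [indicator_of_mem hk]
    · rw [indicator_of_notMem h]
      refine Filter.Tendsto.congr' ?_ tendsto_const_nhds
      filter_upwards [eventually_sideChart_notMem T i h] with k hk
      rw [indicator_of_notMem hk]

lemma setIntegral_strip_eq {φ : Plane → ℂ} (hφ : Continuous φ) (η : ℝ) :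
    IntegrableOn (sliceIntegral T i φ) (Ioo 0 (η * T.height i)) ∧
    ∫ x in T.interior ∩ {x | bary T i x < η}, ‖φ x‖ ^ 2
      = ∫ k in Ioo 0 (η * T.height i), sliceIntegral T i φ k := by
  have hl := T.height_pos i
  have hmp := measurePreserving_sideChart T i
  have hme := measurableEmbedding_sideChart T i
  have hm := measurableSet_interior T
  have hint0 : Integrable (T.interior.indicator fun x => ‖φ x‖ ^ 2) :=
    (integrable_indicator_iff hm).2 (integrable_of_continuous (isBounded_interior T)
      (hφ.norm.pow 2))
  have hint : Integrable fun z => T.interior.indicator (fun x => ‖φ x‖ ^ 2)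
      (sideChart T i z) := (hmp.integrable_comp_emb hme).2 hint0
  have hprod : ((volume : Measure (ℝ × ℝ)).restrict (univ ×ˢ Ioo 0 (η * T.height i)))
      = (volume : Measure ℝ).prod (volume.restrict (Ioo 0 (η * T.height i))) := by
    rw [Measure.volume_eq_prod, ← Measure.prod_restrict, Measure.restrict_univ]
  have hint2 : Integrable (fun z => T.interior.indicator (fun x => ‖φ x‖ ^ 2)
      (sideChart T i z))
      ((volume : Measure ℝ).prod (volume.restrict (Ioo 0 (η * T.height i)))) := by
    rw [← hprod]; exact hint.integrableOn
  refine ⟨hint2.integral_prod_right, ?_⟩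
  have h1 := integral_prod_symm _ hint2
  rw [← hprod] at h1
  have hpre : (univ : Set ℝ) ×ˢ Ioo 0 (η * T.height i)
      = sideChart T i ⁻¹' {x | 0 < bary T i x ∧ bary T i x < η} := by
    ext z
    simp only [mem_prod, mem_univ, true_and, mem_Ioo, mem_preimage, mem_ofPred_eq,
      bary_sideChart, div_pos_iff_of_pos_right hl, div_lt_iff₀ hl]
  rw [hpre, hmp.setIntegral_preimage_emb hme, setIntegral_indicator hm] at h1
  simp only [sliceIntegral]
  rw [← h1]
  congr 2
  ext x
  simp only [mem_inter_iff, mem_ofPred_eq]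
  exact ⟨fun h => ⟨⟨(mem_interior_iff T).1 h.1 i, h.2⟩, h.1⟩, fun h => ⟨h.2, h.1.2⟩⟩

/-- Upper bound for averages over thin strips along a side. -/
lemma eventually_setIntegral_strip_le {φ : Plane → ℂ} (hφ : Continuous φ) {ε : ℝ} (hε : 0 < ε) :
    ∀ᶠ η in 𝓝[>] (0 : ℝ), ∫ x in T.interior ∩ {x | bary T i x < η}, ‖φ x‖ ^ 2
      ≤ η * (T.height i * (∫ x in side T i, ‖φ x‖ ^ 2 ∂arclength) + ε) := by
  have hl := T.height_pos i
  set q := ∫ x in side T i, ‖φ x‖ ^ 2 ∂arclength with hq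
  have h1 := (tendsto_sliceIntegral T i hφ).eventually
    (gt_mem_nhds (show q < q + ε / T.height i by linarith [div_pos hε hl]))
  obtain ⟨κ, hκ, hκ2⟩ := mem_nhdsGT_iff_exists_Ioo_subset.1 h1
  have h2 : ∀ᶠ η in 𝓝[>] (0 : ℝ), η < κ / T.height i :=
    mem_nhdsWithin_of_mem_nhds (gt_mem_nhds (div_pos hκ hl))
  filter_upwards [h2, self_mem_nhdsWithin] with η hη hη0
  obtain ⟨hint, heq⟩ := setIntegral_strip_eq T i hφ η
  have hη' : η * T.height i < κ := (lt_div_iff₀ hl).1 hη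
  have hη0' : 0 < η * T.height i := mul_pos hη0 hl
  rw [heq]
  calc ∫ k in Ioo 0 (η * T.height i), sliceIntegral T i φ k
      ≤ ∫ _ in Ioo 0 (η * T.height i), (q + ε / T.height i) := by
        refine setIntegral_mono_on hint (integrableOn_const (by simp)) measurableSet_Ioo
          fun k hk => ?_
        exact le_of_lt (hκ2 ⟨hk.1, hk.2.trans hη'⟩)
    _ = η * (T.height i * q + ε) := by
        simp only [integral_const, MeasurableSet.univ, measureReal_restrict_apply, univ_inter,
          Real.volume_real_Ioo_of_le hη0'.le, smul_eq_mul, sub_zero]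
        field_simp

end Tri

/-! ### A smooth ramp of almost minimal slope -/

/-- A transition from `0` to `1` over a unit interval needs slope at least `1`; any bound `c > 1` is
attainable smoothly. Letting `c → 1` later is what makes the constants in Green's estimate sharp. -/
lemma exists_ramp {c : ℝ} (hc : 1 < c) : ∃ ψ ρ : ℝ → ℝ, ∃ κ > 0, ContDiff ℝ ∞ ψ ∧
    (∀ t, HasDerivAt ψ (ρ t) t) ∧ (∀ t, 0 ≤ ρ t ∧ ρ t ≤ c) ∧ (∀ t, 1 ≤ t → ρ t = 0) ∧
    (∀ t, t ≤ κ → ψ t = 0) ∧ (∀ t, 1 ≤ t → ψ t = 1) ∧ ∀ t, 0 ≤ ψ t ∧ ψ t ≤ 1 := by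
  have hc0 : 0 < c := by linarith
  have hc1 : 1 / (2 * c) < 1 / 2 := by
    rw [div_lt_div_iff₀ (by positivity) (by norm_num)]; linarith
  -- The inner interval has length `1/c`, so the normalized bump is at most `c`. An outer radius
  -- below `1/2` keeps the support inside `(0, 1)` and leaves a margin `κ`.
  let f : ContDiffBump (1 / 2 : ℝ) :=
    { rIn := 1 / (2 * c)
      rOut := (1 / (2 * c) + 1 / 2) / 2
      rIn_pos := by positivity
      rIn_lt_rOut := by linarith }
  set ρ : ℝ → ℝ := f.normed volume with hρ
  have hρc : Continuous ρ := f.continuous_normed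
  have hρ0 : ∀ t, 0 ≤ ρ t := fun t => f.nonneg_normed t
  have hρle : ∀ t, ρ t ≤ c := by
    intro t
    have h := f.normed_le_div_measure_closedBall_rIn (volume : Measure ℝ) t
    refine h.trans (le_of_eq ?_)
    rw [measureReal_def, Real.volume_closedBall, ENNReal.toReal_ofReal (by positivity)]
    change 1 / (2 * (1 / (2 * c))) = c
    field_simp
  set κ := (1 - (1 / (2 * c) + 1 / 2)) / 2 with hκ
  have hκ0 : 0 < κ := by rw [hκ]; linarith
  have hsupp : ∀ t, ρ t ≠ 0 → κ < t ∧ t < 1 := by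
    intro t ht
    have h : t ∈ Function.support ρ := ht
    rw [hρ, f.support_normed_eq, Metric.mem_ball, Real.dist_eq] at h
    change |t - 1 / 2| < (1 / (2 * c) + 1 / 2) / 2 at h
    rw [abs_lt] at h
    constructor <;> linarith [h.1, h.2]
  have hd : ∀ t, HasDerivAt (fun t => ∫ x in (0 : ℝ)..t, ρ x) (ρ t) t := fun t =>
    intervalIntegral.integral_hasDerivAt_right (hρc.intervalIntegrable _ _)
      hρc.stronglyMeasurable.stronglyMeasurableAtFilter hρc.continuousAt
  have hzero : ∀ t, t ≤ κ → ∫ x in (0 : ℝ)..t, ρ x = 0 := by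
    intro t ht
    refine intervalIntegral.integral_zero_ae (ae_of_all _ fun x hx => ?_)
    by_contra h
    have h1 := (hsupp x h).1
    rcases le_total 0 t with h0 | h0
    · rw [uIoc_of_le h0] at hx; linarith [hx.2]
    · rw [uIoc_of_ge h0] at hx; linarith [hx.2]
  have hone : ∀ t, 1 ≤ t → ∫ x in (0 : ℝ)..t, ρ x = 1 := by
    intro t ht
    rw [intervalIntegral.integral_of_le (by linarith), ← f.integral_normed (μ := volume)]
    refine setIntegral_eq_integral_of_forall_compl_eq_zero fun x hx => ?_
    by_contra h
    have := hsupp x h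
    exact hx ⟨by linarith, by linarith⟩
  have hmono : Monotone fun t => ∫ x in (0 : ℝ)..t, ρ x := by
    refine monotone_of_deriv_nonneg (fun t => (hd t).differentiableAt) fun t => ?_
    rw [(hd t).deriv]
    exact hρ0 t
  refine ⟨fun t => ∫ x in (0 : ℝ)..t, ρ x, ρ, κ, hκ0, ?_, hd, fun t => ⟨hρ0 t, hρle t⟩, ?_,
    hzero, hone, fun t => ⟨?_, ?_⟩⟩
  · rw [contDiff_infty_iff_deriv]
    refine ⟨fun t => (hd t).differentiableAt, ?_⟩
    have : deriv (fun t => ∫ x in (0 : ℝ)..t, ρ x) = ρ := funext fun t => (hd t).deriv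
    rw [this]
    exact f.contDiff_normed
  · intro t ht
    by_contra h
    linarith [(hsupp t h).2]
  · have h := hmono (min_le_left t κ)
    simp only at h
    rwa [hzero _ (min_le_right _ _)] at h
  · have h := hmono (le_max_left t 1)
    simp only at h
    rwa [hone _ (le_max_right _ _)] at h

end

section

open scoped Topology RealInnerProductSpace

namespace Tri

variable (T : Affine.Triangle ℝ Plane)

/-! ### Cutoff functions -/

/-- The cutoff function `∏ ψ(bₖ / η)`. -/
def cutoff (ψ : ℝ → ℝ) (η : ℝ) (x : Plane) : ℝ := ∏ k, ψ (bary T k x / η)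

lemma contDiff_bary (k : Fin 3) : ContDiff ℝ ∞ (bary T k) := by
  unfold bary
  exact contDiff_const.mul (contDiff_const.inner ℝ (contDiff_id.sub contDiff_const))

lemma hasFDerivAt_bary (k : Fin 3) (x : Plane) :
    HasFDerivAt (bary T k) ((T.height k)⁻¹ • innerSL ℝ (normal T k)) x := by
  have h : HasFDerivAt (fun x => ⟪normal T k, x - T.points (k + 1)⟫)
      (innerSL ℝ (normal T k)) x :=
    (innerSL ℝ (normal T k)).hasFDerivAt.comp x ((hasFDerivAt_id x).sub_const _)
  exact h.const_mul _

lemma contDiff_cutoff {ψ : ℝ → ℝ} (hψ : ContDiff ℝ ∞ ψ) (η : ℝ) :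
    ContDiff ℝ ∞ (cutoff T ψ η) := by
  unfold cutoff
  exact contDiff_prod fun k _ => hψ.comp ((contDiff_bary T k).div_const η)

variable {ψ ρ : ℝ → ℝ}

lemma hasFDerivAt_cutoff (hd : ∀ t, HasDerivAt ψ (ρ t) t) (η : ℝ) (x : Plane) :
    HasFDerivAt (cutoff T ψ η) (∑ k, (∏ j ∈ Finset.univ.erase k, ψ (bary T j x / η)) •
      (ρ (bary T k x / η) • (η⁻¹ • ((T.height k)⁻¹ • innerSL ℝ (normal T k))))) x := by
  unfold cutoff
  refine HasFDerivAt.finsetProd (g := fun k x => ψ (bary T k x / η)) fun k _ => ?_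
  have h1 : HasFDerivAt (fun x => bary T k x / η)
      (η⁻¹ • ((T.height k)⁻¹ • innerSL ℝ (normal T k))) x := by
    simp only [div_eq_mul_inv]
    exact (hasFDerivAt_bary T k x).mul_const η⁻¹
  exact (hd _).comp_hasFDerivAt x h1

/-- The ramp vanishes up to `κ`, so the product is supported where all barycentric coordinates are
at least `κη`, a compact subset of the interior. -/
lemma isTest_cutoff_mul (hψ : ContDiff ℝ ∞ ψ) {κ : ℝ} (hκ : 0 < κ)
    (h0 : ∀ t, t ≤ κ → ψ t = 0) {η : ℝ} (hη : 0 < η) {φ : Plane → ℂ} (hφ : ContDiff ℝ ∞ φ) :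
    IsTest T.interior fun x => (cutoff T ψ η x : ℂ) * φ x := by
  set K : Set Plane := {x | ∀ k, κ * η ≤ bary T k x} with hK
  have hKc : IsClosed K := by
    have : K = ⋂ k, {x | κ * η ≤ bary T k x} := by ext x; simp [hK]
    rw [this]
    exact isClosed_iInter fun k => isClosed_le continuous_const (continuous_bary T k)
  have hKΩ : K ⊆ T.interior := fun x hx =>
    (mem_interior_iff T).2 fun k => (mul_pos hκ hη).trans_le (hx k)
  have hsupp : Function.support (fun x => (cutoff T ψ η x : ℂ) * φ x) ⊆ K := by
    intro x hx k
    by_contra hk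
    refine hx ?_
    have : cutoff T ψ η x = 0 :=
      Finset.prod_eq_zero (Finset.mem_univ k) (h0 _ ((div_le_iff₀ hη).2 (not_le.1 hk).le))
    simp [this]
  refine ⟨?_, ?_, (closure_minimal hsupp hKc).trans hKΩ⟩
  · exact (Complex.ofRealCLM.contDiff.comp (contDiff_cutoff T hψ η)).mul hφ
  · exact HasCompactSupport.intro
      (Metric.isCompact_of_isClosed_isBounded hKc ((isBounded_interior T).subset hKΩ))
      fun x hx => Function.notMem_support.1 fun h => hx (hsupp h)

lemma pderiv_cutoff_mul (hd : ∀ t, HasDerivAt ψ (ρ t) t) (η : ℝ)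
    {φ : Plane → ℂ} (hφ : ContDiff ℝ ∞ φ) (j : Fin 2) (x : Plane) :
    pderiv j (fun x => (cutoff T ψ η x : ℂ) * φ x) x
      = cutoff T ψ η x * pderiv j φ x
        + φ x * ∑ k, (((∏ l ∈ Finset.univ.erase k, ψ (bary T l x / η))
          * (ρ (bary T k x / η) * (η⁻¹ * (T.height k)⁻¹)) : ℝ) : ℂ) * (normal T k j : ℂ) := by
  have h1 := Complex.ofRealCLM.hasFDerivAt.comp x (hasFDerivAt_cutoff T hd η x)
  have h2 := (hφ.differentiable (by simp) x).hasFDerivAt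
  have h3 : HasFDerivAt (fun x => (cutoff T ψ η x : ℂ) * φ x) _ x := h1.mul h2
  unfold pderiv
  rw [h3.fderiv]
  have hn : ∀ k, ⟪normal T k, EuclideanSpace.single j (1 : ℝ)⟫ = normal T k j := by
    intro k
    rw [EuclideanSpace.inner_single_right]
    simp
  simp only [add_apply, smul_apply, Function.comp_apply,
    Complex.ofRealCLM_apply, ContinuousLinearMap.comp_apply, sum_apply,
    innerSL_apply_apply, hn, smul_eq_mul, Complex.ofReal_sum, Complex.ofReal_mul]
  congr 2
  refine Finset.sum_congr rfl fun k _ => ?_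
  push_cast
  ring

lemma cutoff_mem (h01 : ∀ t, 0 ≤ ψ t ∧ ψ t ≤ 1) (η : ℝ) (x : Plane) :
    0 ≤ cutoff T ψ η x ∧ cutoff T ψ η x ≤ 1 :=
  ⟨Finset.prod_nonneg fun _ _ => (h01 _).1, Finset.prod_le_one (fun _ _ => (h01 _).1)
    fun _ _ => (h01 _).2⟩

lemma one_sub_cutoff_le (h01 : ∀ t, 0 ≤ ψ t ∧ ψ t ≤ 1) (h1 : ∀ t, 1 ≤ t → ψ t = 1) {η : ℝ}
    (hη : 0 < η) (x : Plane) :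
    1 - cutoff T ψ η x ≤ ∑ k, if bary T k x < η then 1 else 0 := by
  have hnn : ∀ k ∈ Finset.univ, (0 : ℝ) ≤ if bary T k x < η then 1 else 0 := fun k _ => by
    split_ifs <;> norm_num
  by_cases h : ∃ k, bary T k x < η
  · obtain ⟨k, hk⟩ := h
    have := Finset.single_le_sum hnn (Finset.mem_univ k)
    rw [if_pos hk] at this
    linarith [(cutoff_mem T h01 η x).1]
  · push Not at h
    have : cutoff T ψ η x = 1 :=
      Finset.prod_eq_one fun k _ => h1 _ ((one_le_div hη).2 (h k))
    rw [this, sub_self]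
    exact Finset.sum_nonneg hnn

/-- Pointwise bound for the error made by inserting a cutoff function. -/
lemma norm_cutoff_error_le (hd : ∀ t, HasDerivAt ψ (ρ t) t) {c : ℝ}
    (hρ : ∀ t, 0 ≤ ρ t ∧ ρ t ≤ c) (hρ1 : ∀ t, 1 ≤ t → ρ t = 0)
    (h01 : ∀ t, 0 ≤ ψ t ∧ ψ t ≤ 1) (h1 : ∀ t, 1 ≤ t → ψ t = 1) {η : ℝ} (hη : 0 < η)
    {φ : Plane → ℂ} (hφ : ContDiff ℝ ∞ φ) (a : Fin 2 → ℂ) (b : ℂ) (x : Plane) :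
    ‖((∑ j, a j * pderiv j φ x) + b * φ x)
      - ((∑ j, a j * pderiv j (fun x => (cutoff T ψ η x : ℂ) * φ x) x)
        + b * ((cutoff T ψ η x : ℂ) * φ x))‖
      ≤ ∑ k, if bary T k x < η then
          ((∑ j, ‖a j‖ * ‖pderiv j φ x‖) + ‖b‖ * ‖φ x‖)
            + c / (η * T.height k) * (‖φ x‖ * √(∑ j, ‖a j‖ ^ 2)) else 0 := by
  have hc0 : 0 ≤ c := (hρ 0).1.trans (hρ 0).2
  set H := (∑ j, ‖a j‖ * ‖pderiv j φ x‖) + ‖b‖ * ‖φ x‖ with hH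
  set N := √(∑ j, ‖a j‖ ^ 2) with hN
  have hN0 : 0 ≤ N := Real.sqrt_nonneg _
  have hH0 : 0 ≤ H := add_nonneg (Finset.sum_nonneg fun _ _ => by positivity) (by positivity)
  set w : Fin 3 → ℝ := fun k => (∏ l ∈ Finset.univ.erase k, ψ (bary T l x / η))
    * (ρ (bary T k x / η) * (η⁻¹ * (T.height k)⁻¹)) with hw
  -- The error consists of `1 - χ` times the original integrand and of `φ ∇χ · a`. The first will
  -- vanish with `η`; the second has size `1/η` in strips and carries the boundary term.
  have hsplit : ((∑ j, a j * pderiv j φ x) + b * φ x)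
      - ((∑ j, a j * pderiv j (fun x => (cutoff T ψ η x : ℂ) * φ x) x)
        + b * ((cutoff T ψ η x : ℂ) * φ x))
      = ((1 - cutoff T ψ η x : ℝ) : ℂ) * ((∑ j, a j * pderiv j φ x) + b * φ x)
        - φ x * ∑ k, (w k : ℂ) * ∑ j, (normal T k j : ℂ) * a j := by
    simp only [pderiv_cutoff_mul T hd η hφ, Fin.sum_univ_two, Fin.sum_univ_three, hw]
    push_cast
    ring
  have hF : ‖(∑ j, a j * pderiv j φ x) + b * φ x‖ ≤ H := by
    refine (norm_add_le _ _).trans (add_le_add ((norm_sum_le _ _).trans (le_of_eq ?_)) ?_)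
    · simp only [norm_mul]
    · rw [norm_mul]
  have hna : ∀ k, ‖∑ j, (normal T k j : ℂ) * a j‖ ≤ N := by
    intro k
    have := norm_sq_sum_mul_le (normal T k) a
    rw [norm_normal, one_pow, one_mul] at this
    exact Real.le_sqrt_of_sq_le this
  have hwk : ∀ k, |w k| ≤ if bary T k x < η then c / (η * T.height k) else 0 := by
    intro k
    have hl := T.height_pos k
    have hP0 : 0 ≤ ∏ l ∈ Finset.univ.erase k, ψ (bary T l x / η) :=
      Finset.prod_nonneg fun _ _ => (h01 _).1
    have hP1 : ∏ l ∈ Finset.univ.erase k, ψ (bary T l x / η) ≤ 1 :=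
      Finset.prod_le_one (fun _ _ => (h01 _).1) fun _ _ => (h01 _).2
    have hr := hρ (bary T k x / η)
    split_ifs with h
    · rw [hw]
      simp only
      rw [abs_of_nonneg (mul_nonneg hP0 (mul_nonneg hr.1 (by positivity)))]
      have e : c / (η * T.height k) = c * (η⁻¹ * (T.height k)⁻¹) := by
        rw [div_eq_mul_inv, mul_inv]
      rw [e]
      calc _ ≤ 1 * (ρ (bary T k x / η) * (η⁻¹ * (T.height k)⁻¹)) :=
            mul_le_mul_of_nonneg_right hP1 (mul_nonneg hr.1 (by positivity))
        _ ≤ c * (η⁻¹ * (T.height k)⁻¹) := by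
            rw [one_mul]
            exact mul_le_mul_of_nonneg_right hr.2 (by positivity)
    · rw [hw]
      simp only
      rw [hρ1 _ ((one_le_div hη).2 (not_lt.1 h))]
      simp
  have hχ := cutoff_mem T h01 η x
  rw [hsplit]
  refine (norm_sub_le _ _).trans ?_
  have hA : ‖((1 - cutoff T ψ η x : ℝ) : ℂ) * ((∑ j, a j * pderiv j φ x) + b * φ x)‖
      ≤ ∑ k, if bary T k x < η then H else 0 := by
    rw [norm_mul, Complex.norm_real, Real.norm_of_nonneg (by linarith [hχ.2])]
    refine (mul_le_mul (one_sub_cutoff_le T h01 h1 hη x) hF (norm_nonneg _) ?_).trans ?_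
    · exact Finset.sum_nonneg fun k _ => by split_ifs <;> norm_num
    · rw [Finset.sum_mul]
      refine Finset.sum_le_sum fun k _ => ?_
      split_ifs <;> simp
  have hB : ‖φ x * ∑ k, (w k : ℂ) * ∑ j, (normal T k j : ℂ) * a j‖
      ≤ ∑ k, if bary T k x < η then c / (η * T.height k) * (‖φ x‖ * N) else 0 := by
    rw [norm_mul]
    refine (mul_le_mul_of_nonneg_left (norm_sum_le _ _) (norm_nonneg _)).trans ?_
    rw [Finset.mul_sum]
    refine Finset.sum_le_sum fun k _ => ?_
    rw [norm_mul, Complex.norm_real, Real.norm_eq_abs]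
    refine (mul_le_mul_of_nonneg_left (mul_le_mul (hwk k) (hna k) (norm_nonneg _) ?_)
      (norm_nonneg _)).trans ?_
    · have := T.height_pos k
      split_ifs <;> positivity
    · split_ifs
      · exact le_of_eq (by ring)
      · simp
  refine (add_le_add hA hB).trans (le_of_eq ?_)
  rw [← Finset.sum_add_distrib]
  refine Finset.sum_congr rfl fun k _ => ?_
  split_ifs <;> simp

/-! ### Bounds for Green's functional -/

variable {T}

/-- The functional `φ ↦ ∫ G · ∇φ + f φ`. -/
def greenFunctional (G : Fin 2 → L2 T.interior) (f : L2 T.interior) (φ : Plane → ℂ) : ℂ :=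
  (∑ j, ∫ x in T.interior, G j x * pderiv j φ x) + ∫ x in T.interior, f x * φ x

lemma integrable_L2_mul (f : L2 T.interior) {φ : Plane → ℂ} (hφ : Continuous φ) :
    Integrable (fun x => f x * φ x) (volume.restrict T.interior) :=
  (Lp.memLp f).integrable_mul (memLp_restrict_of_continuous (isBounded_interior T) 2 hφ)

lemma greenFunctional_eq (G : Fin 2 → L2 T.interior) (f : L2 T.interior) {φ : Plane → ℂ}
    (hφ : ContDiff ℝ ∞ φ) :
    greenFunctional G f φ
      = ∫ x in T.interior, ((∑ j, G j x * pderiv j φ x) + f x * φ x) := by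
  rw [greenFunctional, integral_add, integral_finsetSum]
  · exact fun j _ => integrable_L2_mul (G j) (continuous_pderiv hφ j)
  · exact integrable_finsetSum _ fun j _ => integrable_L2_mul (G j) (continuous_pderiv hφ j)
  · exact integrable_L2_mul f hφ.continuous

lemma greenFunctional_isTest {G : Fin 2 → L2 T.interior} {f : L2 T.interior}
    (hG : IsWeakDiv T.interior G f) {φ : Plane → ℂ} (hφ : IsTest T.interior φ) :
    greenFunctional G f φ = 0 := by
  rw [greenFunctional, hG φ hφ]
  ring

lemma memLp_sqrt_sum (G : Fin 2 → L2 T.interior) :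
    MemLp (fun x => √(∑ j, ‖G j x‖ ^ 2)) 2 (volume.restrict T.interior) := by
  have hme : AEStronglyMeasurable (fun x => ∑ j, ‖G j x‖ ^ 2) (volume.restrict T.interior) :=
    (integrableOn_sum_norm_sq G).aestronglyMeasurable
  refine (memLp_two_iff_integrable_sq (Real.continuous_sqrt.comp_aestronglyMeasurable hme)).2 ?_
  refine (integrableOn_sum_norm_sq G).congr (ae_of_all _ fun x => ?_)
  simp only
  rw [Real.sq_sqrt (Finset.sum_nonneg fun _ _ => by positivity)]

/-- The integrand controlling the interior error of the cutoff. -/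
def errorDensity (G : Fin 2 → L2 T.interior) (f : L2 T.interior) (φ : Plane → ℂ) (x : Plane) :
    ℝ :=
  (∑ j, ‖G j x‖ * ‖pderiv j φ x‖) + ‖f x‖ * ‖φ x‖

lemma integrable_errorDensity (G : Fin 2 → L2 T.interior) (f : L2 T.interior) {φ : Plane → ℂ}
    (hφ : ContDiff ℝ ∞ φ) :
    Integrable (errorDensity G f φ) (volume.restrict T.interior) := by
  refine (integrable_finsetSum _ fun j _ => ?_).add ?_
  · simpa only [norm_mul] using (integrable_L2_mul (G j) (continuous_pderiv hφ j)).norm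
  · simpa only [norm_mul] using (integrable_L2_mul f hφ.continuous).norm

/-- The functional annihilates the test function `χφ`, so it only sees `(1 - χ)φ`, which lives in
the three strips. Cauchy–Schwarz there separates `φ` from `G`. -/
lemma norm_greenFunctional_le_strip {G : Fin 2 → L2 T.interior} {f : L2 T.interior}
    (hG : IsWeakDiv T.interior G f) {c : ℝ} (hc : 1 < c) {φ : Plane → ℂ}
    (hφ : ContDiff ℝ ∞ φ) {η : ℝ} (hη : 0 < η) :
    ‖greenFunctional G f φ‖ ≤ ∑ k, ((∫ x in T.interior ∩ {x | bary T k x < η},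
      errorDensity G f φ x) + c / (η * T.height k) *
        (√(∫ x in T.interior ∩ {x | bary T k x < η}, ‖φ x‖ ^ 2)
          * √(∫ x in T.interior ∩ {x | bary T k x < η}, ∑ j, ‖G j x‖ ^ 2))) := by
  obtain ⟨ψ, ρ, κ, hκ, hψ, hd, hρ, hρ1, hψ0, hψ1, h01⟩ := exists_ramp hc
  have hm := measurableSet_interior T
  have htest := isTest_cutoff_mul T hψ hκ hψ0 hη hφ
  have h1 : greenFunctional G f φ = ∫ x in T.interior,
      (((∑ j, G j x * pderiv j φ x) + f x * φ x)
      - ((∑ j, G j x * pderiv j (fun x => (cutoff T ψ η x : ℂ) * φ x) x)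
        + f x * ((cutoff T ψ η x : ℂ) * φ x))) := by
    have hint : ∀ χ : Plane → ℂ, ContDiff ℝ ∞ χ → Integrable
        (fun x => (∑ j, G j x * pderiv j χ x) + f x * χ x) (volume.restrict T.interior) :=
      fun χ hχ => (integrable_finsetSum _ fun j _ =>
        integrable_L2_mul (G j) (continuous_pderiv hχ j)).add (integrable_L2_mul f hχ.continuous)
    rw [integral_sub (hint φ hφ) (hint _ htest.1), ← greenFunctional_eq G f hφ,
      ← greenFunctional_eq G f htest.1, greenFunctional_isTest hG htest, sub_zero]
  have hsq := memLp_sqrt_sum G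
  have hφm := memLp_restrict_of_continuous (isBounded_interior T) 2 hφ.continuous
  have hprod : Integrable (fun x => ‖φ x‖ * √(∑ j, ‖G j x‖ ^ 2))
      (volume.restrict T.interior) := hφm.norm.integrable_mul hsq
  have hB : ∀ k, Integrable (fun x => errorDensity G f φ x
      + c / (η * T.height k) * (‖φ x‖ * √(∑ j, ‖G j x‖ ^ 2))) (volume.restrict T.interior) :=
    fun k => (integrable_errorDensity G f hφ).add (hprod.const_mul _)
  have hms : ∀ k, MeasurableSet {x | bary T k x < η} := fun k => measurableSet_bary_lt T k η
  have h2 : ∀ x, ‖((∑ j, G j x * pderiv j φ x) + f x * φ x)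
      - ((∑ j, G j x * pderiv j (fun x => (cutoff T ψ η x : ℂ) * φ x) x)
        + f x * ((cutoff T ψ η x : ℂ) * φ x))‖
      ≤ ∑ k, {x | bary T k x < η}.indicator (fun x => errorDensity G f φ x
        + c / (η * T.height k) * (‖φ x‖ * √(∑ j, ‖G j x‖ ^ 2))) x := by
    intro x
    exact norm_cutoff_error_le T hd hρ hρ1 h01 hψ1 hη hφ (fun j => G j x) (f x) x
  rw [h1]
  refine (norm_integral_le_of_norm_le (integrable_finsetSum _ fun k _ =>
    (hB k).indicator (hms k)) (ae_of_all _ h2)).trans ?_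
  rw [integral_finsetSum _ fun k _ => (hB k).indicator (hms k)]
  refine Finset.sum_le_sum fun k _ => ?_
  have hle : (volume : Measure Plane).restrict (T.interior ∩ {x | bary T k x < η})
      ≤ volume.restrict T.interior := Measure.restrict_mono inter_subset_left le_rfl
  have hc0 : 0 ≤ c / (η * T.height k) := by
    have := T.height_pos k
    positivity
  rw [setIntegral_indicator (hms k), integral_add ((integrable_errorDensity G f hφ).mono_measure
    hle) ((hprod.mono_measure hle).const_mul _), integral_const_mul]
  refine add_le_add le_rfl (mul_le_mul_of_nonneg_left ?_ hc0)
  have hcs := integral_mul_norm_le_sqrt (hφm.mono_measure hle) (hsq.mono_measure hle)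
  simp only [Real.norm_eq_abs, abs_of_nonneg (Real.sqrt_nonneg _)] at hcs
  refine hcs.trans (le_of_eq ?_)
  congr 2
  refine integral_congr_ae (ae_of_all _ fun x => ?_)
  simp only
  rw [Real.sq_sqrt (Finset.sum_nonneg fun _ _ => by positivity)]

lemma tendsto_setIntegral_strip (k : Fin 3) {H : Plane → ℝ}
    (hH : Integrable H (volume.restrict T.interior)) :
    Filter.Tendsto (fun η => ∫ x in T.interior ∩ {x | bary T k x < η}, H x) (𝓝[>] 0) (𝓝 0) := by
  have hms : ∀ η, MeasurableSet {x | bary T k x < η} := fun η => measurableSet_bary_lt T k η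
  simp_rw [← setIntegral_indicator (hms _)]
  have h0 : ∫ _ in T.interior, (0 : ℝ) = 0 := integral_zero _ _
  conv => enter [3]; rw [← h0]
  refine tendsto_integral_filter_of_dominated_convergence (fun x => ‖H x‖) ?_ ?_ hH.norm ?_
  · exact Filter.Eventually.of_forall fun η => hH.aestronglyMeasurable.indicator (hms η)
  · exact Filter.Eventually.of_forall fun η => ae_of_all _ fun x => norm_indicator_le_norm_self _ _
  · filter_upwards [ae_restrict_mem (measurableSet_interior T)] with x hx
    refine tendsto_const_nhds.congr' ?_
    have h1 : ∀ᶠ η in 𝓝[>] (0 : ℝ), η < bary T k x :=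
      mem_nhdsWithin_of_mem_nhds (gt_mem_nhds ((mem_interior_iff T).1 hx k))
    filter_upwards [h1] with η hη
    rw [indicator_of_notMem]
    simpa using hη.le

/-- Both strip integrals are of order `η`: that of `|φ|²` by continuity, that of `|G|²` by the
dilation estimate. The product of their square roots compensates the slope `1/η` of the cutoff. -/
lemma norm_greenFunctional_le_of_pos {v : L2 T.interior} {G : Fin 2 → L2 T.interior}
    {f : L2 T.interior} (hv : (v, G) ∈ H10 T.interior) (hG : IsWeakDiv T.interior G f)
    {φ : Plane → ℂ} (hφ : ContDiff ℝ ∞ φ) {δ : ℝ} (hδ : 0 < δ) :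
    ‖greenFunctional G f φ‖ ≤ ∑ k, (δ + (1 + δ) / T.height k *
      (√(T.height k * (∫ x in side T k, ‖φ x‖ ^ 2 ∂arclength) + δ)
        * √((1 + δ) * (rellich T k G f + 2 * δ * √(normSq G))))) := by
  have hη0 : ∀ᶠ η in 𝓝[>] (0 : ℝ), 0 < η := self_mem_nhdsWithin
  have hsmall : ∀ a : ℝ, 0 < a → ∀ᶠ η in 𝓝[>] (0 : ℝ), η < a := fun a ha =>
    mem_nhdsWithin_of_mem_nhds (gt_mem_nhds ha)
  have hstrip : ∀ k : Fin 3, ∀ᶠ η in 𝓝[>] (0 : ℝ),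
      ∫ x in T.interior ∩ {x | bary T k x < η}, ∑ j, ‖G j x‖ ^ 2
        ≤ η * ((1 + δ) * (rellich T k G f + 2 * δ * √(normSq G))) := by
    intro k
    obtain ⟨ε₀, hε, h⟩ := exists_setIntegral_strip_le k hv hG hδ
    filter_upwards [hη0, hsmall _ (show 0 < δ / (1 + δ) by positivity),
      hsmall _ (show 0 < ε₀ / (1 + δ) by positivity)] with η h0 h1 h2
    have h1' : η * (1 + δ) < δ := (lt_div_iff₀ (by positivity)).1 h1
    have h2' : η * (1 + δ) < ε₀ := (lt_div_iff₀ (by positivity)).1 h2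
    have hη1 : 0 < 1 - η := by nlinarith
    -- The factor `s = 1/(1 - η)` makes the strip `bₖ < 1 - s⁻¹` exactly `bₖ < η`, and `s - 1 = η/(1
    -- - η)` exceeds `η` only by a factor close to `1`.
    have hs : 1 < (1 - η)⁻¹ := (one_lt_inv₀ hη1).2 (by linarith)
    have hs2 : (1 - η)⁻¹ - 1 ≤ η * (1 + δ) := by
      rw [sub_le_iff_le_add, inv_le_iff_one_le_mul₀ hη1]
      nlinarith
    have h3 := h _ hs (hs2.trans h2'.le)
    rw [inv_inv, sub_sub_cancel] at h3
    have hX : 0 ≤ rellich T k G f + 2 * δ * √(normSq G) := by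
      have h4 : 0 ≤ ∫ x in T.interior ∩ {x | bary T k x < η}, ∑ j, ‖G j x‖ ^ 2 :=
        integral_nonneg fun _ => Finset.sum_nonneg fun _ _ => by positivity
      exact nonneg_of_mul_nonneg_right (h4.trans h3) (by linarith)
    refine h3.trans ((mul_le_mul_of_nonneg_right hs2 hX).trans (le_of_eq (by ring)))
  have herr : ∀ k : Fin 3, ∀ᶠ η in 𝓝[>] (0 : ℝ),
      ∫ x in T.interior ∩ {x | bary T k x < η}, errorDensity G f φ x < δ := fun k =>
    (tendsto_setIntegral_strip k (integrable_errorDensity G f hφ)).eventually (gt_mem_nhds hδ)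
  obtain ⟨η, hη, hs, he, ha⟩ := (hη0.and ((Filter.eventually_all.2 hstrip).and
    ((Filter.eventually_all.2 herr).and (Filter.eventually_all.2 fun k =>
      eventually_setIntegral_strip_le T k hφ.continuous hδ)))).exists
  refine (norm_greenFunctional_le_strip hG (c := 1 + δ) (by linarith) hφ hη).trans ?_
  refine Finset.sum_le_sum fun k _ => add_le_add (he k).le ?_
  have hl := T.height_pos k
  have h1 : √(∫ x in T.interior ∩ {x | bary T k x < η}, ‖φ x‖ ^ 2)
      ≤ √η * √(T.height k * (∫ x in side T k, ‖φ x‖ ^ 2 ∂arclength) + δ) := by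
    rw [← Real.sqrt_mul hη.le]
    exact Real.sqrt_le_sqrt (ha k)
  have h2 : √(∫ x in T.interior ∩ {x | bary T k x < η}, ∑ j, ‖G j x‖ ^ 2)
      ≤ √η * √((1 + δ) * (rellich T k G f + 2 * δ * √(normSq G))) := by
    rw [← Real.sqrt_mul hη.le]
    exact Real.sqrt_le_sqrt (hs k)
  refine (mul_le_mul_of_nonneg_left (mul_le_mul h1 h2 (Real.sqrt_nonneg _) (by positivity))
    (by positivity)).trans (le_of_eq ?_)
  have h3 : √η * √η = η := Real.mul_self_sqrt hη.le
  field_simp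
  rw [Real.sq_sqrt hη.le]

/-- The seminorm `(∫_S |φ|²)^{1/2}` on a side. -/
def sideNorm (T : Affine.Triangle ℝ Plane) (k : Fin 3) (φ : Plane → ℂ) : ℝ :=
  √(∫ x in side T k, ‖φ x‖ ^ 2 ∂arclength)

/-- Green's functional is bounded by the `L²` norms of the boundary values, with sharp
constants. -/
lemma norm_greenFunctional_le {v : L2 T.interior} {G : Fin 2 → L2 T.interior}
    {f : L2 T.interior} (hv : (v, G) ∈ H10 T.interior) (hG : IsWeakDiv T.interior G f)
    {φ : Plane → ℂ} (hφ : ContDiff ℝ ∞ φ) :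
    ‖greenFunctional G f φ‖ ≤ ∑ k, √(rellich T k G f / T.height k) * sideNorm T k φ := by
  have hcont : Continuous fun δ : ℝ => ∑ k, (δ + (1 + δ) / T.height k *
      (√(T.height k * (∫ x in side T k, ‖φ x‖ ^ 2 ∂arclength) + δ)
        * √((1 + δ) * (rellich T k G f + 2 * δ * √(normSq G))))) := by
    fun_prop
  -- The width `η` has already been eliminated, so `δ → 0` may be taken at fixed `φ`.
  have hlim := ge_of_tendsto (tendsto_nhdsWithin_of_tendsto_nhds (s := Ioi 0) (hcont.tendsto 0))
    (b := ‖greenFunctional G f φ‖) (by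
      filter_upwards [self_mem_nhdsWithin] with δ hδ
      exact norm_greenFunctional_le_of_pos hv hG hφ hδ)
  refine hlim.trans (le_of_eq (Finset.sum_congr rfl fun k _ => ?_))
  have hl := T.height_pos k
  rw [Real.sqrt_div' _ hl.le, sideNorm]
  simp only [zero_add, add_zero, mul_zero, zero_mul, one_mul]
  rw [Real.sqrt_mul hl.le]
  have h3 : √(T.height k) ≠ 0 := (Real.sqrt_pos.2 hl).ne'
  field_simp
  rw [Real.sq_sqrt hl.le]

end Tri

end

section

open scoped Topology

/-! ### Uniqueness of the weak divergence -/

lemma isWeakDiv_unique {Ω : Set Plane} (hΩ : IsOpen Ω) (hb : Bornology.IsBounded Ω)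
    {G : Fin 2 → L2 Ω} {f f' : L2 Ω} (h : IsWeakDiv Ω G f) (h' : IsWeakDiv Ω G f') : f = f' := by
  have hi := integrable_L2 hb f
  have hi' := integrable_L2 hb f'
  have key : ∀ᵐ x : Plane, x ∈ Ω → f x - f' x = 0 := by
    refine hΩ.ae_eq_zero_of_integral_contDiff_smul_eq_zero (f := fun x => f x - f' x) ?_ ?_
    · exact IntegrableOn.locallyIntegrableOn (hi.sub hi')
    · intro g hg hgc hgs
      have htest : IsTest Ω fun x => (g x : ℂ) := by
        refine ⟨Complex.ofRealCLM.contDiff.comp hg, hgc.comp_left (g := fun t : ℝ => (t : ℂ))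
          (by simp), (closure_mono fun x hx => ?_).trans hgs⟩
        simpa using hx
      have hmul : ∀ a : L2 Ω, Integrable (fun x => a x * (g x : ℂ)) (volume.restrict Ω) :=
        fun a => (Lp.memLp a).integrable_mul
          (memLp_restrict_of_continuous hb 2 htest.1.continuous)
      have h1 : ∫ x, g x • (f x - f' x) = ∫ x in Ω, g x • (f x - f' x) := by
        refine (setIntegral_eq_integral_of_isTest htest fun x hx => ?_).symm
        have := image_eq_zero_of_notMem_tsupport hx
        have hg0 : g x = 0 := by exact_mod_cast this
        rw [hg0, zero_smul]
      have h2 : ∫ x in Ω, g x • (f x - f' x)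
          = (∫ x in Ω, f x * (g x : ℂ)) - ∫ x in Ω, f' x * (g x : ℂ) := by
        rw [← integral_sub (hmul f) (hmul f')]
        refine integral_congr_ae (ae_of_all _ fun x => ?_)
        simp only [Complex.real_smul]
        ring
      rw [h1, h2, sub_eq_zero, ← neg_inj, ← h _ htest, ← h' _ htest]
  refine Lp.ext ?_
  rw [Filter.EventuallyEq, ae_restrict_iff' hΩ.measurableSet]
  filter_upwards [key] with x hx hxΩ
  exact sub_eq_zero.1 (hx hxΩ)

namespace Tri

variable {T : Affine.Triangle ℝ Plane}

/-! ### Boundary values in `L²` -/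

lemma isCompact_bdry : IsCompact (bdry T) := by
  refine isCompact_iUnion fun j => ?_
  rw [side_eq_image]
  exact isCompact_Icc.image (isometry_sideChart_zero T j).continuous

lemma memLp_bdry_of_continuous {φ : Plane → ℂ} (hφ : Continuous φ) :
    MemLp φ 2 (arclength.restrict (bdry T)) := by
  obtain ⟨C, hC⟩ := (isCompact_bdry (T := T)).exists_bound_of_continuousOn hφ.continuousOn
  refine MemLp.of_bound hφ.aestronglyMeasurable C ?_
  filter_upwards [ae_restrict_mem (measurableSet_bdry T)] with x hx using hC x hx

lemma restrict_side_le (k : Fin 3) :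
    arclength.restrict (side T k) ≤ arclength.restrict (bdry T) :=
  Measure.restrict_mono (subset_iUnion (side T) k) le_rfl

lemma sideNorm_eq_eLpNorm (k : Fin 3) {h : Plane → ℂ}
    (hh : MemLp h 2 (arclength.restrict (bdry T))) :
    sideNorm T k h = (eLpNorm h 2 (arclength.restrict (side T k))).toReal := by
  rw [toReal_eLpNorm_two_eq_sqrt (hh.mono_measure (restrict_side_le k)), sideNorm]

lemma sideNorm_le_eLpNorm (k : Fin 3) {h : Plane → ℂ}
    (hh : MemLp h 2 (arclength.restrict (bdry T))) :
    sideNorm T k h ≤ (eLpNorm h 2 (arclength.restrict (bdry T))).toReal := by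
  rw [sideNorm_eq_eLpNorm k hh]
  exact ENNReal.toReal_mono hh.2.ne (eLpNorm_mono_measure h (restrict_side_le k))

lemma sideNorm_le_add (k : Fin 3) {h φ : Plane → ℂ}
    (hh : MemLp h 2 (arclength.restrict (bdry T)))
    (hφ : MemLp φ 2 (arclength.restrict (bdry T))) :
    sideNorm T k φ ≤ sideNorm T k h
      + (eLpNorm (h - φ) 2 (arclength.restrict (bdry T))).toReal := by
  have hle := restrict_side_le (T := T) k
  have h1 := hh.mono_measure hle
  have h2 := (hh.sub hφ).mono_measure hle
  refine le_trans ?_ (add_le_add le_rfl (sideNorm_le_eLpNorm k (hh.sub hφ)))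
  rw [sideNorm_eq_eLpNorm k hh, sideNorm_eq_eLpNorm k hφ, sideNorm_eq_eLpNorm k (hh.sub hφ),
    ← ENNReal.toReal_add h1.2.ne h2.2.ne]
  refine ENNReal.toReal_mono (ENNReal.add_ne_top.2 ⟨h1.2.ne, h2.2.ne⟩) ?_
  have : φ = h - (h - φ) := by simp
  conv_lhs => rw [this]
  exact eLpNorm_sub_le h1.1 h2.1 (by simp)

/-- A bound by side norms extends from smooth functions to `L²`. -/
lemma norm_integral_bdry_le {g : Plane → ℂ} (hg : MemLp g 2 (arclength.restrict (bdry T)))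
    {r : Fin 3 → ℝ} (hr : ∀ k, 0 ≤ r k)
    (hbound : ∀ φ : Plane → ℂ, ContDiff ℝ ∞ φ →
      ‖∫ x in bdry T, g x * φ x ∂arclength‖ ≤ ∑ k, r k * sideNorm T k φ)
    {h : Plane → ℂ} (hh : MemLp h 2 (arclength.restrict (bdry T))) :
    ‖∫ x in bdry T, g x * h x ∂arclength‖ ≤ ∑ k, r k * sideNorm T k h := by
  set A := (eLpNorm g 2 (arclength.restrict (bdry T))).toReal + ∑ k, r k with hA
  have hA0 : 0 ≤ A := add_nonneg ENNReal.toReal_nonneg (Finset.sum_nonneg fun k _ => hr k)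
  refine le_of_forall_pos_le_add fun ε hε => ?_
  obtain ⟨φ, -, hφ, hφε⟩ := hh.exist_eLpNorm_sub_le (by simp) (by simp)
    (show 0 < ε / (A + 1) by positivity)
  have hφm := memLp_bdry_of_continuous (T := T) hφ.continuous
  have h1 : (eLpNorm (h - φ) 2 (arclength.restrict (bdry T))).toReal ≤ ε / (A + 1) := by
    have := ENNReal.toReal_mono ENNReal.ofReal_ne_top hφε
    rwa [ENNReal.toReal_ofReal (by positivity)] at this
  have h2 : ∫ x in bdry T, g x * h x ∂arclength
      = (∫ x in bdry T, g x * φ x ∂arclength)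
        + ∫ x in bdry T, g x * (h - φ) x ∂arclength := by
    have i1 : Integrable (fun x => g x * φ x) (arclength.restrict (bdry T)) :=
      hg.integrable_mul hφm
    have i2 : Integrable (fun x => g x * (h - φ) x) (arclength.restrict (bdry T)) :=
      hg.integrable_mul (hh.sub hφm)
    rw [← integral_add i1 i2]
    refine integral_congr_ae (ae_of_all _ fun x => ?_)
    simp only [Pi.sub_apply]
    ring
  rw [h2]
  calc _ ≤ ‖∫ x in bdry T, g x * φ x ∂arclength‖
        + ‖∫ x in bdry T, g x * (h - φ) x ∂arclength‖ := norm_add_le _ _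
    _ ≤ (∑ k, r k * (sideNorm T k h + ε / (A + 1)))
        + (eLpNorm g 2 (arclength.restrict (bdry T))).toReal * (ε / (A + 1)) := by
        refine add_le_add ((hbound φ hφ).trans (Finset.sum_le_sum fun k _ => ?_)) ?_
        · exact mul_le_mul_of_nonneg_left ((sideNorm_le_add k hh hφm).trans
            (add_le_add le_rfl h1)) (hr k)
        · exact (norm_integral_mul_le_eLpNorm hg (hh.sub hφm)).trans
            (mul_le_mul_of_nonneg_left h1 ENNReal.toReal_nonneg)
    _ = (∑ k, r k * sideNorm T k h) + A * (ε / (A + 1)) := by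
        simp only [mul_add, Finset.sum_add_distrib, ← Finset.sum_mul, hA]
        ring
    _ ≤ _ := by
        refine add_le_add le_rfl ?_
        rw [mul_div_assoc', div_le_iff₀ (by positivity)]
        nlinarith

/-! ### The Rellich identity -/

/-- Up to an arbitrarily small error and a positive factor, this quantity dominates the integral of
`|∇v|²` over a strip. -/
lemma rellich_nonneg (k : Fin 3) {v : L2 T.interior} {G : Fin 2 → L2 T.interior}
    {f : L2 T.interior} (hv : (v, G) ∈ H10 T.interior) (hG : IsWeakDiv T.interior G f) :
    0 ≤ rellich T k G f := by
  refine le_of_forall_pos_le_add fun η hη => ?_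
  obtain ⟨ε₀, h0, h⟩ := exists_setIntegral_strip_le k hv hG
    (show 0 < η / (2 * (√(normSq G) + 1)) by positivity)
  have h1 := h (1 + ε₀) (by linarith) (by linarith)
  have h2 : 0 ≤ ∫ x in T.interior ∩ {x | bary T k x < 1 - (1 + ε₀)⁻¹}, ∑ j, ‖G j x‖ ^ 2 :=
    integral_nonneg fun _ => Finset.sum_nonneg fun _ _ => by positivity
  have h3 := nonneg_of_mul_nonneg_right (h2.trans h1) (by linarith)
  have h4 : 2 * (η / (2 * (√(normSq G) + 1))) * √(normSq G) ≤ η := by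
    have := Real.sqrt_nonneg (normSq G)
    have e : 2 * (η / (2 * (√(normSq G) + 1))) * √(normSq G)
        = η * √(normSq G) / (√(normSq G) + 1) := by field_simp
    rw [e, div_le_iff₀ (by positivity)]
    nlinarith
  linarith

/-- The Rellich identity on a side of a triangle. -/
lemma height_mul_integral_eq (i : Fin 3) {v : L2 T.interior} {G : Fin 2 → L2 T.interior}
    {f : L2 T.interior} (hv : (v, G) ∈ H10 T.interior) (hG : IsWeakDiv T.interior G f)
    {g : Plane → ℂ} (hg : MemLp g 2 (arclength.restrict (bdry T)))
    (hgreen : GreenFormula T G f g) :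
    T.height i * ∫ x in side T i, ‖g x‖ ^ 2 ∂arclength = rellich T i G f := by
  refine le_antisymm ?_ (rellich_le i hv hG hg hgreen)
  have hl := T.height_pos i
  set a := ∫ x in side T i, ‖g x‖ ^ 2 ∂arclength with ha
  have ha0 : 0 ≤ a := integral_nonneg fun _ => by positivity
  -- Testing with the conjugate of `g` on a single side isolates that side: `a ≤ √(R/ℓ) √a`, hence
  -- `ℓ a ≤ R`. The sharp constant in Green's estimate is essential here.
  set h : Plane → ℂ := (side T i).indicator fun x => (starRingEnd ℂ) (g x) with hh
  have hstar : MemLp (fun x => (starRingEnd ℂ) (g x)) 2 (arclength.restrict (bdry T)) := hg.star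
  have hmem : MemLp h 2 (arclength.restrict (bdry T)) :=
    hstar.indicator (measurableSet_side T i)
  have key := norm_integral_bdry_le hg (r := fun k => √(rellich T k G f / T.height k))
    (fun k => Real.sqrt_nonneg _) (fun φ hφ => by
      rw [← hgreen φ hφ]
      exact norm_greenFunctional_le hv hG hφ) hmem
  have e1 : ∫ x in bdry T, g x * h x ∂arclength = (a : ℂ) := by
    have h1 : ∀ x, g x * h x = (side T i).indicator (fun x => ((‖g x‖ ^ 2 : ℝ) : ℂ)) x := by
      intro x
      by_cases hx : x ∈ side T i
      · rw [hh, indicator_of_mem hx, indicator_of_mem hx, Complex.mul_conj,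
          Complex.normSq_eq_norm_sq]
      · rw [hh, indicator_of_notMem hx, indicator_of_notMem hx, mul_zero]
    have hsub : side T i ⊆ bdry T := subset_iUnion (side T) i
    simp_rw [h1]
    rw [setIntegral_indicator (measurableSet_side T i),
      inter_eq_self_of_subset_right hsub, integral_complex_ofReal]
  have e2 : sideNorm T i h = √a := by
    rw [sideNorm, ha]
    congr 1
    refine setIntegral_congr_fun (measurableSet_side T i) fun x hx => ?_
    rw [hh, indicator_of_mem hx, RCLike.norm_conj]
  have e3 : ∀ k, k ≠ i → sideNorm T k h = 0 := by
    intro k hk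
    rw [sideNorm, Real.sqrt_eq_zero']
    refine le_of_eq (integral_eq_zero_of_ae ?_)
    have hnull : ∀ᵐ x ∂arclength.restrict (side T k), x ∉ side T i := by
      rw [ae_restrict_iff' (measurableSet_side T k), ae_iff]
      refine measure_mono_null (fun x hx => ?_) (arclength_side_inter_side T k hk)
      simpa using hx
    filter_upwards [hnull] with x hx
    rw [hh, indicator_of_notMem hx]
    simp
  rw [e1, Finset.sum_eq_single i (fun k _ hk => by rw [e3 k hk, mul_zero]) (by simp), e2,
    Complex.norm_real, Real.norm_of_nonneg ha0] at key
  have hR := rellich_nonneg i hv hG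
  have hq : 0 ≤ rellich T i G f / T.height i := div_nonneg hR hl.le
  have h1 : √a ≤ √(rellich T i G f / T.height i) := by
    rcases (Real.sqrt_nonneg a).eq_or_lt with h0 | h0
    · rw [← h0]; exact Real.sqrt_nonneg _
    · refine le_of_mul_le_mul_right ?_ h0
      rwa [Real.mul_self_sqrt ha0]
  have h2 := (Real.sqrt_le_sqrt_iff hq).1 h1
  rw [le_div_iff₀ hl] at h2
  linarith

/-! ### Existence of the normal derivative -/

/-- The space of smooth functions. -/
def smoothFunctions : Submodule ℂ (Plane → ℂ) where
  carrier := {φ | ContDiff ℝ ∞ φ}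
  add_mem' {a b} h1 h2 := ContDiff.add (show ContDiff ℝ ∞ a from h1) (show ContDiff ℝ ∞ b from h2)
  zero_mem' := show ContDiff ℝ ∞ fun _ : Plane => (0 : ℂ) from contDiff_const
  smul_mem' c a h := ContDiff.const_smul c (show ContDiff ℝ ∞ a from h)

variable (T) in
/-- Boundary values of smooth functions. -/
def boundaryValue : smoothFunctions →ₗ[ℂ] Lp ℂ 2 (arclength.restrict (bdry T)) where
  toFun φ := (memLp_bdry_of_continuous (T := T) (show ContDiff ℝ ∞ φ.1 from φ.2).continuous).toLp
  map_add' _ _ := rfl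
  map_smul' _ _ := rfl

lemma denseRange_boundaryValue : DenseRange (boundaryValue T) := by
  refine (Lp.dense_hasCompactSupport_contDiff (F := ℂ) (p := 2)
    (μ := arclength.restrict (bdry T)) (by simp)).mono ?_
  rintro f ⟨φ, hφ, -, hφ2⟩
  refine ⟨⟨φ, hφ2⟩, Lp.ext ?_⟩
  exact ((memLp_bdry_of_continuous (T := T) hφ2.continuous).coeFn_toLp).trans hφ.symm

/-- Green's functional as a linear map. -/
def greenLinear (G : Fin 2 → L2 T.interior) (f : L2 T.interior) : smoothFunctions →ₗ[ℂ] ℂ where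
  toFun φ := greenFunctional G f φ
  map_add' φ χ := by
    have hφ : ContDiff ℝ ∞ φ.1 := φ.2
    have hχ : ContDiff ℝ ∞ χ.1 := χ.2
    have hi : ∀ ξ : Plane → ℂ, ContDiff ℝ ∞ ξ → Integrable
        (fun x => (∑ j, G j x * pderiv j ξ x) + f x * ξ x) (volume.restrict T.interior) :=
      fun ξ hξ => (integrable_finsetSum _ fun j _ =>
        integrable_L2_mul (G j) (continuous_pderiv hξ j)).add (integrable_L2_mul f hξ.continuous)
    rw [greenFunctional_eq G f (φ + χ).2, greenFunctional_eq G f hφ, greenFunctional_eq G f hχ,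
      ← integral_add (hi _ hφ) (hi _ hχ)]
    refine integral_congr_ae (ae_of_all _ fun x => ?_)
    have h : ∀ j, pderiv j (φ + χ : smoothFunctions).1 x = pderiv j φ.1 x + pderiv j χ.1 x :=
      fun j => pderiv_add hφ hχ j x
    have h' : (φ + χ : smoothFunctions).1 x = φ.1 x + χ.1 x := rfl
    simp only [Fin.sum_univ_two, h, h']
    ring
  map_smul' c φ := by
    have hφ : ContDiff ℝ ∞ φ.1 := φ.2
    rw [greenFunctional_eq G f (c • φ).2, greenFunctional_eq G f hφ, RingHom.id_apply,
      smul_eq_mul, ← integral_const_mul]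
    refine integral_congr_ae (ae_of_all _ fun x => ?_)
    have h : ∀ j, pderiv j (c • φ : smoothFunctions).1 x = c * pderiv j φ.1 x := by
      intro j
      unfold pderiv
      have : fderiv ℝ (c • φ : smoothFunctions).1 x = c • fderiv ℝ φ.1 x :=
        fderiv_const_smul (hφ.differentiable (by simp) x) c
      rw [this]
      rfl
    have h' : (c • φ : smoothFunctions).1 x = c * φ.1 x := rfl
    simp only [Fin.sum_univ_two, h, h']
    ring

/-- Green's functional is bounded by the `L²` norm of boundary values, which are dense, so it
factors through the restriction to the boundary and extends to all of `L²`. The Riesz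
representative, conjugated, is the normal derivative. -/
lemma exists_greenFormula {v : L2 T.interior} {G : Fin 2 → L2 T.interior} {f : L2 T.interior}
    (hv : (v, G) ∈ H10 T.interior) (hG : IsWeakDiv T.interior G f) :
    ∃ g : Plane → ℂ, MemLp g 2 (arclength.restrict (bdry T)) ∧ GreenFormula T G f g := by
  have hbound : ∀ φ : smoothFunctions, ‖greenLinear G f φ‖
      ≤ (∑ k, √(rellich T k G f / T.height k)) * ‖boundaryValue T φ‖ := by
    intro φ
    have hφ : ContDiff ℝ ∞ φ.1 := φ.2
    refine (norm_greenFunctional_le hv hG hφ).trans ?_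
    rw [Finset.sum_mul]
    refine Finset.sum_le_sum fun k _ => mul_le_mul_of_nonneg_left ?_ (Real.sqrt_nonneg _)
    have hm := memLp_bdry_of_continuous (T := T) hφ.continuous
    refine (sideNorm_le_eLpNorm k hm).trans (le_of_eq ?_)
    exact (Lp.norm_toLp _ hm).symm
  set F := (greenLinear G f).extendOfNorm (boundaryValue T) with hF
  have hFeq : ∀ φ, F (boundaryValue T φ) = greenLinear G f φ := fun φ =>
    LinearMap.extendOfNorm_eq denseRange_boundaryValue ⟨_, hbound⟩ φ
  set κ := (InnerProductSpace.toDual ℂ (Lp ℂ 2 (arclength.restrict (bdry T)))).symm F with hκ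
  refine ⟨fun x => (starRingEnd ℂ) (κ x), (Lp.memLp κ).star, fun φ hφ => ?_⟩
  have h1 : inner ℂ κ (boundaryValue T ⟨φ, hφ⟩) = F (boundaryValue T ⟨φ, hφ⟩) := by
    rw [hκ, InnerProductSpace.toDual_symm_apply]
  rw [hFeq, L2.inner_def] at h1
  refine h1.symm.trans (integral_congr_ae ?_)
  filter_upwards [(memLp_bdry_of_continuous (T := T) hφ.continuous).coeFn_toLp] with x hx
  have h2 : (boundaryValue T ⟨φ, hφ⟩ : Plane → ℂ) x = φ x := hx
  rw [h2, RCLike.inner_apply, mul_comm]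

end Tri

end

section

open scoped Topology

/-! ### Time derivatives of waves -/

/-- Difference quotients stay in the subspace, and closedness passes to the limit. Applied to `H¹₀`,
this makes `∂ₜu` an admissible function in the weak wave equation. -/
lemma mem_submodule_of_hasDerivWithinAt {E : Type*} [NormedAddCommGroup E] [NormedSpace ℝ E]
    {K : Submodule ℝ E} (hK : IsClosed (K : Set E)) {c : ℝ → E} {c' : E} {t : ℝ}
    (hc : HasDerivWithinAt c c' (Ioi t) t) (hm : ∀ s, t ≤ s → c s ∈ K) : c' ∈ K := by
  have h := (hasDerivWithinAt_iff_tendsto_slope' self_notMem_Ioi).1 hc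
  refine hK.mem_of_tendsto h ?_
  filter_upwards [self_mem_nhdsWithin] with s hs
  rw [slope_def_module]
  exact K.smul_mem _ (K.sub_mem (hm s (le_of_lt hs)) (hm t le_rfl))

namespace IsWaveSolution

variable {Ω : Set Plane} {u₀ u₁ : L2 Ω} {u : ℝ → L2 Ω} {Du : ℝ → Fin 2 → L2 Ω}

lemma contDiffOn_timeDeriv (h : IsWaveSolution Ω u₀ u₁ u Du) :
    ContDiffOn ℝ 1 (timeDeriv u) (Ici 0) :=
  ((contDiffOn_succ_iff_derivWithin (n := 1) (uniqueDiffOn_Ici 0)).1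
    (by simpa [one_add_one_eq_two] using h.contDiffOn_L2)).2.2

lemma continuousOn_timeDeriv_two (h : IsWaveSolution Ω u₀ u₁ u Du) :
    ContinuousOn (timeDeriv (timeDeriv u)) (Ici 0) :=
  ((contDiffOn_one_iff_derivWithin (uniqueDiffOn_Ici 0)).1 h.contDiffOn_timeDeriv).2

lemma hasDerivWithinAt (h : IsWaveSolution Ω u₀ u₁ u Du) {t : ℝ} (ht : 0 ≤ t) :
    HasDerivWithinAt u (timeDeriv u t) (Ici 0) t :=
  ((h.contDiffOn_L2.differentiableOn (by simp)) t ht).hasDerivWithinAt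

lemma hasDerivWithinAt_timeDeriv (h : IsWaveSolution Ω u₀ u₁ u Du) {t : ℝ} (ht : 0 ≤ t) :
    HasDerivWithinAt (timeDeriv u) (timeDeriv (timeDeriv u) t) (Ici 0) t :=
  ((h.contDiffOn_timeDeriv.differentiableOn (by simp)) t ht).hasDerivWithinAt

lemma hasDerivWithinAt_grad (h : IsWaveSolution Ω u₀ u₁ u Du) {t : ℝ} (ht : 0 ≤ t) :
    HasDerivWithinAt Du (derivWithin Du (Ici 0) t) (Ici 0) t :=
  ((h.contDiffOn_grad.differentiableOn (by simp)) t ht).hasDerivWithinAt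

lemma timeDeriv_mem_H10 (h : IsWaveSolution Ω u₀ u₁ u Du) {t : ℝ} (ht : 0 ≤ t) :
    (timeDeriv u t, derivWithin Du (Ici 0) t) ∈ H10 Ω := by
  have hsub : Ioi t ⊆ Ici 0 := fun s hs => ht.trans (le_of_lt hs)
  exact mem_submodule_of_hasDerivWithinAt (K := H10Submodule Ω) (c := fun s => (u s, Du s))
    isClosed_closure
    (((h.hasDerivWithinAt ht).mono hsub).prodMk ((h.hasDerivWithinAt_grad ht).mono hsub))
    fun s hs => h.dirichlet s (ht.trans hs)

end IsWaveSolution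

lemma hasDerivWithinAt_re_inner {E : Type*} [NormedAddCommGroup E] [InnerProductSpace ℂ E]
    {f g : ℝ → E} {f' g' : E} {s : Set ℝ} {t : ℝ} (hf : HasDerivWithinAt f f' s t)
    (hg : HasDerivWithinAt g g' s t) :
    HasDerivWithinAt (fun r => (inner ℂ (f r) (g r)).re)
      ((inner ℂ (f t) g').re + (inner ℂ f' (g t)).re) s t :=
  Complex.reCLM.hasFDerivAt.comp_hasDerivWithinAt t (hf.inner ℂ hg)

namespace Tri

variable {T : Affine.Triangle ℝ Plane} {u₀ u₁ : L2 T.interior} {u : ℝ → L2 T.interior}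
  {Du : ℝ → Fin 2 → L2 T.interior}

/-! ### Conservation of energy -/

lemma energy_eq (t : ℝ) : energy u Du t = ‖timeDeriv u t‖ ^ 2 + normSq (Du t) := by
  rw [energy, integral_add (integrable_norm_sq_L2 _) (integrableOn_sum_norm_sq _), norm_sq_L2_eq,
    normSq_eq_integral]

lemma energy_nonneg (t : ℝ) : 0 ≤ energy u Du t := by
  rw [energy_eq]
  have := normSq_nonneg (Du t)
  positivity

/-- Testing the wave equation with `∂ₜu ∈ H¹₀` makes the kinetic and potential contributions cancel.
-/
lemma hasDerivWithinAt_energy (h : IsWaveSolution T.interior u₀ u₁ u Du) {t : ℝ} (ht : 0 ≤ t) :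
    HasDerivWithinAt (energy u Du) 0 (Ici 0) t := by
  have e : energy u Du = fun r => (inner ℂ (timeDeriv u r) (timeDeriv u r)).re
      + ∑ j, (inner ℂ (Du r j) (Du r j)).re := by
    funext r
    rw [energy_eq, normSq]
    congr 1
    · exact (inner_self_eq_norm_sq (𝕜 := ℂ) _).symm
    · exact Finset.sum_congr rfl fun j _ => (inner_self_eq_norm_sq (𝕜 := ℂ) _).symm
  have hv := h.hasDerivWithinAt_timeDeriv ht
  have hD := hasDerivWithinAt_pi.1 (h.hasDerivWithinAt_grad ht)
  have hd := (hasDerivWithinAt_re_inner hv hv).add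
    (HasDerivWithinAt.fun_sum (u := Finset.univ) fun j _ => hasDerivWithinAt_re_inner (hD j) (hD j))
  rw [e]
  refine hd.congr_deriv ?_
  have key := congrArg Complex.re
    (vinner_eq_of_isWeakDiv (isBounded_interior T) (h.wave t ht) (h.timeDeriv_mem_H10 ht))
  have hs := fun a b : L2 T.interior => inner_re_symm (𝕜 := ℂ) a b
  simp only [RCLike.re_to_complex] at hs
  simp only [vinner, Complex.re_sum, Complex.neg_re] at key
  rw [hs (timeDeriv (timeDeriv u) t)]
  simp_rw [fun j => hs (Du t j) (derivWithin Du (Ici 0) t j)]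
  rw [Finset.sum_add_distrib, key]
  ring

lemma energy_eq_energy_zero (h : IsWaveSolution T.interior u₀ u₁ u Du) {t : ℝ} (ht : 0 ≤ t) :
    energy u Du t = energy u Du 0 := by
  refine constant_of_has_deriv_right_zero (a := 0) (b := t) (fun s hs => ?_) (fun s hs => ?_) t
    ⟨ht, le_rfl⟩
  · exact ((hasDerivWithinAt_energy h hs.1).continuousWithinAt).mono Icc_subset_Ici_self
  · exact (hasDerivWithinAt_energy h hs.1).mono (Ici_subset_Ici.2 hs.1)

/-! ### The radial multiplier -/

variable (T) in
/-- The radial momentum `Re ∫ 2 (x - pᵢ) · ∇u ∂ₜū + u ∂ₜū`. -/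
def momentum (i : Fin 3) (u : ℝ → L2 T.interior) (Du : ℝ → Fin 2 → L2 T.interior) (t : ℝ) : ℝ :=
  rellich T i (Du t) (timeDeriv u t) + (inner ℂ (u t) (timeDeriv u t)).re

/-- By the virial identity the term `2 Re ∫ X∂ₜu ∂ₜū` is `-2‖∂ₜu‖²`. The correction `u ∂ₜū` adds
`‖∂ₜu‖² - ‖∇u‖²`, which turns this into exactly minus the energy. -/
lemma hasDerivWithinAt_momentum (i : Fin 3) (h : IsWaveSolution T.interior u₀ u₁ u Du) {t : ℝ}
    (ht : 0 ≤ t) :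
    HasDerivWithinAt (momentum T i u Du)
      (rellich T i (Du t) (timeDeriv (timeDeriv u) t) - energy u Du 0) (Ici 0) t := by
  have hb := isBounded_interior T
  have hv := h.hasDerivWithinAt_timeDeriv ht
  have hR : HasDerivWithinAt (fun r => radial hb (T.points i) (Du r))
      (radial hb (T.points i) (derivWithin Du (Ici 0) t)) (Ici 0) t :=
    ((radial hb (T.points i)).restrictScalars ℝ).hasFDerivAt.comp_hasDerivWithinAt t
      (h.hasDerivWithinAt_grad ht)
  have hd := ((hasDerivWithinAt_re_inner hR hv).const_mul 2).add
    (hasDerivWithinAt_re_inner (h.hasDerivWithinAt ht) hv)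
  refine hd.congr_deriv ?_
  have hs := fun a b : L2 T.interior => inner_re_symm (𝕜 := ℂ) a b
  simp only [RCLike.re_to_complex] at hs
  have h1 := re_inner_radial hb (T.points i) (h.timeDeriv_mem_H10 ht)
  rw [hs] at h1
  have h2 := congrArg Complex.re
    (vinner_eq_of_isWeakDiv hb (h.wave t ht) (h.dirichlet t ht))
  rw [vinner_self, Complex.ofReal_re, Complex.neg_re] at h2
  have h3 : (inner ℂ (timeDeriv u t) (timeDeriv u t)).re = ‖timeDeriv u t‖ ^ 2 :=
    inner_self_eq_norm_sq (𝕜 := ℂ) _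
  rw [← energy_eq_energy_zero h ht, energy_eq, rellich, h3]
  linarith

lemma abs_re_inner_le {E : Type*} [NormedAddCommGroup E] [InnerProductSpace ℂ E] {a w : E}
    {c : ℝ} (ha : ‖a‖ ≤ c) : |(inner ℂ a w).re| ≤ c * ‖w‖ :=
  ((Complex.abs_re_le_norm _).trans (norm_inner_le_norm _ _)).trans
    (mul_le_mul_of_nonneg_right ha (norm_nonneg _))

lemma abs_two_mul_add_le {L N w a b : ℝ} (hL : 0 ≤ L) (hN : 0 ≤ N) (ha : |a| ≤ L * √N * w)
    (hb : |b| ≤ L * √N * w) : |2 * a + b| ≤ 3 / 2 * L * (w ^ 2 + N) := by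
  have h1 : 2 * (√N * w) ≤ w ^ 2 + N := by
    have := two_mul_le_add_sq (√N) w
    rw [Real.sq_sqrt hN] at this
    linarith
  have h2 := mul_le_mul_of_nonneg_left h1 hL
  refine (abs_add_le _ _).trans ?_
  rw [abs_mul, abs_two]
  linarith

/-- Both `Xu` and, by Poincaré, `u` have norm at most `L‖∇u‖`. The total is at most `3L ‖∇u‖ ‖∂ₜu‖`,
and the arithmetic–geometric mean halves the constant. -/
lemma abs_momentum_le (i : Fin 3) (h : IsWaveSolution T.interior u₀ u₁ u Du) {t : ℝ}
    (ht : 0 ≤ t) : |momentum T i u Du t| ≤ 3 / 2 * longestSide T * energy u Du 0 := by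
  have hL := longestSide_nonneg T
  have hd : ∀ x ∈ T.interior, dist x (T.points i) ≤ longestSide T :=
    fun x hx => dist_le_of_mem_interior T i hx
  rw [← energy_eq_energy_zero h ht, energy_eq]
  exact abs_two_mul_add_le hL (normSq_nonneg _)
    (abs_re_inner_le (norm_radial_le (isBounded_interior T) (measurableSet_interior T) hL hd _))
    (abs_re_inner_le (norm_le_of_mem_H10 (q := (u t, Du t)) (isBounded_interior T)
      (measurableSet_interior T) hL hd (h.dirichlet t ht)))

lemma continuousOn_rellich (i : Fin 3) (h : IsWaveSolution T.interior u₀ u₁ u Du) :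
    ContinuousOn (fun t => rellich T i (Du t) (timeDeriv (timeDeriv u) t)) (Ici 0) := by
  have h1 := h.continuousOn_timeDeriv_two
  have h2 := h.contDiffOn_grad.continuousOn
  have h3 : ContinuousOn (fun t => radial (isBounded_interior T) (T.points i) (Du t)) (Ici 0) :=
    (radial (isBounded_interior T) (T.points i)).continuous.comp_continuousOn h2
  exact continuousOn_const.mul (Complex.continuous_re.comp_continuousOn (h3.inner h1))

lemma intervalIntegrable_rellich (i : Fin 3) (h : IsWaveSolution T.interior u₀ u₁ u Du) {τ : ℝ}
    (hτ : 0 ≤ τ) :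
    IntervalIntegrable (fun t => rellich T i (Du t) (timeDeriv (timeDeriv u) t)) volume 0 τ := by
  refine ContinuousOn.intervalIntegrable ((continuousOn_rellich i h).mono ?_)
  rw [uIcc_of_le hτ]
  exact Icc_subset_Ici_self

lemma integral_rellich (i : Fin 3) (h : IsWaveSolution T.interior u₀ u₁ u Du) {τ : ℝ}
    (hτ : 0 ≤ τ) :
    ∫ t in (0 : ℝ)..τ, rellich T i (Du t) (timeDeriv (timeDeriv u) t)
      = τ * energy u Du 0 + (momentum T i u Du τ - momentum T i u Du 0) := by
  have hi := intervalIntegrable_rellich i h hτ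
  have := intervalIntegral.integral_eq_sub_of_hasDeriv_right_of_le hτ
    (f := momentum T i u Du) (fun t ht =>
      ((hasDerivWithinAt_momentum i h ht.1).continuousWithinAt).mono Icc_subset_Ici_self)
    (fun t ht => (hasDerivWithinAt_momentum i h ht.1.le).mono
      fun s hs => ht.1.le.trans (le_of_lt hs))
    (hi.sub intervalIntegrable_const)
  rw [intervalIntegral.integral_sub hi intervalIntegrable_const,
    intervalIntegral.integral_const, sub_zero, smul_eq_mul] at this
  linarith

/-! ### Neumann data of a wave -/

lemma exists_isNormalDeriv (h : IsWaveSolution T.interior u₀ u₁ u Du) :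
    ∃ g : ℝ → Plane → ℂ, ∀ t : ℝ, 0 ≤ t → IsNormalDeriv T (Du t) (g t) := by
  have : ∀ t : ℝ, ∃ g : Plane → ℂ, 0 ≤ t → IsNormalDeriv T (Du t) g := by
    intro t
    by_cases ht : 0 ≤ t
    · obtain ⟨g, hg, hgreen⟩ := exists_greenFormula (h.dirichlet t ht) (h.wave t ht)
      exact ⟨g, fun _ => ⟨hg, _, h.wave t ht, hgreen⟩⟩
    · exact ⟨0, fun h => absurd h ht⟩
  exact ⟨fun t => (this t).choose, fun t => (this t).choose_spec⟩

/-- The function `f` in the definition of the normal derivative must be `∂ₜ²u`, by uniqueness of the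
weak divergence, so the Rellich identity applies to every representative `g`. -/
lemma integral_side_eq (i : Fin 3) (h : IsWaveSolution T.interior u₀ u₁ u Du) {t : ℝ}
    (ht : 0 ≤ t) {g : Plane → ℂ} (hg : IsNormalDeriv T (Du t) g) :
    ∫ x in side T i, ‖g x‖ ^ 2 ∂arclength
      = (T.height i)⁻¹ * rellich T i (Du t) (timeDeriv (timeDeriv u) t) := by
  obtain ⟨hmem, f, hf, hgreen⟩ := hg
  obtain rfl : f = timeDeriv (timeDeriv u) t :=
    isWeakDiv_unique (isOpen_interior T) (isBounded_interior T) hf (h.wave t ht)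
  rw [← height_mul_integral_eq i (h.dirichlet t ht) hf hmem hgreen,
    inv_mul_cancel_left₀ (T.height_pos i).ne']

/-- Converts the additive error to a relative one. If the energy vanishes, so does the error, and `r
= 0` works. -/
lemma exists_relative_error {E δ τ L : ℝ} (hE : 0 ≤ E) (hτ : 0 < τ) (hL : 0 ≤ L)
    (hδ : |δ| ≤ 3 * L * E) : ∃ r : ℝ, |r| ≤ 3 * (L / τ) ∧ τ * E + δ = τ * E * (1 + r) := by
  rcases hE.eq_or_lt with rfl | hE
  · refine ⟨0, by rw [abs_zero]; positivity, ?_⟩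
    rw [mul_zero, abs_nonpos_iff] at hδ
    simp [hδ]
  · refine ⟨δ / (τ * E), ?_, by field_simp⟩
    rw [abs_div, abs_of_pos (by positivity : 0 < τ * E), div_le_iff₀ (by positivity)]
    calc |δ| ≤ 3 * L * E := hδ
      _ = 3 * (L / τ) * (τ * E) := by field_simp

end Tri

end

end TriangleWave

end

theorem theorem1 :
    ∃ C : ℝ, 0 < C ∧
      ∀ (T : Affine.Triangle ℝ Plane) (u₀ u₁ : L2 T.interior),
        MemH10 T.interior u₀ → MemSobolevAll T.interior u₀ →
        MemH10 T.interior u₁ → MemSobolevAll T.interior u₁ →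
        ∀ (u : ℝ → L2 T.interior) (Du : ℝ → Fin 2 → L2 T.interior),
          IsWaveSolution T.interior u₀ u₁ u Du →
          -- the energy is conserved
          (∀ t : ℝ, 0 ≤ t → energy u Du t = energy u Du 0) ∧
          -- the Neumann data `∂_ν u` exist in `L²(∂Ω)` at every time
          (∃ g : ℝ → Plane → ℂ, ∀ t : ℝ, 0 ≤ t → IsNormalDeriv T (Du t) (g t)) ∧
          -- and satisfy the asymptotics on each of the three sides
          ∀ g : ℝ → Plane → ℂ, (∀ t : ℝ, 0 ≤ t → IsNormalDeriv T (Du t) (g t)) →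
            ∀ (i : Fin 3) (τ : ℝ), 0 < τ →
              IntervalIntegrable (fun t => ∫ x in side T i, ‖g t x‖ ^ 2 ∂arclength)
                MeasureTheory.volume 0 τ ∧
              ∃ r : ℝ, |r| ≤ C * (longestSide T / τ) ∧
                ∫ t in (0 : ℝ)..τ, ∫ x in side T i, ‖g t x‖ ^ 2 ∂arclength
                  = τ / T.height i * energy u Du 0 * (1 + r) := by
  -- The constant is twice the bound `3/2` for the momentum, once for each endpoint in time.
  refine ⟨3, by norm_num, fun T u₀ u₁ _ _ _ _ u Du h =>
    ⟨fun t ht => Tri.energy_eq_energy_zero h ht, Tri.exists_isNormalDeriv h, ?_⟩⟩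
  intro g hg i τ hτ
  -- No measurability of `g` in time is given. Integrability comes from this identity, whose left
  -- side is continuous in time.
  have heq : EqOn (fun t => (T.height i)⁻¹ * Tri.rellich T i (Du t) (timeDeriv (timeDeriv u) t))
      (fun t => ∫ x in side T i, ‖g t x‖ ^ 2 ∂arclength) (uIcc 0 τ) := by
    intro t ht
    rw [uIcc_of_le hτ.le] at ht
    exact (Tri.integral_side_eq i h ht.1 (hg t ht.1)).symm
  refine ⟨((Tri.intervalIntegrable_rellich i h hτ.le).const_mul _).congr
    fun t ht => heq (uIoc_subset_uIcc ht), ?_⟩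
  have hδ : |Tri.momentum T i u Du τ - Tri.momentum T i u Du 0|
      ≤ 3 * longestSide T * energy u Du 0 := by
    refine (abs_sub _ _).trans ?_
    linarith [Tri.abs_momentum_le i h hτ.le, Tri.abs_momentum_le i h le_rfl]
  obtain ⟨r, hr, he⟩ := Tri.exists_relative_error (Tri.energy_nonneg 0) hτ
    (Tri.longestSide_nonneg T) hδ
  refine ⟨r, hr, ?_⟩
  rw [← intervalIntegral.integral_congr heq, intervalIntegral.integral_const_mul,
    Tri.integral_rellich i h hτ.le, he]
  ring
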